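/- Let $\gamma^0=\begin{pmatrix}0&1\\1&0\end{pmatrix}$, $\gamma^1=\begin{pmatrix}0&-1\\1&0\end{pmatrix}$, $\gamma_0=\gamma^0$, $\gamma_1=-\gamma^1$, $\partial_0=\partial_t$, $\partial_1=\partial_x$, $\square=\partial_t^2-\partial_x^2$ and $M\in\mathbb R$. Consider the Cauchy problem for the Maxwell–Dirac system in Lorenz gauge in one space dimension, $$(-i\gamma^\mu\partial_\mu+M)\psi=A_\mu\gamma^\mu\psi,\qquad \square A_\mu=-\overline\psi\gamma_\mu\psi\qquad(\mu=0,1),$$ $$\psi(0,x)=\psi_0(x),\qquad A_\mu(0,x)=a_\mu(x),\qquad \partial_tA_\mu(0,x)=b_\mu(x),$$ for $\psi\colon\mathbb R^{1+1}\to\mathbb C^2$ and $A_0,A_1\colon\mathbb R^{1+1}\to\mathbb R$, where $\overline\psi=\psi^*\gamma^0$ and repeated upper and lower indices are summed. Let $Y$ be the space of bounded absolutely continuous functions $f\colon\mathbb R\to\mathbb R$ with $f'\in L^1(\mathbb R)$, with norm $\|f\|_Y=\|f\|_{L^\infty}+\|f'\|_{L^1}$, and let $X_0=L^2(\mathbb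 R;\mathbb C^2)\times Y^2\times L^1(\mathbb R;\mathbb R)^2$. Then the problem is globally well posed for data $(\psi_0,a_\mu,b_\mu)\in X_0$. That is, for every $T>0$: (i) for all data in $X_0$ there is a unique solution $(\psi,A_\mu)$ on $(-T,T)\times\mathbb R$, in the sense of distributions, with $(\psi,A_\mu,\partial_tA_\mu)\in C([-T,T];X_0)$ and with the given initial data; (ii) the map from the data to $(\psi,A_\mu,\partial_tA_\mu)$ is continuous from $X_0$ to $C([-T,T];X_0)$; (iii) higher regularity persists: if $N\in\mathbb N$ and $\partial_x^j(\psi_0,a_\mu,b_\mu)\in X_0$ for $0\le j\le N$, then $\partial_t^j\partial_x^k(\psi,A_\mu,\partial_tA_\mu)\in C([-T,T];X_0)$ for all $j,k\ge0$ with $j+k\le N$ (derivatives in the sense of distributions); (iv) for all data in $X_0$, the solution $(\psi,A_\mu,\partial_tA_\mu)$ is a limit in $C([-T,T];X_0)$ of solutions with $\psi$ and $A_\mu$ of class $C^\infty$. -/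

import Mathlib

open MeasureTheory Filter Topology Set TopologicalSpace
open scoped ContDiff BoundedContinuousFunction Distributions Matrix

namespace MaxwellDirac

noncomputable section

/-! ### Function spaces on the real line -/

/-- The spinor space `ℂ²`. -/
abbrev Spinor : Type := EuclideanSpace ℂ (Fin 2)

/-- The space `L²(ℝ; ℂ²)`. -/
abbrev L2 : Type := Lp Spinor 2 (volume : Measure ℝ)

/-- The space `L¹(ℝ; ℝ)`. -/
abbrev L1 : Type := Lp ℝ 1 (volume : Measure ℝ)

/-- Pairs `(f, f')` with `f` bounded and continuous, `f' ∈ L¹(ℝ)` and `f(b) - f(a) = ∫ₐᵇ f'` for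
all `a, b`: thus `f` is absolutely continuous and `f'` is its (uniquely determined) derivative.
The norm, inherited from the `ℓ¹` product, is `‖f‖_∞ + ‖f'‖_{L¹}`. -/
def YSubmodule : Submodule ℝ (WithLp 1 ((ℝ →ᵇ ℝ) × L1)) where
  carrier := {p | ∀ a b : ℝ, p.fst b - p.fst a = ∫ x in a..b, p.snd x}
  zero_mem' := by
    intro a b
    simp
  add_mem' := by
    intro p q hp hq a b
    have h : ∫ x in a..b, (p.snd + q.snd : L1) x = ∫ x in a..b, (p.snd x + q.snd x) :=
      intervalIntegral.integral_congr_ae ((Lp.coeFn_add p.snd q.snd).mono fun x hx _ => hx)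
    rw [WithLp.add_snd, h, intervalIntegral.integral_add
      (L1.integrable_coeFn p.snd).intervalIntegrable
      (L1.integrable_coeFn q.snd).intervalIntegrable, ← hp a b, ← hq a b]
    simp only [WithLp.add_fst, BoundedContinuousFunction.coe_add, Pi.add_apply]
    ring
  smul_mem' := by
    intro c p hp a b
    have h : ∫ x in a..b, (c • p.snd : L1) x = ∫ x in a..b, c * p.snd x :=
      intervalIntegral.integral_congr_ae ((Lp.coeFn_smul c p.snd).mono fun x hx _ => hx)
    rw [WithLp.smul_snd, h, intervalIntegral.integral_const_mul, ← hp a b]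
    simp only [WithLp.smul_fst, BoundedContinuousFunction.coe_smul, smul_eq_mul]
    ring

/-- The space `Y` of bounded, absolutely continuous real functions with integrable derivative,
with the norm `‖f‖_∞ + ‖f'‖_{L¹}`. -/
abbrev Y : Type := ↥YSubmodule

/-- The function underlying an element of `Y`. -/
def Y.fn (f : Y) : ℝ → ℝ := f.1.fst

/-- The data space `X₀ = L² × Y × L¹`; its elements are `(ψ, (A₀, A₁), (B₀, B₁))`. -/
abbrev X0 : Type := L2 × (Fin 2 → Y) × (Fin 2 → L1)

/-- The space `C([-T, T]; X₀)`, with the topology of uniform convergence. -/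
abbrev CX0 (T : ℝ) : Type := C(↥(Icc (-T) T), X0)

/-! ### The Dirac matrices -/

/-- The matrices `γ⁰, γ¹`. -/
def γ : Fin 2 → Matrix (Fin 2) (Fin 2) ℂ :=
  ![!![0, 1; 1, 0], !![0, -1; 1, 0]]

/-- The diagonal entries of the metric `diag(1, -1)`. -/
def g : Fin 2 → ℝ := ![1, -1]

/-- The matrices with lowered index, `γ_μ = g_{μν} γ^ν`. -/
def γLow (μ : Fin 2) : Matrix (Fin 2) (Fin 2) ℂ := (g μ : ℂ) • γ μ

/-- The action of a matrix on spinors. -/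
def act (m : Matrix (Fin 2) (Fin 2) ℂ) : Spinor →L[ℂ] Spinor :=
  Matrix.toEuclideanCLM (n := Fin 2) (𝕜 := ℂ) m

/-- The quadratic expression `ψ̄ γ_μ ψ`, where `ψ̄ = ψ* γ⁰`. -/
def current (μ : Fin 2) (v : Spinor) : ℂ :=
  (star v.ofLp ᵥ* γ 0) ⬝ᵥ (γLow μ *ᵥ v.ofLp)

/-! ### Derivatives and distributional equations -/

/-- Lebesgue measure on the time interval `[-T, T]`. -/
def dt (T : ℝ) : Measure ↥(Icc (-T) T) := (volume : Measure ℝ).comap Subtype.val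

/-- The partial derivatives `∂₀ = ∂_t`, `∂₁ = ∂_x` of a function of `(t, x)`. -/
def pd (μ : Fin 2) (φ : ℝ × ℝ → ℝ) (p : ℝ × ℝ) : ℝ :=
  fderiv ℝ φ p ((![(1, 0), (0, 1)] : Fin 2 → ℝ × ℝ) μ)

/-- The d'Alembertian `∂_t² - ∂_x²`. -/
def box (φ : ℝ × ℝ → ℝ) (p : ℝ × ℝ) : ℝ := ∑ μ, g μ * pd μ (pd μ φ) p

/-- The open strip `(-T, T) × ℝ`. -/
def strip (T : ℝ) : Opens (ℝ × ℝ) := ⟨Ioo (-T) T ×ˢ univ, isOpen_Ioo.prod isOpen_univ⟩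

/-- The pairing of an element of `X₀` with a scalar function on `ℝ`, component by component. -/
def pairLine (d : X0) (φ : ℝ → ℝ) : Spinor × (Fin 2 → ℝ) × (Fin 2 → ℝ) :=
  (∫ x, φ x • d.1 x, fun μ => ∫ x, φ x * (d.2.1 μ).fn x, fun μ => ∫ x, φ x * d.2.2 μ x)

/-- `e = ∂_x^j d` in the sense of distributions on `ℝ`, component by component. -/
def IsSpaceDeriv (j : ℕ) (d e : X0) : Prop :=
  ∀ φ : 𝓓((⊤ : Opens ℝ), ℝ), pairLine e φ = (-1 : ℝ) ^ j • pairLine d (iteratedDeriv j φ)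

/-- The pairing of an element of `C([-T, T]; X₀)` with a scalar function on spacetime, component
by component. -/
def pairStrip {T : ℝ} (u : CX0 T) (φ : ℝ × ℝ → ℝ) : Spinor × (Fin 2 → ℝ) × (Fin 2 → ℝ) :=
  (∫ t, (∫ x, φ (t, x) • (u t).1 x) ∂(dt T),
    fun μ => ∫ t, (∫ x, φ (t, x) * ((u t).2.1 μ).fn x) ∂(dt T),
    fun μ => ∫ t, (∫ x, φ (t, x) * (u t).2.2 μ x) ∂(dt T))

/-- `w = ∂_t^j ∂_x^k u` in the sense of distributions on `(-T, T) × ℝ`, component by component. -/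
def IsMixedDeriv {T : ℝ} (j k : ℕ) (u w : CX0 T) : Prop :=
  ∀ φ : 𝓓(strip T, ℝ),
    pairStrip w φ = (-1 : ℝ) ^ (j + k) • pairStrip u ((pd 0)^[j] ((pd 1)^[k] φ))

/-- `∂_t A_μ = B_μ` in the sense of distributions on `(-T, T) × ℝ`, where `u = (ψ, A, B)`. -/
def VelocityEq {T : ℝ} (u : CX0 T) : Prop :=
  ∀ φ : 𝓓(strip T, ℝ), ∀ μ : Fin 2,
    ∫ t, (∫ x, φ (t, x) * (u t).2.2 μ x) ∂(dt T) =
      -∫ t, (∫ x, pd 0 φ (t, x) * ((u t).2.1 μ).fn x) ∂(dt T)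

/-- The Dirac equation `(-i γ^μ ∂_μ + M) ψ = A_μ γ^μ ψ` in the sense of distributions on
`(-T, T) × ℝ`. -/
def DiracEq {T : ℝ} (M : ℝ) (u : CX0 T) : Prop :=
  ∀ φ : 𝓓(strip T, ℝ),
    ∫ t, (∫ x,
        ((∑ μ, (Complex.I * (pd μ φ (t, x) : ℂ)) • act (γ μ) ((u t).1 x)) +
          (M * φ (t, x)) • (u t).1 x)) ∂(dt T) =
      ∫ t, (∫ x,
        φ (t, x) • ∑ μ, ((u t).2.1 μ).fn x • act (γ μ) ((u t).1 x)) ∂(dt T)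

/-- The wave equations `□ A_μ = - ψ̄ γ_μ ψ` in the sense of distributions on `(-T, T) × ℝ`. -/
def WaveEq {T : ℝ} (u : CX0 T) : Prop :=
  ∀ φ : 𝓓(strip T, ℝ), ∀ μ : Fin 2,
    ∫ t, (∫ x, ((box φ (t, x) * ((u t).2.1 μ).fn x : ℝ) : ℂ)) ∂(dt T) =
      -∫ t, (∫ x, (φ (t, x) : ℂ) * current μ ((u t).1 x)) ∂(dt T)

/-- `u = (ψ, A, ∂_t A) ∈ C([-T, T]; X₀)` solves the Maxwell-Dirac system with mass `M` on
`(-T, T) × ℝ` in the sense of distributions, with initial data `d = (ψ₀, a, b)` at `t = 0`. -/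
structure IsSolution {T : ℝ} (hT : 0 < T) (M : ℝ) (d : X0) (u : CX0 T) : Prop where
  initial : u ⟨0, by constructor <;> linarith⟩ = d
  velocity : VelocityEq u
  dirac : DiracEq M u
  wave : WaveEq u

/-- `u = (ψ, A, ∂_t A)` is smooth: `ψ` and `A` are given by `C^∞` functions of `(t, x)`. -/
def IsSmooth {T : ℝ} (u : CX0 T) : Prop :=
  ∃ (Ψ : ℝ × ℝ → Spinor) (A : Fin 2 → ℝ × ℝ → ℝ),
    ContDiff ℝ ∞ Ψ ∧ (∀ μ, ContDiff ℝ ∞ (A μ)) ∧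
    ∀ t : Icc (-T) T,
      ((u t).1 =ᵐ[volume] fun x => Ψ (t, x)) ∧
      ∀ μ, ((u t).2.1 μ).fn = (fun x => A μ (t, x)) ∧
        ((u t).2.2 μ =ᵐ[volume] fun x => pd 0 (A μ) (t, x))

end

end MaxwellDirac

open MeasureTheory Filter Topology Set TopologicalSpace
open scoped ContDiff BoundedContinuousFunction Distributions Matrix

namespace MaxwellDirac

noncomputable section

open scoped Interval
set_option autoImplicit false

/-! In one space dimension the wave operator factors. With P = ∂ₜA + ∂ₓA and Q = ∂ₜA − ∂ₓA, and with
ψ split along the eigenvectors of γ⁰γ¹, the system is of first order: each component is carried to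
the left or to the right with unit speed, and the coupling is linear plus quadratic, without
derivatives. The potential is recovered from ∂ₓA = (P − Q)/2 and its limit at −∞, which is
conserved; in this way Y is ℝ × L¹ (`Y.equiv`). Since L²·L² ⊂ L¹ and L^∞·L² ⊂ L², the quadratic term
is a bounded bilinear map on the space `State`. Undoing the free transport (interaction picture)
leaves an ordinary differential equation with a quadratic field, jointly continuous in time and
state although its coefficients are only strongly continuous in time.

For such a field the integral equation on [-T, T] reads `defect U = const d`. The derivative of the
defect is the identity minus a Volterra operator, so it is invertible whatever T is. This gives
uniqueness and Lipschitz dependence on bounded sets, and makes the set of data that have a solution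
on [-T, T] open. The set is closed because of the a priori bound `mdSystem_apriori`: the charge, the
L² norm of ψ, is conserved, and the sources of P and Q are quadratic in ψ alone, so their L¹ norms
grow at most linearly. Hence all data have global solutions (`exists_isIntegralCurve`).

Distributional solutions are identified with integral curves by testing with η(t)χ(x + ct), on which
the transport operator acts only through η' (`IsTranslation.eq_add_integral`, resting on the lemma
of du Bois-Reymond). An integrability argument shows that the limits of A at −∞ do not move
(`lim_eq_of_velocity`).

For regularity, x-derivatives are read as derivatives of the orbit h ↦ τ_h z under translations. A
translate of a solution is a solution, and by the inverse function theorem a differentiable family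
of data gives a differentiable family of solutions; its derivative solves the linearized system,
which together with the original one is again a transport system. Induction gives joint C^m
regularity in (t, h) (`contDiff_of_contDiff_orbit`), and partial derivatives at h = 0 are weak
derivatives of the solution.

Smooth approximation mollifies the orbit of the datum. Smooth pointwise representatives come from
composing the orbit of the solution with continuous linear functionals: evaluation at 0 for A, and a
formula for a point value in terms of ψ and ∂ₓψ in L² (`ae_eq_endpoint`). -/

/-! ### Volterra operators on `C([-T, T]; Z)` -/

section Volterra

variable {Z : Type*} [NormedAddCommGroup Z] [NormedSpace ℝ Z]

/-- The curves `C([-T, T]; Z)`. -/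
abbrev Curve (T : ℝ) (Z : Type*) [TopologicalSpace Z] : Type _ := C(↥(Icc (-T) T), Z)

/-- The extension of a curve on `[-T, T]` to `ℝ` by constants. -/
def extend {T : ℝ} (hT : 0 ≤ T) (W : Curve T Z) : ℝ → Z :=
  IccExtend (neg_le_self hT) W

variable {T : ℝ} (hT : 0 ≤ T)

theorem continuous_extend (W : Curve T Z) : Continuous (extend hT W) :=
  W.continuous.Icc_extend'

theorem extend_apply (W : Curve T Z) (t : Icc (-T) T) : extend hT W t = W t :=
  IccExtend_val _ _ _

theorem extend_of_mem (W : Curve T Z) {t : ℝ} (ht : t ∈ Icc (-T) T) :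
    extend hT W t = W ⟨t, ht⟩ := IccExtend_of_mem _ _ _

theorem norm_extend_le (W : Curve T Z) (t : ℝ) : ‖extend hT W t‖ ≤ ‖W‖ :=
  W.norm_coe_le_norm _

theorem mem_Icc_of_mem_uIoc {t s : ℝ} (ht : t ∈ Icc (-T) T) (hs : s ∈ Ι 0 t) :
    s ∈ Icc (-T) T := by
  rcases mem_uIoc.1 hs with h | h <;> constructor <;> linarith [h.1, h.2, ht.1, ht.2]

theorem mem_Icc_of_mem_uIcc {t s : ℝ} (ht : t ∈ Icc (-T) T) (hs : s ∈ uIcc 0 t) :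
    s ∈ Icc (-T) T := by
  rcases mem_uIcc.1 hs with h | h <;> constructor <;> linarith [h.1, h.2, ht.1, ht.2]

/-- The operator `W ↦ ∫₀ᵗ W`. -/
def primitive [CompleteSpace Z] : Curve T Z →L[ℝ] Curve T Z :=
  LinearMap.mkContinuous
    { toFun := fun W => ⟨fun t => ∫ s in (0 : ℝ)..t, extend hT W s,
        (intervalIntegral.continuous_primitive
          (fun a b => (continuous_extend hT W).intervalIntegrable a b) 0).comp
          continuous_subtype_val⟩
      map_add' := by
        intro V W
        ext t
        exact intervalIntegral.integral_add ((continuous_extend hT V).intervalIntegrable _ _)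
          ((continuous_extend hT W).intervalIntegrable _ _)
      map_smul' := by
        intro c W
        ext t
        exact intervalIntegral.integral_smul c _ } T (by
    intro W
    rw [ContinuousMap.norm_le _ (by positivity)]
    intro t
    have h : ‖∫ s in (0 : ℝ)..t, extend hT W s‖ ≤ ‖W‖ * |(t : ℝ) - 0| :=
      intervalIntegral.norm_integral_le_of_norm_le_const fun s _ => norm_extend_le hT W s
    have ht : |(t : ℝ) - 0| ≤ T := by
      rw [sub_zero, abs_le]; exact t.2
    calc _ ≤ ‖W‖ * |(t : ℝ) - 0| := h
      _ ≤ T * ‖W‖ := by rw [mul_comm T]; gcongr)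

/-- `A` is a Volterra operator with constant `c`. -/
def IsVolterra (c : ℝ) (A : Curve T Z →L[ℝ] Curve T Z) : Prop :=
  ∀ (W : Curve T Z) (t : Icc (-T) T), ‖A W t‖ ≤ c * ∫ s in Ι 0 (t : ℝ), ‖extend hT W s‖

/-- Each application of `A` integrates the previous power of |s| once more from 0 to t, which
produces the factorial. -/
theorem IsVolterra.norm_pow_apply_le {c : ℝ} (hc : 0 ≤ c) {A : Curve T Z →L[ℝ] Curve T Z}
    (hA : IsVolterra hT c A) (n : ℕ) (W : Curve T Z) (t : Icc (-T) T) :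
    ‖(A ^ n) W t‖ ≤ (c * |(t : ℝ)|) ^ n / n.factorial * ‖W‖ := by
  induction n generalizing t with
  | zero => simpa using W.norm_coe_le_norm t
  | succ n ih =>
    rw [pow_succ' A n]
    refine (hA _ t).trans ?_
    have h1 : ∫ s in Ι 0 (t : ℝ), ‖extend hT ((A ^ n) W) s‖ ≤
        ∫ s in Ι 0 (t : ℝ), c ^ n / n.factorial * ‖W‖ * |s - 0| ^ n := by
      refine setIntegral_mono_on ?_ ?_ measurableSet_uIoc fun s hs => ?_
      · exact ((continuous_extend hT _).norm.integrableOn_uIoc)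
      · exact Continuous.integrableOn_uIoc (by fun_prop)
      · have hs' := mem_Icc_of_mem_uIoc t.2 hs
        rw [extend_of_mem hT _ hs']
        refine (ih ⟨s, hs'⟩).trans (le_of_eq ?_)
        simp only [sub_zero, mul_pow]
        ring
    refine (mul_le_mul_of_nonneg_left h1 hc).trans (le_of_eq ?_)
    rw [integral_const_mul, integral_pow_abs_sub_uIoc, Nat.factorial_succ]
    push_cast
    field_simp
    ring_nf

theorem IsVolterra.norm_pow_le {c : ℝ} (hc : 0 ≤ c) {A : Curve T Z →L[ℝ] Curve T Z}
    (hA : IsVolterra hT c A) (n : ℕ) : ‖A ^ n‖ ≤ (c * T) ^ n / n.factorial := by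
  refine ContinuousLinearMap.opNorm_le_bound _ (by positivity) fun W => ?_
  rw [ContinuousMap.norm_le _ (by positivity)]
  intro t
  refine (hA.norm_pow_apply_le hT hc n W t).trans ?_
  have : |(t : ℝ)| ≤ T := abs_le.2 t.2
  gcongr

/-- `A` itself need not be a contraction, but some power has norm less than one. Then 1 - A ^ n is
invertible, and it is the product of 1 - A with a geometric sum commuting with it. -/
theorem IsVolterra.isUnit [CompleteSpace Z] {c : ℝ} (hc : 0 ≤ c)
    {A : Curve T Z →L[ℝ] Curve T Z} (hA : IsVolterra hT c A) : IsUnit (1 - A) := by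
  obtain ⟨n, hn⟩ := ((FloorSemiring.tendsto_pow_div_factorial_atTop (c * T)).eventually
    (gt_mem_nhds one_pos)).exists
  have h1 : IsUnit (1 - A ^ n) :=
    (Units.oneSub (A ^ n) ((hA.norm_pow_le hT hc n).trans_lt hn)).isUnit
  rw [← mul_neg_geom_sum A n] at h1
  refine ((Commute.isUnit_mul_iff ?_).1 h1).1
  exact (mul_neg_geom_sum A n).trans (geom_sum_mul_neg A n).symm

/-- A Volterra operator satisfies a Gronwall estimate, depending only on its constant. -/
theorem exists_volterra_bound (c : ℝ) (hc : 0 ≤ c) :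
    ∃ C : ℝ, 0 ≤ C ∧ ∀ A : Curve T Z →L[ℝ] Curve T Z, IsVolterra hT c A →
      ∀ W, ‖W‖ ≤ C * ‖W - A W‖ := by
  obtain ⟨n, hn⟩ := ((FloorSemiring.tendsto_pow_div_factorial_atTop (c * T)).eventually
    (gt_mem_nhds (by norm_num : (0 : ℝ) < 1 / 2))).exists
  -- W telescopes as the geometric sum applied to W - A W, plus A ^ n W. The remainder has norm at
  -- most ‖W‖ / 2 and is absorbed on the left, whence the factor 2.
  refine ⟨2 * ∑ k ∈ Finset.range n, (c * T) ^ k / k.factorial, by positivity, fun A hA W => ?_⟩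
  have h1 : W = (∑ k ∈ Finset.range n, A ^ k) (W - A W) + (A ^ n) W := by
    have h := congrArg (fun Q : Curve T Z →L[ℝ] Curve T Z => Q W) (geom_sum_mul_neg A n)
    simp only [mul_apply_eq_comp, sub_apply,
      one_apply_eq_self] at h
    rw [h, sub_add_cancel]
  have h2 : ‖(∑ k ∈ Finset.range n, A ^ k) (W - A W)‖ ≤
      (∑ k ∈ Finset.range n, (c * T) ^ k / k.factorial) * ‖W - A W‖ := by
    refine ContinuousLinearMap.le_of_opNorm_le _ ?_ _
    exact (norm_sum_le _ _).trans (Finset.sum_le_sum fun k _ => hA.norm_pow_le hT hc k)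
  have h3 : ‖(A ^ n) W‖ ≤ 1 / 2 * ‖W‖ :=
    ContinuousLinearMap.le_of_opNorm_le _ ((hA.norm_pow_le hT hc n).trans hn.le) _
  have h4 : ‖W‖ ≤ ‖(∑ k ∈ Finset.range n, A ^ k) (W - A W)‖ + ‖(A ^ n) W‖ := by
    conv_lhs => rw [h1]
    exact norm_add_le _ _
  linarith

end Volterra


/-! ### Ordinary differential equations with quadratic right-hand side -/

/-- A time-dependent vector field `z ↦ lin t z + quad t z z` on a Banach space, strongly continuous
in time and bounded uniformly in time. -/
structure QuadField (Z : Type*) [NormedAddCommGroup Z] [NormedSpace ℝ Z] where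
  /-- the linear part -/
  lin : ℝ → Z →L[ℝ] Z
  /-- the quadratic part -/
  quad : ℝ → Z →L[ℝ] Z →L[ℝ] Z
  /-- a uniform bound for the coefficients -/
  bound : ℝ
  bound_nonneg : 0 ≤ bound
  norm_lin_le : ∀ t z, ‖lin t z‖ ≤ bound * ‖z‖
  norm_quad_le : ∀ t z w, ‖quad t z w‖ ≤ bound * ‖z‖ * ‖w‖
  continuous_lin : Continuous fun p : ℝ × Z => lin p.1 p.2
  continuous_quad : Continuous fun p : ℝ × Z × Z => quad p.1 p.2.1 p.2.2

namespace QuadField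

variable {Z : Type*} [NormedAddCommGroup Z] [NormedSpace ℝ Z] (Q : QuadField Z)
  {T : ℝ} (hT : 0 ≤ T)

/-- The vector field at time `t`. -/
def field (t : ℝ) (z : Z) : Z := Q.lin t z + Q.quad t z z

theorem continuous_field : Continuous fun p : ℝ × Z => Q.field p.1 p.2 :=
  Q.continuous_lin.add (Q.continuous_quad.comp (by fun_prop : Continuous fun p : ℝ × Z =>
    (p.1, p.2, p.2)))

theorem continuous_field_comp {u : ℝ → Z} (hu : Continuous u) :
    Continuous fun t => Q.field t (u t) :=
  Q.continuous_field.comp (continuous_id.prodMk hu)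

theorem continuous_variation {u w : ℝ → Z} (hu : Continuous u) (hw : Continuous w) :
    Continuous fun t => Q.lin t (w t) + Q.quad t (u t) (w t) + Q.quad t (w t) (u t) :=
  ((Q.continuous_lin.comp (continuous_id.prodMk hw)).add
    (Q.continuous_quad.comp (continuous_id.prodMk (hu.prodMk hw)))).add
    (Q.continuous_quad.comp (continuous_id.prodMk (hw.prodMk hu)))

/-- The action of the linear part on curves. -/
def linCurve : Curve T Z →L[ℝ] Curve T Z :=
  LinearMap.mkContinuous
    { toFun := fun W => ⟨fun t => Q.lin t (W t),
        Q.continuous_lin.comp (continuous_subtype_val.prodMk W.continuous)⟩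
      map_add' := fun V W => by ext t; exact map_add (Q.lin t) _ _
      map_smul' := fun c W => by ext t; exact map_smul (Q.lin t) _ _ } Q.bound (by
    intro W
    rw [ContinuousMap.norm_le _ (mul_nonneg Q.bound_nonneg (norm_nonneg _))]
    exact fun t => (Q.norm_lin_le _ _).trans
      (mul_le_mul_of_nonneg_left (W.norm_coe_le_norm t) Q.bound_nonneg))

/-- The action of the quadratic part on curves. -/
def quadCurve : Curve T Z →L[ℝ] Curve T Z →L[ℝ] Curve T Z :=
  LinearMap.mkContinuous₂
    (LinearMap.mk₂ ℝ (fun V W : Curve T Z => (⟨fun t => Q.quad t (V t) (W t),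
        Q.continuous_quad.comp (continuous_subtype_val.prodMk
          (V.continuous.prodMk W.continuous))⟩ : Curve T Z))
      (fun V V' W => by ext t; exact (congrArg (· (W t)) (map_add (Q.quad t) _ _)))
      (fun c V W => by ext t; exact (congrArg (· (W t)) (map_smul (Q.quad t) c _)))
      (fun V W W' => by ext t; exact map_add (Q.quad t (V t)) _ _)
      (fun c V W => by ext t; exact map_smul (Q.quad t (V t)) _ _)) Q.bound (by
    intro V W
    rw [ContinuousMap.norm_le _ (mul_nonneg (mul_nonneg Q.bound_nonneg (norm_nonneg _))
      (norm_nonneg _))]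
    intro t
    refine (Q.norm_quad_le _ _ _).trans ?_
    have := Q.bound_nonneg
    have := V.norm_coe_le_norm t
    have := W.norm_coe_le_norm t
    gcongr)

variable [CompleteSpace Z]

/-- The map `U ↦ U - ∫₀ᵗ field s (U s) ds`, whose value at `U` is the constant `d` if and only if
`U` is an integral curve starting at `d`. -/
def defect (U : Curve T Z) : Curve T Z :=
  U - primitive hT (Q.linCurve U + Q.quadCurve U U)

/-- The Volterra part of the divided difference of `defect`. -/
def slope (U V : Curve T Z) : Curve T Z →L[ℝ] Curve T Z :=
  primitive hT ∘L (Q.linCurve + Q.quadCurve U + Q.quadCurve.flip V)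

theorem slope_apply (U V W : Curve T Z) (t : Icc (-T) T) :
    Q.slope hT U V W t = ∫ s in (0 : ℝ)..t, (Q.lin s (extend hT W s) +
      Q.quad s (extend hT U s) (extend hT W s) + Q.quad s (extend hT W s) (extend hT V s)) := by
  refine intervalIntegral.integral_congr fun s hs => ?_
  have hs' := mem_Icc_of_mem_uIcc t.2 hs
  simp only [extend_of_mem hT _ hs']
  rfl

/-- For a quadratic map the divided difference is exact: q(U, U) − q(V, V) = q(U, U − V) + q(U − V,
V). So the difference of two curves solves a linear Volterra equation without remainder. -/
theorem defect_sub_defect (U V : Curve T Z) :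
    Q.defect hT U - Q.defect hT V = (U - V) - Q.slope hT U V (U - V) := by
  have h : Q.slope hT U V (U - V) = primitive hT (Q.linCurve U + Q.quadCurve U U) -
      primitive hT (Q.linCurve V + Q.quadCurve V V) := by
    rw [← map_sub]
    change primitive hT (Q.linCurve (U - V) + Q.quadCurve U (U - V) + Q.quadCurve (U - V) V) = _
    congr 1
    simp only [map_sub, sub_apply]
    abel
  rw [h, defect, defect]
  abel

/-- In the factor 1 + 2 R, the linear part counts once and each of the two quadratic terms has one
argument of norm at most R. -/
theorem isVolterra_slope (U V : Curve T Z) {R : ℝ} (hU : ‖U‖ ≤ R) (hV : ‖V‖ ≤ R) :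
    IsVolterra hT (Q.bound * (1 + 2 * R)) (Q.slope hT U V) := by
  intro W t
  rw [slope_apply, ← integral_const_mul]
  refine intervalIntegral.norm_integral_le_integral_norm_uIoc.trans ?_
  have hb := Q.bound_nonneg
  have hcW := continuous_extend hT W
  have hcU := continuous_extend hT U
  have hcV := continuous_extend hT V
  refine setIntegral_mono_on (Continuous.integrableOn_uIoc ?_) (Continuous.integrableOn_uIoc ?_)
    measurableSet_uIoc fun s hs => ?_
  · refine Continuous.norm (Continuous.add (Continuous.add ?_ ?_) ?_)
    · exact Q.continuous_lin.comp (continuous_id.prodMk hcW)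
    · exact Q.continuous_quad.comp (continuous_id.prodMk (hcU.prodMk hcW))
    · exact Q.continuous_quad.comp (continuous_id.prodMk (hcW.prodMk hcV))
  · exact continuous_const.mul hcW.norm
  · have h1 := Q.norm_lin_le s (extend hT W s)
    have h2 := Q.norm_quad_le s (extend hT U s) (extend hT W s)
    have h3 := Q.norm_quad_le s (extend hT W s) (extend hT V s)
    have h4 : ‖extend hT U s‖ ≤ R := (norm_extend_le hT U s).trans hU
    have h5 : ‖extend hT V s‖ ≤ R := (norm_extend_le hT V s).trans hV
    have h6 : Q.bound * ‖extend hT U s‖ * ‖extend hT W s‖ ≤ Q.bound * R * ‖extend hT W s‖ := by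
      gcongr
    have h7 : Q.bound * ‖extend hT W s‖ * ‖extend hT V s‖ ≤ Q.bound * ‖extend hT W s‖ * R := by
      gcongr
    refine (norm_add₃_le).trans ?_
    linarith

theorem hasStrictFDerivAt_defect (U : Curve T Z) :
    HasStrictFDerivAt (Q.defect hT) (1 - Q.slope hT U U : Curve T Z →L[ℝ] Curve T Z) U := by
  have h1 : HasStrictFDerivAt (fun U : Curve T Z => Q.quadCurve U U) _ U :=
    (Q.quadCurve (T := T)).hasStrictFDerivAt.clm_apply (hasStrictFDerivAt_id U)
  have h2 := (hasStrictFDerivAt_id U).sub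
    ((primitive hT (Z := Z)).hasStrictFDerivAt.comp U (Q.linCurve.hasStrictFDerivAt.add h1))
  refine h2.congr_fderiv ?_
  ext1 W
  simp only [slope, ContinuousLinearMap.comp_apply, add_apply, sub_apply,
      ContinuousLinearMap.flip_apply, map_add, one_apply_eq_self, ContinuousLinearMap.id_apply,
      add_assoc]

/-- This is the hypothesis of the inverse function theorem, available at every curve and without
smallness of `T`, because the derivative differs from the identity by a Volterra operator. -/
theorem exists_equiv_hasStrictFDerivAt_defect (U : Curve T Z) :
    ∃ e : Curve T Z ≃L[ℝ] Curve T Z,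
      (e : Curve T Z →L[ℝ] Curve T Z) = 1 - Q.slope hT U U ∧
      HasStrictFDerivAt (Q.defect hT) (e : Curve T Z →L[ℝ] Curve T Z) U := by
  obtain ⟨v, hv⟩ := (Q.isVolterra_slope hT U U le_rfl le_rfl).isUnit hT
    (mul_nonneg Q.bound_nonneg (by positivity))
  refine ⟨ContinuousLinearEquiv.unitsEquiv ℝ _ v, ?_, ?_⟩
  · rw [← hv]; rfl
  · have := Q.hasStrictFDerivAt_defect hT U
    rw [← hv] at this
    exact this

/-- Lipschitz dependence of integral curves on the defect, locally uniformly. -/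
theorem exists_norm_sub_le (R : ℝ) (hR : 0 ≤ R) : ∃ C : ℝ, 0 ≤ C ∧ ∀ U V : Curve T Z,
    ‖U‖ ≤ R → ‖V‖ ≤ R → ‖U - V‖ ≤ C * ‖Q.defect hT U - Q.defect hT V‖ := by
  obtain ⟨C, hC, h⟩ := exists_volterra_bound (Z := Z) hT (Q.bound * (1 + 2 * R))
    (mul_nonneg Q.bound_nonneg (by positivity))
  refine ⟨C, hC, fun U V hU hV => ?_⟩
  rw [defect_sub_defect]
  exact h _ (Q.isVolterra_slope hT U V hU hV) _

theorem defect_injective : Function.Injective (Q.defect (Z := Z) hT) := by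
  intro U V h
  obtain ⟨C, -, hC⟩ := Q.exists_norm_sub_le hT (max ‖U‖ ‖V‖) (by positivity)
  have := hC U V (le_max_left _ _) (le_max_right _ _)
  rw [h, sub_self, norm_zero, mul_zero] at this
  exact sub_eq_zero.1 (norm_le_zero_iff.1 this)

/-- `u` may be any function on ℝ that agrees with `U` on the interval, so the integral equation can
be used with curves that live on a longer interval or on the whole line. -/
theorem defect_eq_const_iff (U : Curve T Z) (d : Z) (u : ℝ → Z)
    (hu : ∀ t : Icc (-T) T, U t = u t) :
    Q.defect hT U = ContinuousMap.const _ d ↔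
      ∀ t ∈ Icc (-T) T, u t = d + ∫ s in (0 : ℝ)..t, Q.field s (u s) := by
  have key : ∀ t : Icc (-T) T, Q.defect hT U t = u t - ∫ s in (0 : ℝ)..t, Q.field s (u s) := by
    intro t
    have : primitive hT (Q.linCurve U + Q.quadCurve U U) t =
        ∫ s in (0 : ℝ)..t, Q.field s (u s) := by
      refine intervalIntegral.integral_congr fun s hs => ?_
      have hs' := mem_Icc_of_mem_uIcc t.2 hs
      simp only [extend_of_mem hT _ hs', field]
      rw [← hu ⟨s, hs'⟩]
      rfl
    rw [← this, ← hu t]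
    rfl
  constructor
  · intro h t ht
    have := key ⟨t, ht⟩
    rw [h] at this
    exact (sub_eq_iff_eq_add.1 this.symm)
  · intro h
    ext t
    rw [key t, h t t.2]
    simp

/-- `U` is an integral curve of the field on `ℝ`. -/
def IsIntegralCurve (U : ℝ → Z) : Prop := ∀ t, HasDerivAt U (Q.field t (U t)) t

variable {Q}

theorem IsIntegralCurve.continuous {U : ℝ → Z} (hU : Q.IsIntegralCurve U) : Continuous U :=
  continuous_iff_continuousAt.2 fun t => (hU t).continuousAt

/-- The restriction of a continuous curve to `[-T, T]`. -/
def restrictCurve (T : ℝ) (U : ℝ → Z) (hU : Continuous U) : Curve T Z :=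
  ⟨fun t => U t, hU.comp continuous_subtype_val⟩

theorem IsIntegralCurve.defect_restrict {U : ℝ → Z} (hU : Q.IsIntegralCurve U) :
    Q.defect hT (restrictCurve T U hU.continuous) = ContinuousMap.const _ (U 0) := by
  rw [Q.defect_eq_const_iff hT _ _ U fun t => rfl]
  intro t _
  rw [intervalIntegral.integral_eq_sub_of_hasDerivAt (fun s _ => hU s)
    ((Q.continuous_field_comp hU.continuous).intervalIntegrable _ _)]
  abel

theorem isIntegralCurve_of_integral_eq {u : ℝ → Z} (hu : Continuous u) (d : Z)
    (h : ∀ t, u t = d + ∫ s in (0 : ℝ)..t, Q.field s (u s)) : Q.IsIntegralCurve u := by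
  intro t
  have h1 : HasDerivAt (fun t => d + ∫ s in (0 : ℝ)..t, Q.field s (u s)) (Q.field t (u t)) t :=
    ((Q.continuous_field_comp hu).integral_hasStrictDerivAt 0 t).hasDerivAt.const_add d
  rwa [← funext h] at h1

variable (Q)

/-- A curve solving the integral equation on every `[-T, T]` is a global integral curve. -/
theorem exists_isIntegralCurve_of_forall (d : Z)
    (h : ∀ (T : ℝ) (hT : 0 ≤ T), ∃ W : Curve T Z, Q.defect hT W = ContinuousMap.const _ d) :
    ∃ U : ℝ → Z, Q.IsIntegralCurve U ∧ U 0 = d := by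
  choose W hW using h
  -- The restriction of the longer curve solves the integral equation on the shorter interval;
  -- injectivity of the defect identifies the two.
  have agree : ∀ (S T : ℝ) (hS : 0 ≤ S) (hT : 0 ≤ T), S ≤ T → ∀ t ∈ Icc (-S) S,
      extend hT (W T hT) t = extend hS (W S hS) t := by
    intro S T hS hT hST t ht
    let V : Curve S Z := restrictCurve S (extend hT (W T hT)) (continuous_extend hT _)
    have h1 := (Q.defect_eq_const_iff hT (W T hT) d (extend hT (W T hT))
      fun t => (extend_apply hT _ t).symm).1 (hW T hT)
    have h2 : Q.defect hS V = ContinuousMap.const _ d :=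
      (Q.defect_eq_const_iff hS V d (extend hT (W T hT)) fun t => rfl).2
        fun t ht => h1 t ⟨by linarith [ht.1], by linarith [ht.2]⟩
    have h3 : V = W S hS := Q.defect_injective hS (h2.trans (hW S hS).symm)
    rw [extend_of_mem hS _ ht, ← h3]
    rfl
  -- The value at t is read off on [-|t|, |t|], the smallest symmetric interval containing t; by
  -- `agree` any larger one gives the same value.
  let U : ℝ → Z := fun t => extend (abs_nonneg t) (W |t| (abs_nonneg t)) t
  have hU : ∀ (T : ℝ) (hT : 0 ≤ T), ∀ t ∈ Icc (-T) T, U t = extend hT (W T hT) t := by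
    intro T hT t ht
    exact (agree |t| T _ hT (abs_le.2 ht) t ⟨neg_abs_le t, le_abs_self t⟩).symm
  have hcont : Continuous U := by
    refine continuous_iff_continuousAt.2 fun t => ?_
    have hT : 0 ≤ |t| + 1 := by positivity
    refine ((continuous_extend hT (W _ hT)).continuousAt).congr ?_
    have : Icc (-(|t| + 1)) (|t| + 1) ∈ 𝓝 t :=
      Icc_mem_nhds (by linarith [neg_abs_le t]) (by linarith [le_abs_self t])
    filter_upwards [this] with s hs using (hU _ hT s hs).symm
  have hint : ∀ t, U t = d + ∫ s in (0 : ℝ)..t, Q.field s (U s) := by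
    intro t
    exact (Q.defect_eq_const_iff (abs_nonneg t) (W _ (abs_nonneg t)) d U fun s => by
      rw [hU _ (abs_nonneg t) s s.2, extend_apply]).1 (hW _ _) t ⟨neg_abs_le t, le_abs_self t⟩
  exact ⟨U, isIntegralCurve_of_integral_eq hcont d hint, by simpa using hint 0⟩

/-- Global existence from an a priori bound, by a connectedness argument in the initial datum. -/
theorem exists_isIntegralCurve
    (hQ : ∀ (T : ℝ) (hT : 0 ≤ T) (R : ℝ), ∃ R' : ℝ, ∀ (d : Z) (W : Curve T Z), ‖d‖ ≤ R →
      Q.defect hT W = ContinuousMap.const _ d → ‖W‖ ≤ R') (d : Z) :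
    ∃ U : ℝ → Z, Q.IsIntegralCurve U ∧ U 0 = d := by
  refine Q.exists_isIntegralCurve_of_forall d fun T hT => ?_
  let D : Set Z := {d | ∃ W : Curve T Z, Q.defect hT W = ContinuousMap.const _ d}
  suffices h : D = univ from (h ▸ mem_univ d : d ∈ D)
  have hconst : Continuous fun d : Z => (ContinuousMap.const (Icc (-T) T) d) :=
    ContinuousMap.continuous_const'
  refine IsClopen.eq_univ ⟨?_, ?_⟩ ⟨0, 0, ?_⟩
  -- Closed: along a convergent sequence of data the a priori bound keeps the curves in one ball,
  -- where they depend on the data in a Lipschitz way. They form a Cauchy sequence, and the limit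
  -- solves the equation because the defect is continuous.
  · refine isClosed_of_closure_subset fun d hd => ?_
    obtain ⟨x, hx, hlim⟩ := mem_closure_iff_seq_limit.1 hd
    choose W hW using hx
    obtain ⟨R, hR⟩ := hlim.norm.bddAbove_range
    obtain ⟨R', hR'⟩ := hQ T hT R
    have hb : ∀ n, ‖W n‖ ≤ max R' 0 := fun n =>
      (hR' (x n) (W n) (hR ⟨n, rfl⟩) (hW n)).trans (le_max_left _ _)
    obtain ⟨C, hC, hlip⟩ := Q.exists_norm_sub_le hT (max R' 0) (le_max_right _ _)
    have hcau : CauchySeq fun n => (ContinuousMap.const (Icc (-T) T) (x n)) :=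
      ((hconst.tendsto d).comp hlim).cauchySeq
    have hcW : CauchySeq W := by
      rw [Metric.cauchySeq_iff] at hcau ⊢
      intro ε hε
      -- Division by C + 1, as C may vanish.
      obtain ⟨N, hN⟩ := hcau (ε / (C + 1)) (by positivity)
      refine ⟨N, fun m hm n hn => ?_⟩
      rw [dist_eq_norm]
      have h1 := hlip (W m) (W n) (hb m) (hb n)
      have h2 := hN m hm n hn
      rw [dist_eq_norm, lt_div_iff₀ (by positivity)] at h2
      rw [hW, hW] at h1
      nlinarith [norm_nonneg ((ContinuousMap.const (Icc (-T) T) (x m)) -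
        (ContinuousMap.const (Icc (-T) T) (x n)))]
    obtain ⟨V, hV⟩ := cauchySeq_tendsto_of_complete hcW
    refine ⟨V, tendsto_nhds_unique ?_ ((hconst.tendsto d).comp hlim)⟩
    have := ((Q.hasStrictFDerivAt_defect hT V).hasFDerivAt.continuousAt.tendsto).comp hV
    exact this.congr fun n => hW n
  -- Open: by the inverse function theorem the range of the defect is a neighbourhood of the
  -- constant curve d, hence contains the constant curves of nearby data.
  · rw [isOpen_iff_mem_nhds]
    rintro d ⟨W, hW⟩
    obtain ⟨e, -, he⟩ := Q.exists_equiv_hasStrictFDerivAt_defect hT W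
    have h1 := he.map_nhds_eq_of_equiv
    have h2 : range (Q.defect (Z := Z) hT) ∈ 𝓝 (Q.defect hT W) := by
      rw [← h1]; exact Filter.range_mem_map
    rw [hW] at h2
    exact (hconst.tendsto d) h2
  · rw [defect]
    ext t
    simp

/-- If the defect is differentiable along a continuous family of curves, then so is the family. -/
theorem hasDerivAt_of_hasDerivAt_defect {γ : ℝ → Curve T Z} {h : ℝ} (hγ : ContinuousAt γ h)
    {v : Curve T Z} (hv : HasDerivAt (fun k => Q.defect hT (γ k)) v h) :
    ∃ W : Curve T Z, HasDerivAt γ W h ∧ W - Q.slope hT (γ h) (γ h) W = v := by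
  obtain ⟨e, he, hd⟩ := Q.exists_equiv_hasStrictFDerivAt_defect hT (γ h)
  refine ⟨e.symm v, ?_, ?_⟩
  -- Near h the family is the local inverse of the defect applied to a differentiable function.
  -- Continuity of `γ` at h ensures that it stays where the local inverse is a left inverse.
  · have h1 := hd.to_localInverse.hasFDerivAt.comp_hasDerivAt h hv
    refine h1.congr_of_eventuallyEq ?_
    exact (hγ.eventually hd.eventually_left_inverse).mono fun k hk => hk.symm
  · have := congrArg (fun A : Curve T Z →L[ℝ] Curve T Z => A (e.symm v)) he
    simp only [ContinuousLinearEquiv.coe_coe, ContinuousLinearEquiv.apply_symm_apply,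
      sub_apply, one_apply_eq_self] at this
    exact this.symm

end QuadField

/-! ### Strongly continuous isometry groups and transport systems -/

/-- A strongly continuous one-parameter group of linear isometries. -/
structure IsometryGroup (Z : Type*) [NormedAddCommGroup Z] [NormedSpace ℝ Z] where
  /-- the operators of the group -/
  toFun : ℝ → Z →L[ℝ] Z
  map_zero : ∀ z, toFun 0 z = z
  map_add : ∀ s t z, toFun (s + t) z = toFun s (toFun t z)
  norm_map : ∀ t z, ‖toFun t z‖ = ‖z‖
  continuous_orbit : ∀ z, Continuous fun t => toFun t z

namespace IsometryGroup

instance {Z : Type*} [NormedAddCommGroup Z] [NormedSpace ℝ Z] :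
    CoeFun (IsometryGroup Z) fun _ => ℝ → Z →L[ℝ] Z := ⟨toFun⟩

variable {Z : Type*} [NormedAddCommGroup Z] [NormedSpace ℝ Z] (τ : IsometryGroup Z)

/-- Strong continuity in time and the common Lipschitz constant 1 of the operators give joint
continuity. -/
theorem continuous_uncurry : Continuous fun p : ℝ × Z => τ p.1 p.2 := by
  have h : Continuous fun p : Z × ℝ => τ p.2 p.1 := by
    refine continuous_prod_of_continuous_lipschitzWith _ 1 (fun z => τ.continuous_orbit z)
      fun t => LipschitzWith.of_dist_le_mul fun z w => ?_
    simp only [dist_eq_norm, NNReal.coe_one, one_mul]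
    rw [← map_sub, τ.norm_map]
  exact h.comp continuous_swap

theorem comm (s t : ℝ) (z : Z) : τ s (τ t z) = τ t (τ s z) := by
  rw [← τ.map_add, add_comm, τ.map_add]

theorem apply_neg_apply (t : ℝ) (z : Z) : τ t (τ (-t) z) = z := by
  rw [← τ.map_add, add_neg_cancel, τ.map_zero]

theorem neg_apply_apply (t : ℝ) (z : Z) : τ (-t) (τ t z) = z := by
  rw [← τ.map_add, neg_add_cancel, τ.map_zero]

/-- The group law τ_l = τ_k τ_{l−k} transports differentiability at 0 to every k. -/
theorem hasDerivAt_orbit {z z' : Z} (h : HasDerivAt (fun k => τ k z) z' 0) (k : ℝ) :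
    HasDerivAt (fun k => τ k z) (τ k z') k := by
  have h1 : HasDerivAt (fun l => τ k (τ (l - k) z)) (τ k z') k := by
    refine (τ k).hasFDerivAt.comp_hasDerivAt k ?_
    have h2 : HasDerivAt (fun l : ℝ => l - k) 1 k := (hasDerivAt_id k).sub_const k
    have := HasDerivAt.scomp (h := fun l : ℝ => l - k) k (by simpa using h) h2
    simpa using! this
  refine h1.congr_of_eventuallyEq (Eventually.of_forall fun l => ?_)
  change τ l z = τ k (τ (l - k) z)
  rw [← τ.map_add]
  congr 2
  ring

/-- Product rule for a group acting on a curve. -/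
theorem hasDerivAt_apply {f : ℝ → Z} {f' w : Z} {t : ℝ} (c : ℝ) (hf : HasDerivAt f f' t)
    (hw : HasDerivAt (fun k => τ k (f t)) w 0) :
    HasDerivAt (fun s => τ (c * s) (f s)) (c • τ (c * t) w + τ (c * t) f') t := by
  have h1 : HasDerivAt (fun s => τ (c * s) (f t)) (c • τ (c * t) w) t := by
    have h2 : HasDerivAt (fun s : ℝ => c * s) c t := by
      simpa using (hasDerivAt_id t).const_mul c
    exact HasDerivAt.scomp (h := fun s : ℝ => c * s) t (τ.hasDerivAt_orbit hw _) h2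
  rw [hasDerivAt_iff_tendsto_slope] at h1 hf ⊢
  -- The difference quotient splits into that of the orbit of the fixed vector f(t) and the group
  -- applied to the difference quotient of f. The second part needs only joint continuity, so f'
  -- need not have a differentiable orbit.
  have h3 : Tendsto (fun s => τ (c * s) (slope f t s)) (𝓝[≠] t) (𝓝 (τ (c * t) f')) := by
    have hc : Tendsto (fun s : ℝ => c * s) (𝓝[≠] t) (𝓝 (c * t)) :=
      ((continuous_const.mul continuous_id).tendsto t).mono_left nhdsWithin_le_nhds
    exact (τ.continuous_uncurry.tendsto (c * t, f')).comp (hc.prodMk_nhds hf)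
  refine (h1.add h3).congr fun s => ?_
  simp only [slope, vsub_eq_sub, map_smul, map_sub, ← smul_add]
  congr 1
  abel

/-- The product of an isometry group with itself. -/
def double : IsometryGroup (Z × Z) where
  toFun t := (τ t).prodMap (τ t)
  map_zero z := by ext <;> simp [τ.map_zero]
  map_add s t z := by ext <;> simp [τ.map_add]
  norm_map t z := by simp [Prod.norm_def, τ.norm_map]
  continuous_orbit z := (τ.continuous_orbit z.1).prodMk (τ.continuous_orbit z.2)

end IsometryGroup

/-- A first-order system `∂ₜ z = Σ ∂ₓ z + L z + B z z` with translation invariant coefficients,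
where `Σ = 2 proj - 1` is a reflection and `∂ₓ` generates the group `τ`. -/
structure TransportSystem (Z : Type*) [NormedAddCommGroup Z] [NormedSpace ℝ Z] where
  /-- translations -/
  τ : IsometryGroup Z
  /-- the projection onto the components transported to the left -/
  proj : Z →L[ℝ] Z
  /-- the linear part of the nonlinearity -/
  L : Z →L[ℝ] Z
  /-- the quadratic part of the nonlinearity -/
  B : Z →L[ℝ] Z →L[ℝ] Z
  proj_proj : ∀ z, proj (proj z) = proj z
  proj_τ : ∀ h z, proj (τ h z) = τ h (proj z)
  L_τ : ∀ h z, L (τ h z) = τ h (L z)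
  B_τ : ∀ h z w, B (τ h z) (τ h w) = τ h (B z w)

/-! ### The interaction picture, and regularity along translations -/

namespace TransportSystem

variable {Z : Type*} [NormedAddCommGroup Z] [NormedSpace ℝ Z] (sys : TransportSystem Z)

/-- The free evolution. -/
def S (t : ℝ) : Z →L[ℝ] Z :=
  sys.τ t ∘L sys.proj + sys.τ (-t) ∘L (ContinuousLinearMap.id ℝ Z - sys.proj)

theorem S_apply (t : ℝ) (z : Z) :
    sys.S t z = sys.τ t (sys.proj z) + sys.τ (-t) (z - sys.proj z) := rfl

theorem S_zero (z : Z) : sys.S 0 z = z := by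
  simp [S_apply, sys.τ.map_zero]

theorem proj_S (t : ℝ) (z : Z) : sys.proj (sys.S t z) = sys.τ t (sys.proj z) := by
  simp [S_apply, sys.proj_τ, sys.proj_proj]

theorem S_add (s t : ℝ) (z : Z) : sys.S (s + t) z = sys.S s (sys.S t z) := by
  rw [S_apply _ s, proj_S, S_apply _ t, S_apply _ (s + t), add_sub_cancel_left, neg_add]
  simp only [sys.τ.map_add]

theorem S_S_neg (t : ℝ) (z : Z) : sys.S t (sys.S (-t) z) = z := by
  rw [← S_add, add_neg_cancel, S_zero]

theorem S_τ (t h : ℝ) (z : Z) : sys.S t (sys.τ h z) = sys.τ h (sys.S t z) := by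
  simp only [S_apply, sys.proj_τ, map_add, ← map_sub, sys.τ.comm h]

theorem continuous_S : Continuous fun p : ℝ × Z => sys.S p.1 p.2 := by
  have h1 : Continuous fun p : ℝ × Z => (p.1, sys.proj p.2) := by fun_prop
  have h2 : Continuous fun p : ℝ × Z => (-p.1, p.2 - sys.proj p.2) := by fun_prop
  exact (sys.τ.continuous_uncurry.comp h1).add (sys.τ.continuous_uncurry.comp h2)

theorem continuous_S_apply {f : ℝ → ℝ} {u : ℝ → Z} (hf : Continuous f) (hu : Continuous u) :
    Continuous fun t => sys.S (f t) (u t) :=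
  sys.continuous_S.comp (hf.prodMk hu)

/-- A bound for the free evolution. -/
def growth : ℝ := ‖sys.proj‖ + (1 + ‖sys.proj‖)

theorem growth_nonneg : 0 ≤ sys.growth := by unfold growth; positivity

theorem norm_S_le (t : ℝ) (z : Z) : ‖sys.S t z‖ ≤ sys.growth * ‖z‖ := by
  rw [S_apply, growth]
  refine (norm_add_le _ _).trans ?_
  rw [sys.τ.norm_map, sys.τ.norm_map]
  have h1 := sys.proj.le_opNorm z
  have h2 := norm_sub_le z (sys.proj z)
  linarith

/-- The nonlinearity. -/
def nonlin (z : Z) : Z := sys.L z + sys.B z z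

theorem nonlin_τ (h : ℝ) (z : Z) : sys.nonlin (sys.τ h z) = sys.τ h (sys.nonlin z) := by
  simp [nonlin, sys.L_τ, sys.B_τ]

theorem contDiff_nonlin {n : WithTop ℕ∞} : ContDiff ℝ n sys.nonlin :=
  sys.L.contDiff.add (sys.B.isBoundedBilinearMap.contDiff.comp (contDiff_id.prodMk contDiff_id))

/-- The system in the interaction picture. -/
def toQuadField : QuadField Z where
  lin t := sys.S (-t) ∘L sys.L ∘L sys.S t
  quad t := (ContinuousLinearMap.compL ℝ Z Z Z (sys.S (-t))) ∘L (sys.B.bilinearComp (sys.S t) (sys.S t))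
  bound := sys.growth * (‖sys.L‖ * sys.growth) + sys.growth * (‖sys.B‖ * sys.growth * sys.growth)
  bound_nonneg := by have := sys.growth_nonneg; positivity
  norm_lin_le t z := by
    have h0 := sys.growth_nonneg
    calc ‖sys.S (-t) (sys.L (sys.S t z))‖ ≤ sys.growth * ‖sys.L (sys.S t z)‖ := sys.norm_S_le _ _
      _ ≤ sys.growth * (‖sys.L‖ * ‖sys.S t z‖) := by gcongr; exact sys.L.le_opNorm _
      _ ≤ sys.growth * (‖sys.L‖ * (sys.growth * ‖z‖)) := by gcongr; exact sys.norm_S_le _ _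
      _ = sys.growth * (‖sys.L‖ * sys.growth) * ‖z‖ := by ring
      _ ≤ _ := by gcongr; exact le_add_of_nonneg_right (by positivity)
  norm_quad_le t z w := by
    have h0 := sys.growth_nonneg
    calc ‖sys.S (-t) (sys.B (sys.S t z) (sys.S t w))‖
        ≤ sys.growth * ‖sys.B (sys.S t z) (sys.S t w)‖ := sys.norm_S_le _ _
      _ ≤ sys.growth * (‖sys.B‖ * ‖sys.S t z‖ * ‖sys.S t w‖) := by
        gcongr; exact sys.B.le_opNorm₂ _ _
      _ ≤ sys.growth * (‖sys.B‖ * (sys.growth * ‖z‖) * (sys.growth * ‖w‖)) := by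
        gcongr <;> exact sys.norm_S_le _ _
      _ = sys.growth * (‖sys.B‖ * sys.growth * sys.growth) * ‖z‖ * ‖w‖ := by ring
      _ ≤ _ := by gcongr; exact le_add_of_nonneg_left (by positivity)
  continuous_lin := by
    refine sys.continuous_S.comp ((by fun_prop : Continuous fun p : ℝ × Z => -p.1).prodMk ?_)
    exact sys.L.continuous.comp sys.continuous_S
  continuous_quad := by
    refine sys.continuous_S.comp ((by fun_prop : Continuous fun p : ℝ × Z × Z => -p.1).prodMk ?_)
    exact sys.B.isBoundedBilinearMap.continuous.comp
      ((sys.continuous_S.comp (by fun_prop : Continuous fun p : ℝ × Z × Z => (p.1, p.2.1))).prodMk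
        (sys.continuous_S.comp (by fun_prop : Continuous fun p : ℝ × Z × Z => (p.1, p.2.2))))

theorem lin_apply (t : ℝ) (z : Z) : sys.toQuadField.lin t z = sys.S (-t) (sys.L (sys.S t z)) := rfl

theorem quad_apply (t : ℝ) (z w : Z) :
    sys.toQuadField.quad t z w = sys.S (-t) (sys.B (sys.S t z) (sys.S t w)) := rfl

theorem field_apply (t : ℝ) (z : Z) :
    sys.toQuadField.field t z = sys.S (-t) (sys.nonlin (sys.S t z)) := by
  rw [QuadField.field, lin_apply, quad_apply, ← map_add]; rfl

/-- The system for a solution together with its variation. -/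
def tangent : TransportSystem (Z × Z) where
  τ := sys.τ.double
  proj := sys.proj.prodMap sys.proj
  L := sys.L.prodMap sys.L
  -- On the diagonal the second component is the derivative of z ↦ B(z, z) in the direction of the
  -- variation.
  B := LinearMap.mkContinuous₂ (LinearMap.mk₂ ℝ
      (fun z w : Z × Z => (sys.B z.1 w.1, sys.B z.1 w.2 + sys.B z.2 w.1))
      (fun z z' w => by ext <;> simp; abel) (fun c z w => by ext <;> simp)
      (fun z w w' => by ext <;> simp; abel) (fun c z w => by ext <;> simp)) (‖sys.B‖ + ‖sys.B‖) (by
    intro z w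
    have h : ∀ a ∈ ({z.1, z.2} : Set Z), ∀ b ∈ ({w.1, w.2} : Set Z),
        ‖sys.B a b‖ ≤ ‖sys.B‖ * ‖z‖ * ‖w‖ := by
      intro a ha b hb
      have ha' : ‖a‖ ≤ ‖z‖ := by
        rcases ha with rfl | rfl
        exacts [norm_fst_le z, norm_snd_le z]
      have hb' : ‖b‖ ≤ ‖w‖ := by
        rcases hb with rfl | rfl
        exacts [norm_fst_le w, norm_snd_le w]
      exact (sys.B.le_opNorm₂ a b).trans (by gcongr)
    have h0 : 0 ≤ ‖sys.B‖ * ‖z‖ * ‖w‖ := by positivity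
    refine norm_prod_le_iff.2 ⟨?_, (norm_add_le _ _).trans ?_⟩
    · have := h z.1 (by simp) w.1 (by simp)
      simp only [LinearMap.mk₂_apply]
      linarith
    · have h1 := h z.1 (by simp) w.2 (by simp)
      have h2 := h z.2 (by simp) w.1 (by simp)
      linarith)
  proj_proj z := by ext <;> simp [sys.proj_proj]
  proj_τ h z := by ext <;> exact sys.proj_τ _ _
  L_τ h z := by ext <;> exact sys.L_τ _ _
  B_τ h z w := by
    ext
    · exact sys.B_τ _ _ _
    · change sys.B (sys.τ h z.1) (sys.τ h w.2) + sys.B (sys.τ h z.2) (sys.τ h w.1) = _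
      rw [sys.B_τ, sys.B_τ, ← map_add]
      rfl

theorem tangent_S (t : ℝ) (z : Z × Z) : sys.tangent.S t z = (sys.S t z.1, sys.S t z.2) := rfl

/-- The second component is the linearization of the field. Since solution and variation together
solve a system of the same kind, the regularity argument can be iterated. -/
theorem tangent_field (t : ℝ) (z w : Z) : sys.tangent.toQuadField.field t (z, w) =
    (sys.toQuadField.field t z, sys.toQuadField.lin t w + sys.toQuadField.quad t z w +
      sys.toQuadField.quad t w z) := by
  rw [field_apply, tangent_S, tangent_S, field_apply, lin_apply, quad_apply, quad_apply,
    ← map_add, ← map_add, add_assoc]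
  rfl

variable [CompleteSpace Z]

/-- The free evolution and the nonlinearity commute with translations, and so does the field. -/
theorem isIntegralCurve_τ {U : ℝ → Z} (hU : sys.toQuadField.IsIntegralCurve U) (h : ℝ) :
    sys.toQuadField.IsIntegralCurve fun t => sys.τ h (U t) := by
  intro t
  have := (sys.τ h).hasFDerivAt.comp_hasDerivAt t (hU t)
  rw [field_apply] at this ⊢
  rwa [S_τ, nonlin_τ, S_τ]

/-- The translates of `U` form a continuous family of curves whose defects are the constant curves
τ_h (U 0). These are differentiable in h, and the inverse function theorem passes this on to the
curves themselves. The variation equation is the derivative of the integral equation. -/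
theorem exists_variation_on {U : ℝ → Z} (hU : sys.toQuadField.IsIntegralCurve U) {d' : Z}
    (hd : HasDerivAt (fun h => sys.τ h (U 0)) d' 0) (T : ℝ) (hT : 0 ≤ T) : ∃ V : Curve T Z,
      (∀ t : Icc (-T) T, HasDerivAt (fun h => sys.τ h (U t)) (V t) 0) ∧
      ∀ t : Icc (-T) T, V t = d' + ∫ s in (0 : ℝ)..t, (sys.toQuadField.lin s (extend hT V s) +
        sys.toQuadField.quad s (U s) (extend hT V s) +
        sys.toQuadField.quad s (extend hT V s) (U s)) := by
  let γ' : C(ℝ, Curve T Z) := ContinuousMap.curry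
    ⟨fun p : ℝ × Icc (-T) T => sys.τ p.1 (U p.2), sys.τ.continuous_uncurry.comp
      (continuous_fst.prodMk (hU.continuous.comp (continuous_subtype_val.comp continuous_snd)))⟩
  have h1 : ∀ h, sys.toQuadField.defect hT (γ' h) = ContinuousMap.const _ (sys.τ h (U 0)) :=
    fun h => (sys.isIntegralCurve_τ hU h).defect_restrict hT
  let κ : Z →L[ℝ] Curve T Z := LinearMap.mkContinuous
    { toFun := fun z => ContinuousMap.const _ z
      map_add' := fun _ _ => rfl
      map_smul' := fun _ _ => rfl } 1 fun z => by
        rw [one_mul]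
        exact (ContinuousMap.norm_le _ (norm_nonneg z)).2 fun t => le_rfl
  have h2 : HasDerivAt (fun h => sys.toQuadField.defect hT (γ' h)) (κ d') 0 := by
    simp only [h1]
    exact κ.hasFDerivAt.comp_hasDerivAt 0 hd
  obtain ⟨V, hV, hV'⟩ :=
    sys.toQuadField.hasDerivAt_of_hasDerivAt_defect hT γ'.continuous.continuousAt h2
  refine ⟨V, fun t => ?_, fun t => ?_⟩
  · exact (ContinuousMap.evalCLM ℝ t).hasFDerivAt.comp_hasDerivAt (0 : ℝ) hV
  · have h3 := congrArg (fun W : Curve T Z => W t) (sub_eq_iff_eq_add.1 hV')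
    simp only [ContinuousMap.add_apply, QuadField.slope_apply] at h3
    rw [h3]
    congr 1
    refine intervalIntegral.integral_congr fun s hs => ?_
    have hs' := mem_Icc_of_mem_uIcc t.2 hs
    have h4 : extend hT (γ' 0) s = U s := by
      rw [extend_of_mem hT _ hs']
      exact sys.τ.map_zero _
    simp only [h4]

/-- An integral curve whose initial datum is differentiable under translations is differentiable
under translations, and its derivative is a variation of the curve. -/
theorem exists_variation {U : ℝ → Z} (hU : sys.toQuadField.IsIntegralCurve U) {d' : Z}
    (hd : HasDerivAt (fun h => sys.τ h (U 0)) d' 0) :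
    ∃ W : ℝ → Z, sys.tangent.toQuadField.IsIntegralCurve (fun t => (U t, W t)) ∧ W 0 = d' ∧
      ∀ t, HasDerivAt (fun h => sys.τ h (U t)) (W t) 0 := by
  choose V hV hVi using sys.exists_variation_on hU hd
  -- Defined as a derivative, `W` does not depend on `T`, so the variations on the different
  -- intervals fit together.
  let W : ℝ → Z := fun t => deriv (fun h => sys.τ h (U t)) 0
  have hVW : ∀ (T : ℝ) (hT : 0 ≤ T) (t : Icc (-T) T), V T hT t = W t :=
    fun T hT t => (hV T hT t).deriv.symm
  have hW : ∀ t, HasDerivAt (fun h => sys.τ h (U t)) (W t) 0 := fun t =>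
    (hV |t| (abs_nonneg t) ⟨t, neg_abs_le t, le_abs_self t⟩).differentiableAt.hasDerivAt
  have hcont : Continuous W := by
    refine continuous_iff_continuousAt.2 fun t => ?_
    have hT : 0 ≤ |t| + 1 := by positivity
    refine ((continuous_extend hT (V _ hT)).continuousAt).congr ?_
    have : Icc (-(|t| + 1)) (|t| + 1) ∈ 𝓝 t :=
      Icc_mem_nhds (by linarith [neg_abs_le t]) (by linarith [le_abs_self t])
    filter_upwards [this] with s hs
    rw [extend_of_mem hT _ hs, hVW]
  have hint : ∀ t, W t = d' + ∫ s in (0 : ℝ)..t, (sys.toQuadField.lin s (W s) +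
      sys.toQuadField.quad s (U s) (W s) + sys.toQuadField.quad s (W s) (U s)) := by
    intro t
    have hT := abs_nonneg t
    have ht : t ∈ Icc (-|t|) |t| := ⟨neg_abs_le t, le_abs_self t⟩
    rw [← hVW |t| hT ⟨t, ht⟩, hVi |t| hT ⟨t, ht⟩]
    congr 1
    refine intervalIntegral.integral_congr fun s hs => ?_
    simp only [extend_of_mem hT _ (mem_Icc_of_mem_uIcc ht hs), hVW]
  refine ⟨W, fun t => ?_, by simpa using hint 0, hW⟩
  rw [tangent_field]
  refine (hU t).prodMk ?_
  have hc := sys.toQuadField.continuous_variation hU.continuous hcont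
  have h1 := (hc.integral_hasStrictDerivAt 0 t).hasDerivAt.const_add d'
  rwa [← funext hint] at h1

/-- The evolution equation for integral curves which are differentiable under translations. -/
theorem hasDerivAt_S_apply {U : ℝ → Z} (hU : sys.toQuadField.IsIntegralCurve U) {W : ℝ → Z}
    (hW : ∀ t, HasDerivAt (fun h => sys.τ h (U t)) (W t) 0) (t : ℝ) :
    HasDerivAt (fun t => sys.S t (U t))
      ((2 : ℝ) • sys.proj (sys.S t (W t)) - sys.S t (W t) + sys.nonlin (sys.S t (U t))) t := by
  have hp : ∀ A : Z →L[ℝ] Z, (∀ h z, A (sys.τ h z) = sys.τ h (A z)) →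
      HasDerivAt (fun h => sys.τ h (A (U t))) (A (W t)) 0 := by
    intro A hA
    simpa only [Function.comp_def, hA] using A.hasFDerivAt.comp_hasDerivAt (0 : ℝ) (hW t)
  -- The product rule is applied in the two moving frames: speed parameter 1 on the range of the
  -- projection, -1 on the complement.
  have h1 := sys.τ.hasDerivAt_apply 1 (sys.proj.hasFDerivAt.comp_hasDerivAt t (hU t))
    (hp sys.proj sys.proj_τ)
  have h2 := sys.τ.hasDerivAt_apply (-1)
    ((ContinuousLinearMap.id ℝ Z - sys.proj).hasFDerivAt.comp_hasDerivAt t (hU t))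
    (hp (ContinuousLinearMap.id ℝ Z - sys.proj) (by simp [sys.proj_τ]))
  have h3 := h1.add h2
  simp only [one_mul, neg_mul, one_smul, neg_smul] at h3
  refine h3.congr_deriv ?_
  have h4 : sys.nonlin (sys.S t (U t)) = sys.S t (sys.toQuadField.field t (U t)) := by
    rw [field_apply, S_S_neg]
  rw [h4, proj_S, S_apply _ t (W t), S_apply _ t (sys.toQuadField.field t (U t)), two_smul]
  simp only [sub_apply, ContinuousLinearMap.id_apply]
  abel

end TransportSystem

/-- Joint regularity in time and translations: if the orbit of the initial datum under translations
is of class `C^m`, then so is the solution, as a function of time and of the translation. -/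
theorem TransportSystem.contDiff_of_contDiff_orbit (m : ℕ) :
    ∀ {Z : Type*} [NormedAddCommGroup Z] [NormedSpace ℝ Z] [CompleteSpace Z]
      (sys : TransportSystem Z) {U : ℝ → Z}, sys.toQuadField.IsIntegralCurve U →
      ContDiff ℝ m (fun h => sys.τ h (U 0)) →
      ContDiff ℝ m fun p : ℝ × ℝ => sys.τ p.2 (sys.S p.1 (U p.1)) := by
  induction m with
  | zero =>
    intro Z _ _ _ sys U hU _
    refine contDiff_zero.2 (sys.τ.continuous_uncurry.comp (continuous_snd.prodMk ?_))
    exact (sys.continuous_S_apply continuous_id hU.continuous).comp continuous_fst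
  | succ m ih =>
    intro Z _ _ _ sys U hU hd
    have hd0 : HasDerivAt (fun h => sys.τ h (U 0)) (deriv (fun h => sys.τ h (U 0)) 0) 0 :=
      ((hd.differentiable (by simp)) 0).hasDerivAt
    -- The orbit of the initial variation is the derivative of the orbit of the datum, hence of
    -- class C^m. The induction hypothesis is used for the tangent system on Z × Z, which is why the
    -- induction ranges over all spaces and systems.
    obtain ⟨W, hUW, hW0, hW⟩ := sys.exists_variation hU hd0
    have hd1 : ContDiff ℝ m fun h => sys.τ h (W 0) := by
      have h1 : (fun h => sys.τ h (W 0)) = deriv fun h => sys.τ h (U 0) := by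
        funext h
        rw [hW0, (sys.τ.hasDerivAt_orbit hd0 h).deriv]
      rw [h1]
      push_cast at hd
      exact (contDiff_succ_iff_deriv.1 hd).2.2
    have h2 := ih sys.tangent hUW
      ((hd.of_le (by exact_mod_cast Nat.le_succ m)).prodMk hd1)
    have hV : ContDiff ℝ m fun p : ℝ × ℝ => sys.τ p.2 (sys.S p.1 (U p.1)) := h2.fst
    have hV' : ContDiff ℝ m fun p : ℝ × ℝ => sys.τ p.2 (sys.S p.1 (W p.1)) := h2.snd
    -- The time derivative, taken from the evolution equation: it involves only the solution and its
    -- variation, both of class C^m. The derivative in the translation parameter is the variation,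
    -- so both partial derivatives are of class C^m.
    let D : ℝ × ℝ → Z := fun p => (2 : ℝ) • sys.proj (sys.τ p.2 (sys.S p.1 (W p.1))) -
      sys.τ p.2 (sys.S p.1 (W p.1)) + sys.nonlin (sys.τ p.2 (sys.S p.1 (U p.1)))
    have hD : ContDiff ℝ m D :=
      ((contDiff_const.smul (sys.proj.contDiff.comp hV')).sub hV').add
        (sys.contDiff_nonlin.comp hV)
    rw [Nat.cast_succ, contDiff_succ_iff_hasFDerivAt]
    let r : Z →L[ℝ] (ℝ →L[ℝ] Z) := ContinuousLinearMap.smulRightL ℝ ℝ Z 1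
    refine ⟨fun p => (r (D p)).coprod (r (sys.τ p.2 (sys.S p.1 (W p.1)))), ?_, fun p => ?_⟩
    · have : (fun p : ℝ × ℝ => (r (D p)).coprod (r (sys.τ p.2 (sys.S p.1 (W p.1))))) =
          fun p => (ContinuousLinearMap.compL ℝ (ℝ × ℝ) ℝ Z).flip
              (ContinuousLinearMap.fst ℝ ℝ ℝ) (r (D p)) +
            (ContinuousLinearMap.compL ℝ (ℝ × ℝ) ℝ Z).flip
              (ContinuousLinearMap.snd ℝ ℝ ℝ) (r (sys.τ p.2 (sys.S p.1 (W p.1)))) := by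
        funext p
        ext <;> simp
      rw [this]
      exact ((ContinuousLinearMap.contDiff _).comp (r.contDiff.comp hD)).add
        ((ContinuousLinearMap.contDiff _).comp (r.contDiff.comp hV'))
    -- Partial derivatives that exist everywhere and are continuous give joint differentiability.
    · refine (hasStrictFDerivAt_uncurry_coprod (f := fun t h => sys.τ h (sys.S t (U t)))
        (f₁ := fun t h => r (D (t, h))) (f₂ := fun t h => r (sys.τ h (sys.S t (W t))))
        (Eventually.of_forall fun v => ?_) (Eventually.of_forall fun v => ?_)
        (r.continuous.comp hD.continuous).continuousAt
        (r.continuous.comp hV'.continuous).continuousAt).hasFDerivAt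
      · have h3 := (sys.τ v.2).hasFDerivAt.comp_hasDerivAt v.1 (sys.hasDerivAt_S_apply hU hW v.1)
        refine (h3.congr_deriv ?_).hasFDerivAt
        simp only [map_add, map_sub, map_smul, ← sys.proj_τ, ← sys.nonlin_τ]
        rfl
      · have h3 := (sys.S v.1).hasFDerivAt.comp_hasDerivAt (0 : ℝ) (hW v.1)
        simp only [Function.comp_def, sys.S_τ] at h3
        exact (sys.τ.hasDerivAt_orbit h3 v.2).hasFDerivAt

/-! ### Translations on `Lᵖ(ℝ)` -/

section Translation

variable {E : Type*} [NormedAddCommGroup E] [NormedSpace ℝ E] {p : ENNReal} [Fact (1 ≤ p)]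

/-- The translation group `f ↦ f(· + h)` on `Lᵖ(ℝ; E)`. -/
def translation (E : Type*) [NormedAddCommGroup E] [NormedSpace ℝ E] (p : ENNReal) [Fact (1 ≤ p)]
    (hp : p ≠ ⊤) : IsometryGroup (Lp E p (volume : Measure ℝ)) where
  toFun h := (Lp.compMeasurePreservingₗᵢ ℝ (· + h)
    (measurePreserving_add_right volume h)).toContinuousLinearMap
  map_zero f := by
    refine Lp.ext ?_
    refine (Lp.coeFn_compMeasurePreserving f (measurePreserving_add_right volume 0)).trans ?_
    simp [Function.comp_def]
  map_add s t f := by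
    refine Lp.ext ?_
    refine (Lp.coeFn_compMeasurePreserving f (measurePreserving_add_right volume (s + t))).trans ?_
    refine EventuallyEq.trans ?_ (Lp.coeFn_compMeasurePreserving
      (Lp.compMeasurePreserving (· + t) (measurePreserving_add_right volume t) f)
      (measurePreserving_add_right volume s)).symm
    refine EventuallyEq.trans ?_
      ((measurePreserving_add_right volume s).quasiMeasurePreserving.ae_eq_comp
      (Lp.coeFn_compMeasurePreserving f (measurePreserving_add_right volume t)).symm)
    simp [Function.comp_def, add_assoc]
  norm_map h f := LinearIsometry.norm_map _ f
  continuous_orbit f := by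
    refine Continuous.compMeasurePreservingLp (Z := ℝ) (f := fun _ => f)
      (g := fun h => (⟨fun x => x + h, by fun_prop⟩ : C(ℝ, ℝ))) continuous_const ?_
      (fun h => measurePreserving_add_right volume h) hp
    exact ContinuousMap.continuous_of_continuous_uncurry _
      (by simp only [Function.uncurry_def, ContinuousMap.coe_mk]; fun_prop)

theorem coeFn_translation (hp : p ≠ ⊤) (h : ℝ) (f : Lp E p (volume : Measure ℝ)) :
    translation E p hp h f =ᵐ[volume] fun x => f (x + h) :=
  Lp.coeFn_compMeasurePreserving f (measurePreserving_add_right volume h)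

theorem comp_add_ae_eq {F : Type*} {f g : ℝ → F} (h : ℝ) (hfg : f =ᵐ[volume] g) :
    (fun x => f (x + h)) =ᵐ[volume] fun x => g (x + h) :=
  (measurePreserving_add_right volume h).quasiMeasurePreserving.ae_eq_comp hfg

end Translation

/-! ### Trivial groups, products and powers -/

namespace IsometryGroup

/-- The trivial group. -/
def trivial (Z : Type*) [NormedAddCommGroup Z] [NormedSpace ℝ Z] : IsometryGroup Z where
  toFun _ := ContinuousLinearMap.id ℝ Z
  map_zero _ := rfl
  map_add _ _ _ := rfl
  norm_map _ _ := rfl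
  continuous_orbit _ := continuous_const

/-- The product of two groups. -/
def prod {Z W : Type*} [NormedAddCommGroup Z] [NormedSpace ℝ Z] [NormedAddCommGroup W]
    [NormedSpace ℝ W] (τ : IsometryGroup Z) (σ : IsometryGroup W) : IsometryGroup (Z × W) where
  toFun t := (τ t).prodMap (σ t)
  map_zero z := by ext <;> simp [τ.map_zero, σ.map_zero]
  map_add s t z := by ext <;> simp [τ.map_add, σ.map_add]
  norm_map t z := by simp [Prod.norm_def, τ.norm_map, σ.norm_map]
  continuous_orbit z := (τ.continuous_orbit z.1).prodMk (σ.continuous_orbit z.2)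

/-- The power of a group. -/
def pow {Z : Type*} [NormedAddCommGroup Z] [NormedSpace ℝ Z] (τ : IsometryGroup Z)
    (ι : Type*) [Fintype ι] : IsometryGroup (ι → Z) where
  toFun t := ContinuousLinearMap.pi fun i => τ t ∘L ContinuousLinearMap.proj i
  map_zero z := by ext i; simp [τ.map_zero]
  map_add s t z := by ext i; simp [τ.map_add]
  norm_map t z := by simp [Pi.norm_def, nnnorm, τ.norm_map]
  continuous_orbit z := continuous_pi fun i => τ.continuous_orbit (z i)

end IsometryGroup

/-! ### Absolutely continuous functions and their derivatives -/

theorem norm_setIntegral_Iic_le (f : L1) (x : ℝ) : ‖∫ y in Iic x, f y‖ ≤ ‖f‖ := by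
  rw [L1.norm_eq_integral_norm]
  exact (norm_integral_le_integral_norm _).trans (setIntegral_le_integral
    (L1.integrable_coeFn f).norm (ae_of_all _ fun y => norm_nonneg _))

/-- The antiderivative `x ↦ ∫_{-∞}^x f` vanishing at `-∞`. -/
def antideriv : L1 →L[ℝ] (ℝ →ᵇ ℝ) :=
  LinearMap.mkContinuous
    { toFun := fun f => BoundedContinuousFunction.ofNormedAddCommGroup
        (fun x => ∫ y in Iic x, f y) (by
          have h : (fun x => ∫ y in Iic x, f y) =
              fun x => (∫ y in Iic (0 : ℝ), f y) + ∫ y in (0 : ℝ)..x, f y := by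
            funext x
            rw [← intervalIntegral.integral_Iic_sub_Iic (L1.integrable_coeFn f).integrableOn
              (L1.integrable_coeFn f).integrableOn]
            ring
          rw [h]
          exact continuous_const.add (intervalIntegral.continuous_primitive
            (fun a b => (L1.integrable_coeFn f).intervalIntegrable) 0)) ‖f‖
        (norm_setIntegral_Iic_le f)
      map_add' := by
        intro f g
        ext x
        change ∫ y in Iic x, (f + g : L1) y = (∫ y in Iic x, f y) + ∫ y in Iic x, g y
        rw [← integral_add (L1.integrable_coeFn f).integrableOn
          (L1.integrable_coeFn g).integrableOn]
        exact integral_congr_ae (ae_restrict_of_ae (Lp.coeFn_add f g))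
      map_smul' := by
        intro c f
        ext x
        change ∫ y in Iic x, (c • f : L1) y = c • ∫ y in Iic x, f y
        rw [← integral_smul]
        exact integral_congr_ae (ae_restrict_of_ae (Lp.coeFn_smul c f)) } 1 (by
    intro f
    rw [one_mul]
    exact BoundedContinuousFunction.norm_ofNormedAddCommGroup_le _ (norm_nonneg f) (norm_setIntegral_Iic_le f))

theorem antideriv_apply (f : L1) (x : ℝ) : antideriv f x = ∫ y in Iic x, f y := rfl

theorem antideriv_sub_antideriv (f : L1) (a b : ℝ) :
    antideriv f b - antideriv f a = ∫ y in a..b, f y :=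
  intervalIntegral.integral_Iic_sub_Iic (L1.integrable_coeFn f).integrableOn
    (L1.integrable_coeFn f).integrableOn

/-- The function with limit `c` at `-∞` and derivative `f`, for `p = (c, f)`. -/
def potential : ℝ × L1 →L[ℝ] (ℝ →ᵇ ℝ) :=
  LinearMap.mkContinuous
    { toFun := fun c => BoundedContinuousFunction.const ℝ c
      map_add' := fun _ _ => rfl
      map_smul' := fun _ _ => rfl } 1 (fun c => by
        rw [one_mul]; exact BoundedContinuousFunction.norm_const_le c) ∘L
    ContinuousLinearMap.fst ℝ ℝ L1 + antideriv ∘L ContinuousLinearMap.snd ℝ ℝ L1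

theorem potential_apply (q : ℝ × L1) (x : ℝ) : potential q x = q.1 + antideriv q.2 x := rfl

/-- The underlying function of an element of `Y`, as a bounded continuous function. -/
def Y.fnL : Y →L[ℝ] (ℝ →ᵇ ℝ) := WithLp.fstL 1 ℝ (ℝ →ᵇ ℝ) L1 ∘L YSubmodule.subtypeL

/-- The derivative of an element of `Y`. -/
def Y.derivL : Y →L[ℝ] L1 := WithLp.sndL 1 ℝ (ℝ →ᵇ ℝ) L1 ∘L YSubmodule.subtypeL

theorem Y.fnL_apply (f : Y) (x : ℝ) : Y.fnL f x = f.fn x := rfl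

theorem Y.norm_fn_le (f : Y) (x : ℝ) : ‖f.fn x‖ ≤ ‖f‖ := by
  have h1 : ‖f‖ = ‖f.1.fst‖ + ‖f.1.snd‖ := WithLp.prod_norm_eq_of_L1 f.1
  rw [h1]
  exact (f.1.fst.norm_coe_le_norm x).trans (le_add_of_nonneg_right (norm_nonneg _))

theorem Y.fn_sub_fn (f : Y) (a b : ℝ) : f.fn b - f.fn a = ∫ x in a..b, Y.derivL f x := f.2 a b

theorem Y.ext_fn {f g : Y} (h : ∀ x, f.fn x = g.fn x) (h' : Y.derivL f = Y.derivL g) : f = g :=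
  Subtype.ext (WithLp.ofLp_injective 1 (Prod.ext (BoundedContinuousFunction.ext h) h'))

/-- An element of `Y` from its limit at `-∞` and its derivative. -/
def Y.ofDeriv : ℝ × L1 →L[ℝ] Y :=
  ((WithLp.prodContinuousLinearEquiv 1 ℝ (ℝ →ᵇ ℝ) L1).symm.toContinuousLinearMap ∘L
    potential.prod (ContinuousLinearMap.snd ℝ ℝ L1)).codRestrict YSubmodule (by
      intro q a b
      change potential q b - potential q a = _
      rw [potential_apply, potential_apply, add_sub_add_left_eq_sub, antideriv_sub_antideriv]
      rfl)

theorem Y.fnL_ofDeriv (q : ℝ × L1) : Y.fnL (Y.ofDeriv q) = potential q := rfl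

/-- The limit at `-∞` of an element of `Y`. -/
def Y.lim : Y →L[ℝ] ℝ :=
  BoundedContinuousFunction.evalCLM ℝ (0 : ℝ) ∘L
    (Y.fnL - antideriv ∘L Y.derivL)

theorem Y.lim_add_antideriv (f : Y) (x : ℝ) : Y.lim f + antideriv (Y.derivL f) x = f.fn x := by
  have h1 := Y.fn_sub_fn f 0 x
  rw [← antideriv_sub_antideriv] at h1
  change f.fn 0 - antideriv (Y.derivL f) 0 + _ = _
  linarith

/-- `Y` is isomorphic to `ℝ × L¹`, via the limit at `-∞` and the derivative. -/
def Y.equiv : Y ≃L[ℝ] ℝ × L1 :=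
  ContinuousLinearEquiv.equivOfInverse (Y.lim.prod Y.derivL) Y.ofDeriv
    (fun f => Y.ext_fn (fun x => Y.lim_add_antideriv f x) rfl)
    (fun q => Prod.ext (by
      change potential q 0 - antideriv q.2 0 = q.1
      rw [potential_apply, add_sub_cancel_right]) rfl)

theorem tendsto_antideriv_atBot (f : L1) : Tendsto (antideriv f) atBot (𝓝 0) := by
  have h := (L1.integrable_coeFn f)
  have h1 := intervalIntegral_tendsto_integral_Iic 0 h.integrableOn tendsto_id
  have h2 : Tendsto (fun x => antideriv f 0 - ∫ y in x..(0 : ℝ), f y) atBot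
      (𝓝 (antideriv f 0 - antideriv f 0)) := tendsto_const_nhds.sub h1
  rw [sub_self] at h2
  refine h2.congr fun x => ?_
  rw [← antideriv_sub_antideriv]
  ring

/-- `Y.lim` is defined by the value at 0 and the derivative, which makes its continuity evident;
this justifies its name. -/
theorem Y.tendsto_atBot (f : Y) : Tendsto f.fn atBot (𝓝 (Y.lim f)) := by
  have h := (tendsto_antideriv_atBot (Y.derivL f)).const_add (Y.lim f)
  rw [add_zero] at h
  exact h.congr fun x => Y.lim_add_antideriv f x

/-! ### Pointwise products -/

theorem memLp_top_coe (a : ℝ →ᵇ ℝ) : MemLp a ⊤ (volume : Measure ℝ) :=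
  memLp_top_of_bound a.continuous.aestronglyMeasurable ‖a‖ (ae_of_all _ a.norm_coe_le_norm)

/-- The inclusion of bounded continuous functions in `L^∞`. -/
def toLinfty : (ℝ →ᵇ ℝ) →L[ℝ] Lp ℝ ⊤ (volume : Measure ℝ) :=
  LinearMap.mkContinuous
    { toFun := fun a => (memLp_top_coe a).toLp
      map_add' := fun _ _ => rfl
      map_smul' := fun _ _ => rfl } 1 (by
    intro a
    rw [one_mul]
    change ‖(memLp_top_coe a).toLp‖ ≤ _
    rw [Lp.norm_toLp, eLpNorm_exponent_top]
    exact ENNReal.toReal_le_of_le_ofReal (norm_nonneg a)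
      (eLpNormEssSup_le_of_ae_bound (ae_of_all _ a.norm_coe_le_norm)))

/-- Multiplication of an `L²` spinor by a bounded continuous function. -/
def mulL2 : (ℝ →ᵇ ℝ) →L[ℝ] L2 →L[ℝ] L2 :=
  ((ContinuousLinearMap.lsmul ℝ ℝ : ℝ →L[ℝ] Spinor →L[ℝ] Spinor).holderL volume ⊤ 2 2) ∘L toLinfty

theorem coeFn_mulL2 (a : ℝ →ᵇ ℝ) (f : L2) : mulL2 a f =ᵐ[volume] fun x => a x • f x := by
  refine (ContinuousLinearMap.coeFn_holder _ (toLinfty a) f).trans ?_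
  have h : toLinfty a =ᵐ[volume] a := (memLp_top_coe a).coeFn_toLp
  filter_upwards [h] with x hx
  rw [hx]; rfl

/-- The action of a matrix on `L²` spinors. -/
def actL2 (m : Matrix (Fin 2) (Fin 2) ℂ) : L2 →L[ℝ] L2 :=
  ((act m).restrictScalars ℝ).compLpL 2 volume

theorem coeFn_actL2 (m : Matrix (Fin 2) (Fin 2) ℂ) (f : L2) :
    actL2 m f =ᵐ[volume] fun x => act m (f x) :=
  ContinuousLinearMap.coeFn_compLpL _ f

/-- The real bilinear form polarizing the current. -/
def currentForm (μ : Fin 2) : Spinor →L[ℝ] Spinor →L[ℝ] ℝ :=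
  LinearMap.mkContinuous₂ (LinearMap.mk₂ ℝ
    (fun v w => (inner ℂ v (act (γ 0 * γLow μ) w)).re)
    (fun v v' w => by simp)
    (fun c v w => by
      rw [← Complex.coe_smul, inner_smul_left]; simp)
    (fun v w w' => by simp)
    (fun c v w => by
      rw [← Complex.coe_smul, map_smul, inner_smul_right]; simp)) ‖act (γ 0 * γLow μ)‖ (by
    intro v w
    calc ‖(inner ℂ v (act (γ 0 * γLow μ) w)).re‖ ≤ ‖inner ℂ v (act (γ 0 * γLow μ) w)‖ :=
          Complex.abs_re_le_norm _
      _ ≤ ‖v‖ * ‖act (γ 0 * γLow μ) w‖ := norm_inner_le_norm _ _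
      _ ≤ ‖v‖ * (‖act (γ 0 * γLow μ)‖ * ‖w‖) := by
        gcongr; exact (act (γ 0 * γLow μ)).le_opNorm w
      _ = _ := by ring)

theorem currentForm_apply (μ : Fin 2) (v w : Spinor) :
    currentForm μ v w = (inner ℂ v (act (γ 0 * γLow μ) w)).re := rfl

/-- The bilinear current `L² × L² → L¹`. -/
def currentL (μ : Fin 2) : L2 →L[ℝ] L2 →L[ℝ] L1 := (currentForm μ).holderL volume 2 2 1

theorem coeFn_currentL (μ : Fin 2) (f g : L2) :
    currentL μ f g =ᵐ[volume] fun x => currentForm μ (f x) (g x) :=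
  ContinuousLinearMap.coeFn_holder _ f g

theorem act_ofLp (m : Matrix (Fin 2) (Fin 2) ℂ) (v : Spinor) : (act m v).ofLp = m *ᵥ v.ofLp :=
  rfl

/-- The matrices γ⁰γ_μ are Hermitian, so the current is real and equals the real quadratic form. -/
theorem current_eq (μ : Fin 2) (v : Spinor) : current μ v = ((currentForm μ v v : ℝ) : ℂ) := by
  have h1 : current μ v = inner ℂ v (act (γ 0 * γLow μ) v) := by
    fin_cases μ <;>
    · simp only [current, act_ofLp, γ, γLow, g, EuclideanSpace.inner_eq_star_dotProduct]
      simp [Matrix.vecMul, Matrix.mulVec, dotProduct, Fin.sum_univ_two]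
      ring
  rw [currentForm_apply, ← h1]
  refine (Complex.conj_eq_iff_re.1 ?_).symm
  fin_cases μ <;>
  · simp only [current, γ, γLow, g]
    simp [Matrix.vecMul, Matrix.mulVec, dotProduct, Fin.sum_univ_two]
    ring

/-! ### The Maxwell-Dirac system as a transport system -/

/-- Translations of `L²` spinors. -/
abbrev translationL2 : IsometryGroup L2 := translation Spinor 2 (by simp)

/-- Translations of `L¹` functions. -/
abbrev translationL1 : IsometryGroup L1 := translation ℝ 1 (by simp)

theorem antideriv_translation (h : ℝ) (f : L1) (x : ℝ) :
    antideriv (translationL1 h f) x = antideriv f (x + h) := by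
  rw [antideriv_apply, antideriv_apply, setIntegral_congr_ae measurableSet_Iic
    ((coeFn_translation (by simp) h f).mono fun y hy _ => hy)]
  have := (measurePreserving_add_right volume h).setIntegral_preimage_emb
    (measurableEmbedding_addRight h) f (Iic (x + h))
  rwa [preimage_add_const_Iic, add_sub_cancel_right] at this

theorem mulL2_translation {a b : ℝ →ᵇ ℝ} {h : ℝ} (hab : ∀ x, b x = a (x + h)) (f : L2) :
    mulL2 b (translationL2 h f) = translationL2 h (mulL2 a f) := by
  refine Lp.ext ?_
  filter_upwards [coeFn_mulL2 b (translationL2 h f), coeFn_translation (by simp) h f,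
    coeFn_translation (by simp) h (mulL2 a f), comp_add_ae_eq h (coeFn_mulL2 a f)]
    with x h1 h2 h3 h4
  rw [h1, h2, h3, h4, hab]

theorem actL2_translation (m : Matrix (Fin 2) (Fin 2) ℂ) (h : ℝ) (f : L2) :
    actL2 m (translationL2 h f) = translationL2 h (actL2 m f) := by
  refine Lp.ext ?_
  filter_upwards [coeFn_actL2 m (translationL2 h f), coeFn_translation (by simp) h f,
    coeFn_translation (by simp) h (actL2 m f), comp_add_ae_eq h (coeFn_actL2 m f)]
    with x h1 h2 h3 h4
  rw [h1, h2, h3, h4]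

theorem currentL_translation (μ : Fin 2) (h : ℝ) (f g : L2) :
    currentL μ (translationL2 h f) (translationL2 h g) = translationL1 h (currentL μ f g) := by
  refine Lp.ext ?_
  filter_upwards [coeFn_currentL μ (translationL2 h f) (translationL2 h g),
    coeFn_translation (by simp) h f, coeFn_translation (by simp) h g,
    coeFn_translation (by simp) h (currentL μ f g), comp_add_ae_eq h (coeFn_currentL μ f g)]
    with x h1 h2 h3 h4 h5
  rw [h1, h2, h3, h4, h5]

/-- The state space: spinor, limits of the potentials at `-∞`, and the Riemann invariants
`∂ₜA + ∂ₓA` and `∂ₜA - ∂ₓA`. -/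
abbrev State : Type := L2 × (Fin 2 → ℝ) × (Fin 2 → L1) × (Fin 2 → L1)

/-- The element of `Y` with index `μ` of a state. -/
def State.pot (μ : Fin 2) : State →L[ℝ] ℝ × L1 :=
  (ContinuousLinearMap.proj μ ∘L ContinuousLinearMap.fst ℝ _ _ ∘L
    ContinuousLinearMap.snd ℝ _ _).prod ((1 / 2 : ℝ) •
    (ContinuousLinearMap.proj μ ∘L ContinuousLinearMap.fst ℝ _ _ ∘L
      ContinuousLinearMap.snd ℝ _ _ ∘L ContinuousLinearMap.snd ℝ _ _ -
    ContinuousLinearMap.proj μ ∘L ContinuousLinearMap.snd ℝ _ _ ∘L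
      ContinuousLinearMap.snd ℝ _ _ ∘L ContinuousLinearMap.snd ℝ _ _))

theorem State.pot_apply (μ : Fin 2) (z : State) :
    State.pot μ z = (z.2.1 μ, (1 / 2 : ℝ) • (z.2.2.1 μ - z.2.2.2 μ)) := rfl

/-- Translations of states. -/
def translationState : IsometryGroup State :=
  translationL2.prod ((IsometryGroup.trivial (Fin 2 → ℝ)).prod
    ((translationL1.pow (Fin 2)).prod (translationL1.pow (Fin 2))))

theorem translationState_apply (h : ℝ) (z : State) : translationState h z =
    (translationL2 h z.1, z.2.1, fun μ => translationL1 h (z.2.2.1 μ),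
      fun μ => translationL1 h (z.2.2.2 μ)) := rfl

theorem potential_pot_translation (μ : Fin 2) (h : ℝ) (z : State) (x : ℝ) :
    potential (State.pot μ (translationState h z)) x = potential (State.pot μ z) (x + h) := by
  simp only [potential_apply, State.pot_apply, translationState_apply]
  rw [← map_sub, ← map_smul, antideriv_translation]

/-- The spinor components transported to the left, and to the right. -/
def leftMatrix : Matrix (Fin 2) (Fin 2) ℂ := !![0, 0; 0, 1]

/-- The quadratic coupling of the spinor to the potentials. -/
def coupling : State →L[ℝ] State →L[ℝ] L2 :=
  ∑ μ, ContinuousLinearMap.compL ℝ State L2 L2 (actL2 (Complex.I • (γ 0 * γ μ))) ∘L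
    (mulL2.bilinearComp (potential ∘L State.pot μ) (ContinuousLinearMap.fst ℝ L2 _))

theorem coupling_apply (z w : State) : coupling z w =
    ∑ μ, actL2 (Complex.I • (γ 0 * γ μ)) (mulL2 (potential (State.pot μ z)) w.1) := by
  simp [coupling, ContinuousLinearMap.bilinearComp]

theorem norm_currentL_le_sum (μ : Fin 2) : ‖currentL μ‖ ≤ ∑ μ, ‖currentL μ‖ :=
  Finset.single_le_sum (f := fun μ => ‖currentL μ‖)
    (fun ν _ => ContinuousLinearMap.opNorm_nonneg (currentL ν)) (Finset.mem_univ μ)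

/-- The quadratic part of the nonlinearity. -/
def quadraticPart : State →L[ℝ] State →L[ℝ] State :=
  LinearMap.mkContinuous₂ (LinearMap.mk₂ ℝ
    (fun z w => ((coupling z w, 0, fun μ => -currentL μ z.1 w.1,
      fun μ => -currentL μ z.1 w.1) : State))
    (fun z z' w => by ext1 <;> [simp; ext1] <;> [simp; ext1] <;> ext1 <;> simp <;> abel)
    (fun c z w => by ext1 <;> [simp; ext1] <;> [simp; ext1] <;> ext1 <;> simp)
    (fun z w w' => by ext1 <;> [simp; ext1] <;> [simp; ext1] <;> ext1 <;> simp <;> abel)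
    (fun c z w => by ext1 <;> [simp; ext1] <;> [simp; ext1] <;> ext1 <;> simp))
    (‖coupling‖ + ∑ μ, ‖currentL μ‖) (by
      intro z w
      have h1 := coupling.le_opNorm₂ z w
      have h2 : ∀ μ, ‖-currentL μ z.1 w.1‖ ≤ (∑ μ, ‖currentL μ‖) * ‖z‖ * ‖w‖ := by
        intro μ
        rw [norm_neg]
        calc ‖currentL μ z.1 w.1‖ ≤ ‖currentL μ‖ * ‖z.1‖ * ‖w.1‖ := (currentL μ).le_opNorm₂ _ _
          _ ≤ ‖currentL μ‖ * ‖z‖ * ‖w‖ := by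
            gcongr
            exacts [norm_fst_le z, norm_fst_le w]
          _ ≤ _ := by
            gcongr
            exact norm_currentL_le_sum μ
      have h3 : 0 ≤ ‖coupling‖ * ‖z‖ * ‖w‖ := by positivity
      have h4 : 0 ≤ (∑ μ, ‖currentL μ‖) * ‖z‖ * ‖w‖ := by positivity
      have h5 : ‖(fun μ => -currentL μ z.1 w.1 : Fin 2 → L1)‖ ≤
          (‖coupling‖ + ∑ μ, ‖currentL μ‖) * ‖z‖ * ‖w‖ :=
        (pi_norm_le_iff_of_nonneg (by positivity)).2 fun μ => (h2 μ).trans (by linarith)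
      refine norm_prod_le_iff.2 ⟨h1.trans (by linarith), norm_prod_le_iff.2 ⟨?_,
        norm_prod_le_iff.2 ⟨h5, h5⟩⟩⟩
      change ‖(0 : Fin 2 → ℝ)‖ ≤ _
      rw [norm_zero]
      positivity)

theorem quadraticPart_apply (z w : State) : quadraticPart z w =
    (coupling z w, 0, fun μ => -currentL μ z.1 w.1, fun μ => -currentL μ z.1 w.1) := rfl

theorem leftMatrix_mul : leftMatrix * leftMatrix = leftMatrix := by
  ext i j
  fin_cases i <;> fin_cases j <;> simp [leftMatrix]

theorem act_act (m n : Matrix (Fin 2) (Fin 2) ℂ) (v : Spinor) :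
    act m (act n v) = act (m * n) v := by
  simp [act]

theorem actL2_actL2 (m n : Matrix (Fin 2) (Fin 2) ℂ) (f : L2) :
    actL2 m (actL2 n f) = actL2 (m * n) f := by
  refine Lp.ext ?_
  filter_upwards [coeFn_actL2 m (actL2 n f), coeFn_actL2 n f, coeFn_actL2 (m * n) f]
    with x h1 h2 h3
  rw [h1, h2, h3, act_act]

/-- The projection onto the components transported to the left. -/
def leftProj : State →L[ℝ] State :=
  -- γ⁰γ¹ = diag(1, -1), so the second spinor component moves to the left. The limits at −∞ are
  -- counted with the left-moving part; translations act trivially on them, so this choice has no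
  -- effect.
  (actL2 leftMatrix).prodMap ((ContinuousLinearMap.id ℝ (Fin 2 → ℝ)).prodMap
    ((ContinuousLinearMap.id ℝ (Fin 2 → L1)).prodMap 0))

theorem leftProj_apply (z : State) : leftProj z = (actL2 leftMatrix z.1, z.2.1, z.2.2.1, 0) := rfl

/-- The mass term. -/
def massPart (M : ℝ) : State →L[ℝ] State := (actL2 (-(Complex.I * M) • γ 0)).prodMap 0

theorem massPart_apply (M : ℝ) (z : State) :
    massPart M z = (actL2 (-(Complex.I * M) • γ 0) z.1, 0) := rfl

theorem leftProj_leftProj (z : State) : leftProj (leftProj z) = leftProj z := by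
  simp only [leftProj_apply, actL2_actL2, leftMatrix_mul]

theorem leftProj_translation (h : ℝ) (z : State) :
    leftProj (translationState h z) = translationState h (leftProj z) := by
  simp only [leftProj_apply, translationState_apply, actL2_translation, Pi.zero_apply, map_zero]
  rfl

theorem massPart_translation (M h : ℝ) (z : State) :
    massPart M (translationState h z) = translationState h (massPart M z) := by
  simp only [massPart_apply, translationState_apply, actL2_translation, Prod.fst_zero,
    Prod.snd_zero, Pi.zero_apply, map_zero]
  rfl

theorem coupling_translation (h : ℝ) (z w : State) :
    coupling (translationState h z) (translationState h w) = translationL2 h (coupling z w) := by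
  rw [coupling_apply, coupling_apply, map_sum]
  refine Finset.sum_congr rfl fun μ _ => ?_
  rw [← actL2_translation, translationState_apply h w]
  congr 1
  exact mulL2_translation (potential_pot_translation μ h z) w.1

theorem quadraticPart_translation (h : ℝ) (z w : State) :
    quadraticPart (translationState h z) (translationState h w) =
      translationState h (quadraticPart z w) := by
  rw [quadraticPart_apply, quadraticPart_apply, coupling_translation]
  simp only [translationState_apply, currentL_translation, map_neg]

/-- The Maxwell-Dirac system with mass `M`. -/
def mdSystem (M : ℝ) : TransportSystem State where
  τ := translationState
  proj := leftProj
  L := massPart M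
  B := quadraticPart
  proj_proj := leftProj_leftProj
  proj_τ := leftProj_translation
  L_τ := massPart_translation M
  B_τ := quadraticPart_translation

/-- The free evolution of spinors. -/
def evolveL2 (t : ℝ) (f : L2) : L2 :=
  translationL2 t (actL2 leftMatrix f) + translationL2 (-t) (f - actL2 leftMatrix f)

theorem mdSystem_S (M t : ℝ) (z : State) : (mdSystem M).S t z =
    (evolveL2 t z.1, z.2.1, fun μ => translationL1 t (z.2.2.1 μ),
      fun μ => translationL1 (-t) (z.2.2.2 μ)) := by
  refine Prod.ext rfl (Prod.ext ?_ (Prod.ext ?_ ?_))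
  · change z.2.1 + (z.2.1 - z.2.1) = _
    simp
  · funext μ
    change translationL1 t (z.2.2.1 μ) + translationL1 (-t) (z.2.2.1 μ - z.2.2.1 μ) = _
    simp
  · funext μ
    change translationL1 t 0 + translationL1 (-t) (z.2.2.2 μ - 0) = _
    simp

theorem mdSystem_nonlin (M : ℝ) (z : State) : (mdSystem M).nonlin z =
    (actL2 (-(Complex.I * M) • γ 0) z.1 + coupling z z, 0, fun μ => -currentL μ z.1 z.1,
      fun μ => -currentL μ z.1 z.1) := by
  refine Prod.ext rfl (Prod.ext ?_ (Prod.ext ?_ ?_))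
  · exact add_zero _
  · exact zero_add _
  · exact zero_add _

/-! ### Conservation of charge and the a priori bound -/

theorem inner_translationL2 (t : ℝ) (f g : L2) :
    inner ℂ f (translationL2 (-t) g) = inner ℂ (translationL2 t f) g := by
  rw [L2.inner_def, L2.inner_def, ← integral_add_right_eq_self _ t]
  refine integral_congr_ae ?_
  filter_upwards [coeFn_translation (by simp) t f,
    comp_add_ae_eq t (coeFn_translation (by simp) (-t) g)] with x h1 h2
  rw [h1, h2, add_neg_cancel_right]

theorem inner_act_leftMatrix (v w : Spinor) :
    inner ℂ v (act leftMatrix w) = inner ℂ (act leftMatrix v) w := by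
  simp [EuclideanSpace.inner_eq_star_dotProduct, act_ofLp, leftMatrix, Matrix.mulVec, dotProduct,
    Fin.sum_univ_two]

theorem inner_actL2_leftMatrix (f g : L2) :
    inner ℂ f (actL2 leftMatrix g) = inner ℂ (actL2 leftMatrix f) g := by
  rw [L2.inner_def, L2.inner_def]
  refine integral_congr_ae ?_
  filter_upwards [coeFn_actL2 leftMatrix f, coeFn_actL2 leftMatrix g] with x h1 h2
  rw [h1, h2, inner_act_leftMatrix]

/-- The free evolution of spinors is unitary: translations are unitary, and `leftMatrix` is an
orthogonal projection commuting with them. -/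
theorem inner_evolveL2_neg (t : ℝ) (f g : L2) :
    inner ℂ f (evolveL2 (-t) g) = inner ℂ (evolveL2 t f) g := by
  have h : inner ℂ f (translationL2 t (g - actL2 leftMatrix g)) =
      inner ℂ (translationL2 (-t) f) (g - actL2 leftMatrix g) := by
    simpa using inner_translationL2 (-t) f (g - actL2 leftMatrix g)
  rw [evolveL2, evolveL2, inner_add_right, inner_add_left, inner_translationL2, neg_neg, h,
    inner_sub_right, inner_actL2_leftMatrix, inner_actL2_leftMatrix, ← inner_sub_left,
    actL2_translation, actL2_translation, ← map_sub]

/-- γ⁰ is Hermitian, so the mass term is skew-Hermitian. -/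
theorem re_inner_act_gamma (v : Spinor) (a : ℝ) :
    (inner ℂ v (act (-(Complex.I * a) • γ 0) v)).re = 0 := by
  simp [EuclideanSpace.inner_eq_star_dotProduct, act_ofLp, γ, Matrix.mulVec, dotProduct,
    Fin.sum_univ_two]
  ring

/-- γ⁰γ^μ is Hermitian and the potential is real, so the coupling is skew-Hermitian. -/
theorem re_inner_act_gamma_mul (v : Spinor) (μ : Fin 2) (a : ℝ) :
    (inner ℂ v (act (Complex.I • (γ 0 * γ μ)) (a • v))).re = 0 := by
  fin_cases μ <;>
  · simp [EuclideanSpace.inner_eq_star_dotProduct, act_ofLp, γ, Matrix.mulVec, dotProduct,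
      Fin.sum_univ_two]
    ring

/-- Infinitesimal conservation of charge: mass term and coupling are pointwise skew-Hermitian. -/
theorem re_inner_nonlin (M : ℝ) (z : State) : (inner ℂ z.1 ((mdSystem M).nonlin z).1).re = 0 := by
  rw [mdSystem_nonlin]
  simp only [coupling_apply, inner_add_right, inner_sum, Complex.add_re, Complex.re_sum]
  have hre : ∀ f g : L2, (∀ᵐ x, (inner ℂ (f x) (g x)).re = 0) → (inner ℂ f g).re = 0 := by
    intro f g h
    rw [L2.inner_def]
    have h1 := integral_re (𝕜 := ℂ) (L2.integrable_inner (𝕜 := ℂ) f g)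
    rw [← RCLike.re_eq_complex_re, ← h1]
    exact integral_eq_zero_of_ae h
  have h1 : (inner ℂ z.1 (actL2 (-(Complex.I * M) • γ 0) z.1)).re = 0 := by
    refine hre _ _ ?_
    filter_upwards [coeFn_actL2 (-(Complex.I * M) • γ 0) z.1] with x hx
    rw [hx, re_inner_act_gamma]
  have h2 : ∀ μ, (inner ℂ z.1 (actL2 (Complex.I • (γ 0 * γ μ))
      (mulL2 (potential (State.pot μ z)) z.1))).re = 0 := by
    intro μ
    refine hre _ _ ?_
    filter_upwards [coeFn_actL2 (Complex.I • (γ 0 * γ μ))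
      (mulL2 (potential (State.pot μ z)) z.1), coeFn_mulL2 (potential (State.pot μ z)) z.1]
      with x hx hx'
    rw [hx, hx', re_inner_act_gamma_mul]
  rw [h1, zero_add]
  exact Finset.sum_eq_zero fun μ _ => h2 μ

theorem re_inner_field (M t : ℝ) (z : State) :
    (inner ℂ z.1 ((mdSystem M).toQuadField.field t z).1).re = 0 := by
  rw [TransportSystem.field_apply, mdSystem_S]
  change (inner ℂ z.1 (evolveL2 (-t) _)).re = 0
  rw [inner_evolveL2_neg]
  have := re_inner_nonlin M ((mdSystem M).S t z)
  rwa [mdSystem_S] at this ⊢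

/-- The potential components are driven by the current alone, which is quadratic in ψ and free of A.
A bound for the charge therefore bounds their growth. -/
theorem norm_field_snd_le (M t : ℝ) (z : State) :
    ‖((mdSystem M).toQuadField.field t z).2‖ ≤
      (∑ μ, ‖currentL μ‖) * ((mdSystem M).growth * ‖z.1‖) ^ 2 := by
  have h1 : ‖evolveL2 t z.1‖ ≤ (mdSystem M).growth * ‖z.1‖ := by
    have h2 := (mdSystem M).norm_S_le t (z.1, 0)
    rw [mdSystem_S, Prod.norm_mk z.1, norm_zero, max_eq_left (norm_nonneg _)] at h2
    exact (norm_fst_le _).trans h2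
  have h2 : ∀ μ, ‖-currentL μ (evolveL2 t z.1) (evolveL2 t z.1)‖ ≤
      (∑ μ, ‖currentL μ‖) * ((mdSystem M).growth * ‖z.1‖) ^ 2 := by
    intro μ
    rw [norm_neg]
    refine ((currentL μ).le_opNorm₂ _ _).trans ?_
    rw [mul_assoc, ← sq]
    gcongr
    exact norm_currentL_le_sum μ
  have h0 : 0 ≤ (∑ μ, ‖currentL μ‖) * ((mdSystem M).growth * ‖z.1‖) ^ 2 := by positivity
  rw [TransportSystem.field_apply, mdSystem_nonlin, mdSystem_S, mdSystem_S]
  refine norm_prod_le_iff.2 ⟨?_, norm_prod_le_iff.2 ⟨?_, ?_⟩⟩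
  · change ‖(0 : Fin 2 → ℝ)‖ ≤ _
    rwa [norm_zero]
  all_goals
    refine (pi_norm_le_iff_of_nonneg h0).2 fun μ => ?_
    refine (IsometryGroup.norm_map _ _ _).trans_le (h2 μ)

/-- The L² norm of the spinor is conserved, and the other components then have a derivative bounded
by a constant, so they grow at most linearly in time. -/
theorem mdSystem_apriori (M T : ℝ) (hT : 0 ≤ T) (R : ℝ) :
    ∃ R' : ℝ, ∀ (d : State) (W : Curve T State), ‖d‖ ≤ R →
      (mdSystem M).toQuadField.defect hT W = ContinuousMap.const _ d → ‖W‖ ≤ R' := by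
  set Q := (mdSystem M).toQuadField with hQ
  let C : ℝ := (∑ μ, ‖currentL μ‖) * ((mdSystem M).growth * |R|) ^ 2
  have hC : 0 ≤ C := by positivity
  -- The absolute value is needed since `R` carries no sign. `C` bounds the sources when the charge
  -- norm is at most |R|.
  refine ⟨|R| + C * T, fun d W hd hW => ?_⟩
  have hR : ‖d‖ ≤ |R| := hd.trans (le_abs_self R)
  let u : ℝ → State := extend hT W
  have hu : Continuous u := continuous_extend hT W
  -- This curve is differentiable on all of ℝ and agrees with `W` on [-T, T], which avoids one-sided
  -- derivatives at the endpoints.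
  let U : ℝ → State := fun t => d + ∫ s in (0 : ℝ)..t, Q.field s (u s)
  have hU : ∀ t, HasDerivAt U (Q.field t (u t)) t := fun t =>
    ((Q.continuous_field_comp hu).integral_hasStrictDerivAt 0 t).hasDerivAt.const_add d
  have hUu : ∀ t ∈ Icc (-T) T, U t = u t := fun t ht =>
    ((Q.defect_eq_const_iff hT W d u fun t => (extend_apply hT W t).symm).1 hW t ht).symm
  have hU0 : U 0 = d := by simp [U]
  have hψ : ∀ t ∈ Icc (-T) T, ‖(u t).1‖ = ‖d.1‖ := by
    intro t ht
    have hU1 : ∀ s, HasDerivAt (fun s => (U s).1) (Q.field s (u s)).1 s := fun s =>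
      (ContinuousLinearMap.fst ℝ L2 _).hasFDerivAt.comp_hasDerivAt s (hU s)
    have h1 : ∀ s ∈ uIcc 0 t, HasDerivAt (fun s => inner ℂ (U s).1 (U s).1) (0 : ℂ) s := by
      intro s hs
      refine ((hU1 s).inner ℂ (hU1 s)).congr_deriv ?_
      rw [hUu s (mem_Icc_of_mem_uIcc ht hs), ← inner_conj_symm (Q.field s (u s)).1 (u s).1,
        Complex.add_conj, re_inner_field]
      simp
    have h2 := intervalIntegral.integral_eq_sub_of_hasDerivAt h1 (by simp)
    rw [intervalIntegral.integral_zero, hUu t ht, hU0, eq_comm, sub_eq_zero,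
      inner_self_eq_norm_sq_to_K, inner_self_eq_norm_sq_to_K] at h2
    have h3 : ‖(u t).1‖ ^ 2 = ‖d.1‖ ^ 2 := by exact_mod_cast h2
    exact (sq_eq_sq₀ (norm_nonneg _) (norm_nonneg _)).1 h3
  have hψ' : ∀ t ∈ Icc (-T) T, ‖(u t).1‖ ≤ |R| := fun t ht =>
    (hψ t ht).trans_le ((norm_fst_le d).trans hR)
  rw [ContinuousMap.norm_le _ (by positivity)]
  intro t
  rw [← extend_apply hT W t]
  refine norm_prod_le_iff.2 ⟨(hψ' t t.2).trans (by linarith [mul_nonneg hC hT]), ?_⟩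
  have h4 : ‖(U t).2 - d.2‖ ≤ C * |(t : ℝ) - 0| := by
    have h5 : (U t).2 - d.2 = ∫ s in (0 : ℝ)..t, (Q.field s (u s)).2 := by
      change d.2 + (ContinuousLinearMap.snd ℝ L2 _) (∫ s in (0 : ℝ)..t, Q.field s (u s)) - d.2 = _
      rw [← ContinuousLinearMap.intervalIntegral_comp_comm _
        ((Q.continuous_field_comp hu).intervalIntegrable _ _)]
      simp
    rw [h5]
    refine intervalIntegral.norm_integral_le_of_norm_le_const fun s hs => ?_
    refine (norm_field_snd_le M s (u s)).trans ?_
    have h6 := hψ' s (mem_Icc_of_mem_uIoc t.2 hs)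
    have h7 := (mdSystem M).growth_nonneg
    have h8 : (mdSystem M).growth * ‖(u s).1‖ ≤ (mdSystem M).growth * |R| :=
      mul_le_mul_of_nonneg_left h6 h7
    exact mul_le_mul_of_nonneg_left (pow_le_pow_left₀ (by positivity) h8 2) (by positivity)
  have h6 : |(t : ℝ) - 0| ≤ T := by rw [sub_zero]; exact abs_le.2 t.2
  change ‖(u t).2‖ ≤ _
  rw [← hUu t t.2]
  calc ‖(U t).2‖ ≤ ‖d.2‖ + ‖(U t).2 - d.2‖ := norm_le_insert' _ _
    _ ≤ |R| + C * T := by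
      have h7 := (norm_snd_le d).trans hR
      have h8 := mul_le_mul_of_nonneg_left h6 hC
      linarith

/-! ### Test functions -/

/-- Smooth compactly supported real functions. -/
structure IsTest {V : Type*} [NormedAddCommGroup V] [NormedSpace ℝ V] (φ : V → ℝ) : Prop where
  contDiff : ContDiff ℝ ∞ φ
  hasCompactSupport : HasCompactSupport φ

theorem IsTest.continuous {V : Type*} [NormedAddCommGroup V] [NormedSpace ℝ V] {φ : V → ℝ}
    (hφ : IsTest φ) : Continuous φ := hφ.contDiff.continuous

theorem hasFDerivAt_pd {φ : ℝ × ℝ → ℝ} (hφ : ContDiff ℝ 1 φ) (p : ℝ × ℝ) :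
    HasFDerivAt φ (fderiv ℝ φ p) p :=
  ((hφ.differentiable (by simp)) p).hasFDerivAt

theorem hasDerivAt_pd_zero {φ : ℝ × ℝ → ℝ} (hφ : ContDiff ℝ 1 φ) (t x : ℝ) :
    HasDerivAt (fun s => φ (s, x)) (pd 0 φ (t, x)) t :=
  (hasFDerivAt_pd hφ (t, x)).comp_hasDerivAt t ((hasDerivAt_id t).prodMk (hasDerivAt_const t x))

theorem hasDerivAt_pd_one {φ : ℝ × ℝ → ℝ} (hφ : ContDiff ℝ 1 φ) (t x : ℝ) :
    HasDerivAt (fun y => φ (t, y)) (pd 1 φ (t, x)) x :=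
  (hasFDerivAt_pd hφ (t, x)).comp_hasDerivAt x ((hasDerivAt_const x t).prodMk (hasDerivAt_id x))

theorem IsTest.pd {φ : ℝ × ℝ → ℝ} (hφ : IsTest φ) (μ : Fin 2) : IsTest (pd μ φ) where
  contDiff := (hφ.contDiff.fderiv_right (m := ∞) (by simp)).clm_apply contDiff_const
  hasCompactSupport := hφ.hasCompactSupport.fderiv_apply ℝ _

theorem tsupport_pd_subset (φ : ℝ × ℝ → ℝ) (μ : Fin 2) : tsupport (pd μ φ) ⊆ tsupport φ :=
  tsupport_fderiv_apply_subset ℝ _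

theorem IsTest.deriv {φ : ℝ → ℝ} (hφ : IsTest φ) : IsTest (deriv φ) where
  contDiff := by
    have h := hφ.contDiff
    rw [contDiff_infty_iff_deriv] at h
    exact h.2
  hasCompactSupport := hφ.hasCompactSupport.deriv

theorem IsTest.hasDerivAt {φ : ℝ → ℝ} (hφ : IsTest φ) (x : ℝ) :
    HasDerivAt φ (_root_.deriv φ x) x :=
  ((hφ.contDiff.differentiable (by simp)) x).hasDerivAt

theorem IsTest.comp_add {φ : ℝ → ℝ} (hφ : IsTest φ) (a : ℝ) : IsTest fun x => φ (x + a) where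
  contDiff := hφ.contDiff.comp (contDiff_id.add contDiff_const)
  hasCompactSupport := hφ.hasCompactSupport.comp_homeomorph (Homeomorph.addRight a)

/-- The shear `(t, x) ↦ (t, x + c t)`. -/
def shear (c : ℝ) : ℝ × ℝ ≃ₜ ℝ × ℝ where
  toFun p := (p.1, p.2 + c * p.1)
  invFun p := (p.1, p.2 - c * p.1)
  left_inv p := by simp
  right_inv p := by simp
  continuous_toFun := by fun_prop
  continuous_invFun := by fun_prop

theorem shear_apply (c : ℝ) (p : ℝ × ℝ) : shear c p = (p.1, p.2 + c * p.1) := rfl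

theorem IsTest.comp_shear {φ : ℝ × ℝ → ℝ} (hφ : IsTest φ) (c : ℝ) : IsTest (φ ∘ shear c) where
  contDiff := hφ.contDiff.comp (contDiff_fst.prodMk (contDiff_snd.add
    (contDiff_const.mul contDiff_fst)))
  hasCompactSupport := hφ.hasCompactSupport.comp_homeomorph (shear c)

theorem pd_zero_comp_shear {φ : ℝ × ℝ → ℝ} (hφ : ContDiff ℝ 1 φ) (c t x : ℝ) :
    pd 0 (φ ∘ shear c) (t, x) = pd 0 φ (t, x + c * t) + c * pd 1 φ (t, x + c * t) := by
  have h0 : ContDiff ℝ 1 (φ ∘ shear c) := hφ.comp (contDiff_fst.prodMk (contDiff_snd.add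
    (contDiff_const.mul contDiff_fst)))
  have h1 := hasDerivAt_pd_zero h0 t x
  have h2 : HasDerivAt (fun s : ℝ => (s, x + c * s)) (1, c) t := by
    have := (hasDerivAt_id t).prodMk (((hasDerivAt_id t).const_mul c).const_add x)
    simpa using! this
  have h3 := (hasFDerivAt_pd hφ (t, x + c * t)).comp_hasDerivAt t h2
  rw [h1.unique h3]
  have h4 : ((1 : ℝ), c) = (1, 0) + c • (0, 1) := by simp
  rw [h4, map_add, map_smul]
  rfl

/-- Products of this shape separate time from the characteristic coordinate x + ct; they suffice to
recover a transport equation from its weak form. -/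
theorem IsTest.mul_comp_shear {η χ : ℝ → ℝ} (hη : IsTest η) (hχ : IsTest χ) (c : ℝ) :
    IsTest fun p : ℝ × ℝ => η p.1 * χ (p.2 + c * p.1) := by
  have h : IsTest fun p : ℝ × ℝ => η p.1 * χ p.2 := by
    refine ⟨(hη.contDiff.comp contDiff_fst).mul (hχ.contDiff.comp contDiff_snd), ?_⟩
    refine HasCompactSupport.intro (hη.hasCompactSupport.isCompact.prod
      hχ.hasCompactSupport.isCompact) fun p hp => ?_
    rw [mem_prod, not_and_or] at hp
    rcases hp with hp | hp
    · rw [image_eq_zero_of_notMem_tsupport hp, zero_mul]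
    · rw [image_eq_zero_of_notMem_tsupport hp, mul_zero]
  exact h.comp_shear c

theorem tsupport_mul_comp_shear_subset {T : ℝ} {η χ : ℝ → ℝ} (c : ℝ)
    (hη : tsupport η ⊆ Ioo (-T) T) :
    tsupport (fun p : ℝ × ℝ => η p.1 * χ (p.2 + c * p.1)) ⊆ strip T := by
  have h1 : tsupport (fun p : ℝ × ℝ => η p.1 * χ (p.2 + c * p.1)) ⊆ Prod.fst ⁻¹' tsupport η := by
    refine closure_minimal (fun p hp => subset_tsupport η fun h => hp ?_)
      ((isClosed_tsupport η).preimage continuous_fst)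
    simp [h]
  exact fun p hp => ⟨hη (h1 hp), mem_univ _⟩

theorem eq_zero_of_notMem_strip {T : ℝ} {φ : ℝ × ℝ → ℝ} (hφ : tsupport φ ⊆ strip T) {t : ℝ}
    (ht : t ∉ Ioo (-T) T) (x : ℝ) : φ (t, x) = 0 :=
  image_eq_zero_of_notMem_tsupport fun h => ht (hφ h).1

/-- Uniform continuity of `φ` makes its slices a continuous curve in the supremum norm, so
time-dependent pairings reduce to a bounded bilinear map. -/
theorem exists_slice {φ : ℝ × ℝ → ℝ} (hc : Continuous φ) (hs : HasCompactSupport φ) :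
    ∃ Φ : ℝ → (ℝ →ᵇ ℝ), Continuous Φ ∧ ∀ t x, Φ t x = φ (t, x) := by
  obtain ⟨C, hC⟩ := hs.exists_bound_of_continuous hc
  let Φ : ℝ → (ℝ →ᵇ ℝ) := fun t => BoundedContinuousFunction.ofNormedAddCommGroup
    (fun x => φ (t, x)) (by fun_prop) C fun x => hC _
  refine ⟨Φ, ?_, fun t x => rfl⟩
  have hu := hs.uniformContinuous_of_continuous hc
  rw [Metric.uniformContinuous_iff] at hu
  rw [Metric.continuous_iff]
  intro t ε hε
  obtain ⟨δ, hδ, h⟩ := hu (ε / 2) (half_pos hε)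
  refine ⟨δ, hδ, fun s hst => ?_⟩
  refine ((BoundedContinuousFunction.dist_le (half_pos hε).le).2 fun x => ?_).trans_lt
    (half_lt_self hε)
  refine (h ?_).le
  rw [Prod.dist_eq, dist_self]
  exact max_lt hst hδ

theorem exists_radius {φ : ℝ × ℝ → ℝ} (hs : HasCompactSupport φ) :
    ∃ R : ℝ, ∀ t x, x ∉ Icc (-R) R → φ (t, x) = 0 := by
  obtain ⟨R, hR⟩ := hs.isCompact.isBounded.exists_norm_le
  refine ⟨R, fun t x hx => image_eq_zero_of_notMem_tsupport fun h => hx ?_⟩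
  exact abs_le.1 ((norm_snd_le (t, x)).trans (hR _ h))

/-- The derivative exists in the supremum norm because the slices are the primitive of a continuous
curve of bounded continuous functions. -/
theorem hasDerivAt_slice {φ : ℝ × ℝ → ℝ} (hφ : IsTest φ) {Φ Φ' : ℝ → (ℝ →ᵇ ℝ)}
    (hΦ : ∀ t x, Φ t x = φ (t, x)) (hc : Continuous Φ') (hΦ' : ∀ t x, Φ' t x = pd 0 φ (t, x))
    (t : ℝ) : HasDerivAt Φ (Φ' t) t := by
  have h1 : Φ = fun t => Φ 0 + ∫ s in (0 : ℝ)..t, Φ' s := by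
    funext t
    ext x
    rw [BoundedContinuousFunction.add_apply]
    have h2 := (BoundedContinuousFunction.evalCLM ℝ x).intervalIntegral_comp_comm
      (hc.intervalIntegrable (μ := volume) 0 t)
    simp only [BoundedContinuousFunction.evalCLM_apply] at h2
    have h3 := intervalIntegral.integral_eq_sub_of_hasDerivAt (a := 0) (b := t)
      (fun s _ => hasDerivAt_pd_zero (hφ.contDiff.of_le (by simp)) s x)
      (((hφ.pd 0).continuous.comp (by fun_prop : Continuous fun s : ℝ => (s, x))).intervalIntegrable
        _ _)
    rw [← h2]
    simp only [hΦ', hΦ]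
    rw [h3]
    ring
  rw [h1]
  exact (hc.integral_hasStrictDerivAt 0 t).hasDerivAt.const_add _

/-! ### Banach spaces of locally integrable functions -/

/-- A realization of the elements of a Banach space as locally integrable functions on `ℝ`. -/
structure Realization (X E : Type*) [NormedAddCommGroup X] [NormedSpace ℝ X]
    [NormedAddCommGroup E] [NormedSpace ℝ E] where
  /-- the function realizing an element -/
  fn : X → ℝ → E
  locallyIntegrable : ∀ f, LocallyIntegrable (fn f) volume
  fn_add : ∀ f g, fn (f + g) =ᵐ[volume] fun x => fn f x + fn g x
  fn_smul : ∀ (c : ℝ) f, fn (c • f) =ᵐ[volume] fun x => c • fn f x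
  bound : ∀ R : ℝ, ∃ C : ℝ, ∀ f, ∫ x in Icc (-R) R, ‖fn f x‖ ≤ C * ‖f‖

namespace Realization

variable {X E : Type*} [NormedAddCommGroup X] [NormedSpace ℝ X]
    [NormedAddCommGroup E] [NormedSpace ℝ E] (ρ : Realization X E)

theorem integrableOn (f : X) (R : ℝ) : IntegrableOn (ρ.fn f) (Icc (-R) R) :=
  (ρ.locallyIntegrable f).integrableOn_isCompact isCompact_Icc

theorem integrableOn_smul (χ : ℝ →ᵇ ℝ) (f : X) (R : ℝ) :
    IntegrableOn (fun x => χ x • ρ.fn f x) (Icc (-R) R) :=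
  (ρ.integrableOn f R).continuousOn_smul χ.continuous.continuousOn isCompact_Icc

/-- The pairing with a function on the interval `[-R, R]`. -/
def pairL (R : ℝ) : (ℝ →ᵇ ℝ) →L[ℝ] X →L[ℝ] E :=
  LinearMap.mkContinuous₂ (LinearMap.mk₂ ℝ
    (fun χ f => ∫ x in Icc (-R) R, χ x • ρ.fn f x)
    (fun χ χ' f => by
      rw [← integral_add (ρ.integrableOn_smul χ f R) (ρ.integrableOn_smul χ' f R)]
      simp [add_smul])
    (fun c χ f => by
      rw [← integral_smul]
      simp [mul_smul])
    (fun χ f f' => by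
      rw [← integral_add (ρ.integrableOn_smul χ f R) (ρ.integrableOn_smul χ f' R)]
      refine integral_congr_ae (ae_restrict_of_ae ?_)
      filter_upwards [ρ.fn_add f f'] with x hx
      rw [hx, smul_add])
    (fun c χ f => by
      rw [← integral_smul]
      refine integral_congr_ae (ae_restrict_of_ae ?_)
      filter_upwards [ρ.fn_smul c f] with x hx
      rw [hx, smul_comm])) (ρ.bound R).choose (by
    intro χ f
    have h := (ρ.bound R).choose_spec f
    calc ‖∫ x in Icc (-R) R, χ x • ρ.fn f x‖ ≤ ∫ x in Icc (-R) R, ‖χ x • ρ.fn f x‖ :=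
          norm_integral_le_integral_norm _
      _ ≤ ∫ x in Icc (-R) R, ‖χ‖ * ‖ρ.fn f x‖ := by
        refine integral_mono (ρ.integrableOn_smul χ f R).norm
          ((ρ.integrableOn f R).norm.const_mul _) fun x => ?_
        simp only [norm_smul]
        gcongr
        exact χ.norm_coe_le_norm x
      _ = ‖χ‖ * ∫ x in Icc (-R) R, ‖ρ.fn f x‖ := integral_const_mul _ _
      _ ≤ ‖χ‖ * ((ρ.bound R).choose * ‖f‖) := by gcongr
      _ = _ := by ring)

/-- The pairing `∫ φ f`. -/
def pair (φ : ℝ → ℝ) (f : X) : E := ∫ x, φ x • ρ.fn f x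

/-- Restricting to an interval that contains the support makes the pairing bounded bilinear in the
test function (supremum norm) and the element. -/
theorem pair_eq_pairL {φ : ℝ → ℝ} {R : ℝ} (hR : ∀ x, x ∉ Icc (-R) R → φ x = 0) {Φ : ℝ →ᵇ ℝ}
    (hΦ : ∀ x, Φ x = φ x) (f : X) : ρ.pair φ f = ρ.pairL R Φ f := by
  change _ = ∫ x in Icc (-R) R, Φ x • ρ.fn f x
  simp only [hΦ]
  refine (setIntegral_eq_integral_of_forall_compl_eq_zero fun x hx => ?_).symm
  rw [hR x hx, zero_smul]

theorem exists_functional {φ : ℝ → ℝ} (hc : Continuous φ) (hs : HasCompactSupport φ) :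
    ∃ ℓ : X →L[ℝ] E, ∀ f, ℓ f = ρ.pair φ f := by
  obtain ⟨C, hC⟩ := hs.exists_bound_of_continuous hc
  obtain ⟨R, hR⟩ := hs.isCompact.isBounded.exists_norm_le
  refine ⟨ρ.pairL R (BoundedContinuousFunction.ofNormedAddCommGroup φ hc C hC), fun f => ?_⟩
  refine (ρ.pair_eq_pairL (fun x hx => ?_) (fun x => rfl) f).symm
  exact image_eq_zero_of_notMem_tsupport fun h => hx (abs_le.1 (hR _ h))

/-- The pairing with a compactly supported continuous function, as a functional. -/
def functional {φ : ℝ → ℝ} (hφ : IsTest φ) : X →L[ℝ] E :=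
  (ρ.exists_functional hφ.continuous hφ.hasCompactSupport).choose

theorem functional_apply {φ : ℝ → ℝ} (hφ : IsTest φ) (f : X) :
    ρ.functional hφ f = ρ.pair φ f :=
  (ρ.exists_functional hφ.continuous hφ.hasCompactSupport).choose_spec f

theorem integrable_smul {φ : ℝ → ℝ} (hc : Continuous φ) (hs : HasCompactSupport φ) (f : X) :
    Integrable fun x => φ x • ρ.fn f x :=
  (ρ.locallyIntegrable f).integrable_smul_left_of_hasCompactSupport hc hs

theorem ae_eq_of_pair_eq [CompleteSpace E] {f : X} {u : ℝ → E} (hu : LocallyIntegrable u volume)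
    (h : ∀ φ : ℝ → ℝ, IsTest φ → ρ.pair φ f = ∫ x, φ x • u x) : ρ.fn f =ᵐ[volume] u := by
  have h1 : ∀ᵐ x, ρ.fn f x - u x = 0 := by
    refine ae_eq_zero_of_integral_contDiff_smul_eq_zero ((ρ.locallyIntegrable f).sub hu)
      fun φ hφ hs => ?_
    simp only [smul_sub]
    rw [integral_sub (ρ.integrable_smul hφ.continuous hs f)
      (hu.integrable_smul_left_of_hasCompactSupport hφ.continuous hs), sub_eq_zero]
    exact h φ ⟨hφ, hs⟩
  exact h1.mono fun x hx => sub_eq_zero.1 hx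

/-- The space-time pairing `∫∫ φ v`. -/
def pairST (T : ℝ) (φ : ℝ × ℝ → ℝ) (v : ℝ → X) : E :=
  ∫ t in (-T)..T, ρ.pair (fun x => φ (t, x)) (v t)

theorem continuous_pair {φ : ℝ × ℝ → ℝ} (hc : Continuous φ) (hs : HasCompactSupport φ)
    {v : ℝ → X} (hv : Continuous v) : Continuous fun t => ρ.pair (fun x => φ (t, x)) (v t) := by
  obtain ⟨Φ, hΦ, hΦφ⟩ := exists_slice hc hs
  obtain ⟨R, hR⟩ := exists_radius hs
  have h : (fun t => ρ.pair (fun x => φ (t, x)) (v t)) = fun t => ρ.pairL R (Φ t) (v t) := by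
    funext t
    exact ρ.pair_eq_pairL (hR t) (hΦφ t) _
  rw [h]
  exact ((ρ.pairL R).continuous.comp hΦ).clm_apply hv

theorem hasDerivAt_pair {φ : ℝ × ℝ → ℝ} (hφ : IsTest φ) {v : ℝ → X} {v' : X} {t : ℝ}
    (hv : HasDerivAt v v' t) : HasDerivAt (fun t => ρ.pair (fun x => φ (t, x)) (v t))
      (ρ.pair (fun x => pd 0 φ (t, x)) (v t) + ρ.pair (fun x => φ (t, x)) v') t := by
  obtain ⟨Φ, hΦ, hΦφ⟩ := exists_slice hφ.continuous hφ.hasCompactSupport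
  obtain ⟨Φ', hΦ', hΦφ'⟩ := exists_slice (hφ.pd 0).continuous (hφ.pd 0).hasCompactSupport
  obtain ⟨R, hR⟩ := exists_radius hφ.hasCompactSupport
  have hR' : ∀ t x, x ∉ Icc (-R) R → pd 0 φ (t, x) = 0 := by
    intro t x hx
    have h1 := hasDerivAt_pd_zero (hφ.contDiff.of_le (by simp)) t x
    simp only [hR _ x hx] at h1
    exact h1.unique (hasDerivAt_const t 0)
  have h : (fun t => ρ.pair (fun x => φ (t, x)) (v t)) = fun t => ρ.pairL R (Φ t) (v t) := by
    funext t
    exact ρ.pair_eq_pairL (hR t) (hΦφ t) _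
  rw [h, ρ.pair_eq_pairL (hR t) (hΦφ t), ρ.pair_eq_pairL (hR' t) (hΦφ' t)]
  exact ((ρ.pairL R).hasFDerivAt.comp_hasDerivAt t
    (hasDerivAt_slice hφ hΦφ hΦ' hΦφ' t)).clm_apply hv

/-- Integration by parts in time. -/
theorem pairST_pd_zero [CompleteSpace E] {T : ℝ} {φ : ℝ × ℝ → ℝ} (hφ : IsTest φ)
    (hT : tsupport φ ⊆ strip T) {v v' : ℝ → X} (hv : ∀ t, HasDerivAt v (v' t) t)
    (hv' : Continuous v') : ρ.pairST T (pd 0 φ) v = -ρ.pairST T φ v' := by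
  have hvc : Continuous v := continuous_iff_continuousAt.2 fun t => (hv t).continuousAt
  have h0 := ρ.continuous_pair (hφ.pd 0).continuous (hφ.pd 0).hasCompactSupport hvc
  have h1 := ρ.continuous_pair hφ.continuous hφ.hasCompactSupport hv'
  have h2 := intervalIntegral.integral_eq_sub_of_hasDerivAt (a := -T) (b := T)
    (fun t _ => ρ.hasDerivAt_pair hφ (hv t)) ((h0.add h1).intervalIntegrable _ _)
  have h3 : ∀ s, s ∉ Ioo (-T) T → ρ.pair (fun x => φ (s, x)) (v s) = 0 := by
    intro s hs
    simp [pair, eq_zero_of_notMem_strip hT hs]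
  rw [h3 T (by simp), h3 (-T) (by simp), sub_zero, intervalIntegral.integral_add
    (h0.intervalIntegrable _ _) (h1.intervalIntegrable _ _)] at h2
  exact eq_neg_of_add_eq_zero_left h2

theorem pair_comp_sub {f g : X} {h : ℝ} (hfg : ρ.fn g =ᵐ[volume] fun x => ρ.fn f (x + h))
    (φ : ℝ → ℝ) : ρ.pair (fun x => φ (x + h)) g = ρ.pair φ f := by
  rw [pair, pair, ← integral_add_right_eq_self (fun x => φ x • ρ.fn f x) h]
  refine integral_congr_ae ?_
  filter_upwards [hfg] with x hx
  rw [hx]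

/-- A curve which is differentiable in the frame moving with speed `-c` is a weak solution of a
transport equation. -/
theorem pairST_transport [CompleteSpace E] {T : ℝ} {φ : ℝ × ℝ → ℝ} (hφ : IsTest φ)
    (hT : tsupport φ ⊆ strip T) {U U' v F : ℝ → X} (c : ℝ) (hU : ∀ t, HasDerivAt U (U' t) t)
    (hU' : Continuous U')
    (hv : ∀ t, ρ.fn (v t) =ᵐ[volume] fun x => ρ.fn (U t) (x + c * t))
    (hF : ∀ t, ρ.fn (F t) =ᵐ[volume] fun x => ρ.fn (U' t) (x + c * t)) :
    ρ.pairST T (fun p => pd 0 φ p - c * pd 1 φ p) v = -ρ.pairST T φ F := by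
  -- In the moving frame the test function is φ(t, x − ct), whose time derivative is the sheared ∂ₜφ
  -- − c ∂ₓφ; integration by parts in time is then enough.
  have h1 := ρ.pairST_pd_zero (hφ.comp_shear (-c)) (T := T) (fun p hp => by
    have h2 := tsupport_comp_subset_preimage φ (shear (-c)).continuous hp
    exact ⟨(hT h2).1, mem_univ _⟩) hU hU'
  have e1 : ρ.pairST T (pd 0 (φ ∘ shear (-c))) U =
      ρ.pairST T (fun p => pd 0 φ p - c * pd 1 φ p) v := by
    refine intervalIntegral.integral_congr fun t _ => ?_
    rw [← ρ.pair_comp_sub (hv t)]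
    congr 1
    funext x
    rw [pd_zero_comp_shear (hφ.contDiff.of_le (by simp))]
    rw [neg_mul, add_neg_cancel_right, neg_mul]
    exact (sub_eq_add_neg _ _).symm
  have e2 : ρ.pairST T (φ ∘ shear (-c)) U' = ρ.pairST T φ F := by
    refine intervalIntegral.integral_congr fun t _ => ?_
    rw [← ρ.pair_comp_sub (hF t)]
    congr 1
    funext x
    rw [Function.comp_apply, shear_apply, neg_mul, add_neg_cancel_right]
  rw [← e1, h1, e2]

end Realization

/-! ### The lemma of du Bois-Reymond -/

/-- The primitive from -T vanishes to the left of the support, and to the right of it because the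
total integral is zero. -/
theorem IsTest.exists_antideriv {f : ℝ → ℝ} (hf : IsTest f) {T : ℝ}
    (hfT : tsupport f ⊆ Ioo (-T) T) (h0 : ∫ t in (-T)..T, f t = 0) :
    ∃ η : ℝ → ℝ, IsTest η ∧ tsupport η ⊆ Ioo (-T) T ∧ _root_.deriv η = f := by
  let η : ℝ → ℝ := fun t => ∫ s in (-T)..t, f s
  have hd : ∀ t, HasDerivAt η (f t) t := fun t =>
    (hf.continuous.integral_hasStrictDerivAt (-T) t).hasDerivAt
  have hd' : _root_.deriv η = f := funext fun t => (hd t).deriv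
  obtain ⟨a, b, hab, hsub⟩ : ∃ a b, Icc a b ⊆ Ioo (-T) T ∧ tsupport f ⊆ Icc a b := by
    rcases (tsupport f).eq_empty_or_nonempty with h | h
    -- For empty support, an empty interval.
    · exact ⟨1, 0, by simp, by simp [h]⟩
    · obtain ⟨a, ha⟩ := hf.hasCompactSupport.isCompact.exists_isLeast h
      obtain ⟨b, hb⟩ := hf.hasCompactSupport.isCompact.exists_isGreatest h
      exact ⟨a, b, fun x hx => ⟨(hfT ha.1).1.trans_le hx.1, hx.2.trans_lt (hfT hb.1).2⟩,
        fun x hx => ⟨ha.2 hx, hb.2 hx⟩⟩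
  have hz : ∀ t, t ∉ Icc a b → f t = 0 := fun t ht =>
    image_eq_zero_of_notMem_tsupport fun h => ht (hsub h)
  have hη : ∀ t, t ∉ Icc a b → η t = 0 := by
    intro t ht
    by_cases h : t < a
    · change ∫ s in (-T)..t, f s = 0
      by_cases hT : -T < a
      · refine (intervalIntegral.integral_congr fun s hs => ?_).trans
          intervalIntegral.integral_zero
        refine hz s fun hs' => ?_
        rcases mem_uIcc.1 hs with h1 | h1
        · linarith [h1.2, hs'.1]
        · linarith [h1.2, hs'.1]
      · refine (intervalIntegral.integral_congr fun s hs => ?_).trans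
          intervalIntegral.integral_zero
        refine hz s fun hs' => hT ?_
        exact (hab ⟨le_rfl, hs'.1.trans hs'.2⟩).1
    · have hbt : a ≤ b → b < t := fun hab' => by
        by_contra hb
        exact ht ⟨not_lt.1 h, not_lt.1 hb⟩
      have h1 : η t = (∫ s in (-T)..T, f s) + ∫ s in T..t, f s :=
        (intervalIntegral.integral_add_adjacent_intervals (hf.continuous.intervalIntegrable _ _)
          (hf.continuous.intervalIntegrable _ _)).symm
      rw [h1, h0, zero_add]
      refine (intervalIntegral.integral_congr fun s hs => ?_).trans
          intervalIntegral.integral_zero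
      refine hz s fun hs' => ?_
      have h2 := hs'.1.trans hs'.2
      have h3 := (hab ⟨h2, le_rfl⟩).2
      have h4 := hbt h2
      rcases mem_uIcc.1 hs with h1 | h1
      · linarith [h1.1, hs'.2]
      · linarith [h1.1, hs'.2]
  have hts : tsupport η ⊆ Icc a b := closure_minimal (fun t ht => by
    by_contra h
    exact ht (hη t h)) isClosed_Icc
  refine ⟨η, ⟨contDiff_infty_iff_deriv.2 ⟨fun t => (hd t).differentiableAt, ?_⟩,
    HasCompactSupport.intro isCompact_Icc fun t ht => hη t ht⟩, hts.trans hab, hd'⟩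
  rw [hd']
  exact hf.contDiff

theorem intervalIntegral_smul_eq_integral {E : Type*} [NormedAddCommGroup E] [NormedSpace ℝ E]
    {T : ℝ} {f : ℝ → ℝ} (hfT : tsupport f ⊆ Ioo (-T) T) (k : ℝ → E) :
    ∫ t in (-T)..T, f t • k t = ∫ t, f t • k t := by
  refine intervalIntegral.integral_eq_integral_of_support_subset fun t ht => ?_
  have h1 := hfT (subset_tsupport f (fun h => ht (by simp [h]) : t ∈ Function.support f))
  exact ⟨h1.1, h1.2.le⟩

/-- A continuous function with vanishing distributional derivative is constant. -/
theorem eq_of_forall_integral_deriv_smul_eq_zero {E : Type*} [NormedAddCommGroup E]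
    [NormedSpace ℝ E] [CompleteSpace E] {k : ℝ → E} (hk : Continuous k) {T : ℝ} (hT : 0 < T)
    (h : ∀ η : ℝ → ℝ, IsTest η → tsupport η ⊆ Ioo (-T) T →
      ∫ t in (-T)..T, deriv η t • k t = 0) : ∀ t ∈ Icc (-T) T, k t = k 0 := by
  -- A reference bump of integral one with support in [-T/2, T/2]; its mean of `k` is the candidate
  -- for the constant.
  let b : ContDiffBump (0 : ℝ) := ⟨T / 3, T / 2, by positivity, by linarith⟩
  let f₀ : ℝ → ℝ := b.normed volume
  have hf₀ : IsTest f₀ := ⟨b.contDiff_normed, b.hasCompactSupport_normed⟩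
  have hf₀T : tsupport f₀ ⊆ Ioo (-T) T := by
    rw [b.tsupport_normed_eq, Real.closedBall_eq_Icc]
    intro x hx
    have hr : b.rOut = T / 2 := rfl
    rw [hr] at hx
    constructor <;> linarith [hx.1, hx.2]
  let c : E := ∫ t, f₀ t • k t
  have h1 : ∀ f : ℝ → ℝ, ContDiff ℝ ∞ f → HasCompactSupport f → tsupport f ⊆ Ioo (-T) T →
      ∫ t, f t • (k t - c) = 0 := by
    intro f hf hfs hfT
    let m : ℝ := ∫ t, f t
    -- Subtracting the multiple of the bump with the same integral leaves a function of mean zero,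
    -- which is the derivative of a test function.
    let f₁ : ℝ → ℝ := fun t => f t - m * f₀ t
    have hf₁ : IsTest f₁ := ⟨hf.sub (contDiff_const.mul hf₀.contDiff),
      hfs.sub hf₀.hasCompactSupport.mul_left⟩
    have hf₁T : tsupport f₁ ⊆ Ioo (-T) T := by
      refine (tsupport_sub f fun t => m * f₀ t).trans (union_subset hfT ?_)
      exact (tsupport_mul_subset_right (f := fun _ => m) (g := f₀)).trans hf₀T
    have hif := hf.continuous.integrable_of_hasCompactSupport hfs (μ := volume)
    have hif₀ := hf₀.continuous.integrable_of_hasCompactSupport hf₀.hasCompactSupport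
      (μ := volume)
    have h2 : ∫ t in (-T)..T, f₁ t = 0 := by
      have h3 := intervalIntegral_smul_eq_integral hf₁T (fun _ => (1 : ℝ))
      simp only [smul_eq_mul, mul_one] at h3
      rw [h3]
      change ∫ t, (f t - m * f₀ t) = 0
      rw [integral_sub hif (hif₀.const_mul m), integral_const_mul, b.integral_normed, mul_one,
        sub_self]
    obtain ⟨η, hη, hηT, hd⟩ := hf₁.exists_antideriv hf₁T h2
    have h4 := h η hη hηT
    rw [hd, intervalIntegral_smul_eq_integral hf₁T] at h4
    have hik : ∀ {g : ℝ → ℝ}, Continuous g → HasCompactSupport g →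
        Integrable fun t => g t • k t := fun hg hgs =>
      (hg.smul hk).integrable_of_hasCompactSupport hgs.smul_right
    have h5 : ∫ t, f₁ t • k t = (∫ t, f t • k t) - m • c := by
      change ∫ t, (f t - m * f₀ t) • k t = _
      simp only [sub_smul, mul_smul]
      have h6 := (hik hf₀.continuous hf₀.hasCompactSupport).smul m
      simp only [Pi.smul_def] at h6
      rw [integral_sub (hik hf.continuous hfs) h6, integral_smul]
    simp only [smul_sub]
    rw [integral_sub (hik hf.continuous hfs) (hif.smul_const c), integral_smul_const, ← h5, h4]
  have h2 := isOpen_Ioo.ae_eq_zero_of_integral_contDiff_smul_eq_zero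
    ((hk.sub continuous_const).locallyIntegrable.locallyIntegrableOn (Ioo (-T) T)) h1
  -- Equality almost everywhere becomes equality everywhere: the exceptional set is open and null,
  -- hence empty.
  have h3 : Ioo (-T) T ∩ {t | k t ≠ c} = ∅ := by
    have ho : IsOpen (Ioo (-T) T ∩ {t | k t ≠ c}) :=
      isOpen_Ioo.inter (isOpen_ne_fun hk continuous_const)
    refine (ho.measure_eq_zero_iff volume).1 (measure_mono_null (fun t ht => ?_) h2)
    exact fun h => ht.2 (sub_eq_zero.1 (h ht.1))
  have h4 : Icc (-T) T ⊆ {t | k t = c} := by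
    rw [← closure_Ioo (by linarith : -T ≠ T)]
    refine closure_minimal (fun t ht => ?_) (isClosed_eq hk continuous_const)
    by_contra h
    exact (h3 ▸ (⟨ht, h⟩ : t ∈ Ioo (-T) T ∩ {t | k t ≠ c}) : t ∈ (∅ : Set ℝ))
  intro t ht
  exact (h4 ht).trans (h4 (⟨by linarith, hT.le⟩ : (0 : ℝ) ∈ Icc (-T) T)).symm

/-- A continuous function with continuous distributional derivative is its primitive. -/
theorem eq_add_integral_of_forall_integral_deriv_smul {E : Type*} [NormedAddCommGroup E]
    [NormedSpace ℝ E] [CompleteSpace E] {g h : ℝ → E} (hg : Continuous g) (hh : Continuous h)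
    {T : ℝ} (hT : 0 < T) (H : ∀ η : ℝ → ℝ, IsTest η → tsupport η ⊆ Ioo (-T) T →
      ∫ t in (-T)..T, deriv η t • g t = -∫ t in (-T)..T, η t • h t) :
    ∀ t ∈ Icc (-T) T, g t = g 0 + ∫ s in (0 : ℝ)..t, h s := by
  let G : ℝ → E := fun t => ∫ s in (0 : ℝ)..t, h s
  have hG : ∀ t, HasDerivAt G (h t) t := fun t =>
    (hh.integral_hasStrictDerivAt 0 t).hasDerivAt
  have hGc : Continuous G := continuous_iff_continuousAt.2 fun t => (hG t).continuousAt
  intro t ht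
  have key := eq_of_forall_integral_deriv_smul_eq_zero (hg.sub hGc) hT (fun η hη hηT => by
    have h1 := intervalIntegral.integral_eq_sub_of_hasDerivAt (a := -T) (b := T)
      (fun t _ => (hη.hasDerivAt t).smul (hG t))
      (((hη.continuous.smul hh).add (hη.deriv.continuous.smul hGc)).intervalIntegrable _ _)
    have h2 : ∀ s, s ∉ Ioo (-T) T → η s = 0 := fun s hs =>
      image_eq_zero_of_notMem_tsupport fun h => hs (hηT h)
    have i1 : IntervalIntegrable (fun t => η t • h t) volume (-T) T :=
      (hη.continuous.smul hh).intervalIntegrable _ _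
    have i2 : IntervalIntegrable (fun t => deriv η t • G t) volume (-T) T :=
      (hη.deriv.continuous.smul hGc).intervalIntegrable _ _
    have i3 : IntervalIntegrable (fun t => deriv η t • g t) volume (-T) T :=
      (hη.deriv.continuous.smul hg).intervalIntegrable _ _
    rw [Pi.smul_apply', Pi.smul_apply', h2 T (by simp), h2 (-T) (by simp), zero_smul, zero_smul,
      sub_zero] at h1
    have h3 := (intervalIntegral.integral_add i1 i2).symm.trans h1
    simp only [Pi.sub_apply, smul_sub]
    rw [intervalIntegral.integral_sub i3 i2, H η hη hηT,
      ← eq_neg_of_add_eq_zero_right h3, sub_self]) t ht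
  have h0 : G 0 = 0 := by simp [G]
  rw [Pi.sub_apply, Pi.sub_apply, h0, sub_zero] at key
  exact sub_eq_iff_eq_add.1 key

/-! ### Transport equations along characteristics, and weak derivatives as derivatives of orbits -/

namespace Realization

variable {X E : Type*} [NormedAddCommGroup X] [NormedSpace ℝ X]
    [NormedAddCommGroup E] [NormedSpace ℝ E] (ρ : Realization X E)

/-- The group `τ` acts on realizations by translations. -/
def IsTranslation (τ : IsometryGroup X) : Prop :=
  ∀ h f, ρ.fn (τ h f) =ᵐ[volume] fun x => ρ.fn f (x + h)

variable {ρ}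

theorem IsTranslation.pair_apply {τ : IsometryGroup X} (hτ : ρ.IsTranslation τ) (φ : ℝ → ℝ) (h : ℝ)
    (f : X) : ρ.pair φ (τ h f) = ρ.pair (fun x => φ (x + -h)) f := by
  rw [← ρ.pair_comp_sub (f := τ h f) (g := f) (h := -h)]
  have := hτ (-h) (τ h f)
  rwa [τ.neg_apply_apply] at this

/-- Weak solutions of a transport equation are given by integration along characteristics. -/
theorem IsTranslation.pair_eq_of_pairST_eq [CompleteSpace E] {τ : IsometryGroup X}
    (hτ : ρ.IsTranslation τ) {T : ℝ} (hT : 0 < T) {v F : ℝ → X} (hv : Continuous v)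
    (hF : Continuous F) (c : ℝ)
    (H : ∀ φ : ℝ × ℝ → ℝ, IsTest φ → tsupport φ ⊆ strip T →
      ρ.pairST T (fun p => pd 0 φ p - c * pd 1 φ p) v = -ρ.pairST T φ F)
    {χ : ℝ → ℝ} (hχ : IsTest χ) : ∀ t ∈ Icc (-T) T, ρ.pair χ (τ (-(c * t)) (v t)) =
      ρ.pair χ (v 0) + ∫ s in (0 : ℝ)..t, ρ.pair χ (τ (-(c * s)) (F s)) := by
  have hcont : ∀ {w : ℝ → X}, Continuous w →
      Continuous fun t => ρ.pair χ (τ (-(c * t)) (w t)) := by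
    intro w hw
    simp only [← ρ.functional_apply hχ]
    exact (ρ.functional hχ).continuous.comp (τ.continuous_uncurry.comp
      ((by fun_prop : Continuous fun t : ℝ => -(c * t)).prodMk hw))
  have key := eq_add_integral_of_forall_integral_deriv_smul (hcont hv) (hcont hF) hT
    (fun η hη hηT => by
      have hφ := hη.mul_comp_shear hχ c
      have h1 := H _ hφ (tsupport_mul_comp_shear_subset c hηT)
      -- χ(x + ct) is annihilated by ∂ₜ − c ∂ₓ, so only the time factor is differentiated. This
      -- leaves a weak ordinary differential equation for the pairing of the transported curve with
      -- `χ`.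
      have h2 : ∀ t x, pd 0 (fun p : ℝ × ℝ => η p.1 * χ (p.2 + c * p.1)) (t, x) -
          c * pd 1 (fun p : ℝ × ℝ => η p.1 * χ (p.2 + c * p.1)) (t, x) =
          deriv η t * χ (x + c * t) := by
        intro t x
        have h3 : HasDerivAt (fun s => η s * χ (x + c * s)) (deriv η t * χ (x + c * t) +
            η t * (deriv χ (x + c * t) * c)) t := by
          refine (hη.hasDerivAt t).mul ((hχ.hasDerivAt _).comp t ?_)
          simpa using ((hasDerivAt_id t).const_mul c).const_add x
        have h4 : HasDerivAt (fun y => η t * χ (y + c * t)) (η t * (deriv χ (x + c * t) * 1)) x := by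
          refine ((hχ.hasDerivAt _).comp x ?_).const_mul _
          exact (hasDerivAt_id x).add_const _
        rw [(hasDerivAt_pd_zero (hφ.contDiff.of_le (by simp)) t x).unique h3,
          (hasDerivAt_pd_one (hφ.contDiff.of_le (by simp)) t x).unique h4]
        ring
      have h5 : ∀ (a : ℝ) (t : ℝ) (w : X), ρ.pair (fun x => a * χ (x + c * t)) w =
          a • ρ.pair χ (τ (-(c * t)) w) := by
        intro a t w
        rw [hτ.pair_apply, neg_neg, pair, pair, ← integral_smul]
        simp only [mul_smul]
      simp only [pairST, h2, h5] at h1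
      exact h1)
  intro t ht
  simpa [τ.map_zero] using key t ht

theorem hasDerivAt_pair_comp_sub {χ : ℝ → ℝ} (hχ : IsTest χ) (f : X) (h : ℝ) :
    HasDerivAt (fun h => ρ.pair (fun x => χ (x + -h)) f)
      (-ρ.pair (fun x => deriv χ (x + -h)) f) h := by
  -- Translating `χ` gives a function on the plane without compact support in the parameter; a
  -- cutoff equal to 1 near h repairs this without changing derivatives there.
  let b : ContDiffBump h := ⟨1, 2, by norm_num, by norm_num⟩
  have hb : IsTest b := ⟨b.contDiff, b.hasCompactSupport⟩
  have hφ := hb.mul_comp_shear hχ (-1)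
  have h1 := ρ.hasDerivAt_pair hφ (hasDerivAt_const h f)
  have hb1 : ∀ᶠ s in 𝓝 h, b s = 1 := b.eventuallyEq_one
  have h2 : ∀ x, pd 0 (fun p : ℝ × ℝ => b p.1 * χ (p.2 + -1 * p.1)) (h, x) =
      -deriv χ (x + -h) := by
    intro x
    have h3 : HasDerivAt (fun s => χ (x + -s)) (deriv χ (x + -h) * -1) h :=
      (hχ.hasDerivAt _).comp h ((hasDerivAt_neg h).const_add x)
    have h4 : HasDerivAt (fun s => b s * χ (x + -1 * s)) (deriv χ (x + -h) * -1) h :=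
      h3.congr_of_eventuallyEq (hb1.mono fun s hs => by simp [hs])
    rw [(hasDerivAt_pd_zero (hφ.contDiff.of_le (by simp)) h x).unique h4]
    ring
  have h0 : ρ.pair (fun x => b h * χ (x + -1 * h)) (0 : X) = 0 := by
    have h3 := ρ.functional_apply (hχ.comp_add (-1 * h)) 0
    rw [map_zero] at h3
    simp only [hb1.self_of_nhds, one_mul]
    exact h3.symm
  have h5 : ρ.pair (fun x => -deriv χ (x + -h)) f = -ρ.pair (fun x => deriv χ (x + -h)) f := by
    simp [pair, integral_neg]
  simp only [h2, h5, h0, add_zero] at h1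
  exact h1.congr_of_eventuallyEq (hb1.mono fun s hs => by simp [hs])

variable (ρ) in
/-- The realization determines the element. -/
def IsFaithful : Prop := ∀ f g, ρ.fn f =ᵐ[volume] ρ.fn g → f = g

theorem IsFaithful.eq_of_pair_eq [CompleteSpace E] (hρ : ρ.IsFaithful) {f g : X}
    (h : ∀ χ : ℝ → ℝ, IsTest χ → ρ.pair χ f = ρ.pair χ g) : f = g :=
  hρ f g (ρ.ae_eq_of_pair_eq (ρ.locallyIntegrable g) h)

/-- A distributional derivative in the space is a derivative of the orbit under translations. -/
theorem IsTranslation.hasDerivAt_of_pair [CompleteSpace E] [CompleteSpace X] {τ : IsometryGroup X}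
    (hτ : ρ.IsTranslation τ) (hρ : ρ.IsFaithful) {f f' : X}
    (H : ∀ χ : ℝ → ℝ, IsTest χ → ρ.pair χ f' = -ρ.pair (deriv χ) f) :
    HasDerivAt (fun h => τ h f) f' 0 := by
  have hc := τ.continuous_orbit f'
  -- The orbit of f is the primitive of the orbit of f'. This is checked against test functions;
  -- norm continuity of the orbit of f' then gives a derivative in norm.
  have h1 : ∀ h, τ h f = f + ∫ s in (0 : ℝ)..h, τ s f' := by
    intro h
    refine hρ.eq_of_pair_eq fun χ hχ => ?_
    have h2 : ∀ s, HasDerivAt (fun h => ρ.pair χ (τ h f)) (ρ.pair χ (τ s f')) s := by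
      intro s
      simp only [hτ.pair_apply]
      rw [H _ (hχ.comp_add (-s))]
      have h3 : deriv (fun x => χ (x + -s)) = fun x => deriv χ (x + -s) := by
        funext x
        exact deriv_comp_add_const χ (-s) x
      rw [h3]
      exact hasDerivAt_pair_comp_sub hχ f s
    have h3 : Continuous fun s => ρ.pair χ (τ s f') := by
      simp only [← ρ.functional_apply hχ]
      exact (ρ.functional hχ).continuous.comp hc
    have h4 := intervalIntegral.integral_eq_sub_of_hasDerivAt (a := 0) (b := h)
      (fun s _ => h2 s) (h3.intervalIntegrable _ _)
    rw [← ρ.functional_apply hχ (f + _), map_add, ← ContinuousLinearMap.intervalIntegral_comp_comm _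
      (hc.intervalIntegrable _ _)]
    simp only [ρ.functional_apply hχ]
    rw [h4, τ.map_zero]
    abel
  have h2 := (hc.integral_hasStrictDerivAt 0 0).hasDerivAt.const_add f
  rw [τ.map_zero, ← funext h1] at h2
  exact h2

end Realization

theorem integral_deriv_eq_zero_of_hasCompactSupport {χ : ℝ → ℝ} (hχ : IsTest χ) :
    ∫ x, deriv χ x = 0 :=
  integral_eq_zero_of_hasDerivAt_of_integrable hχ.hasDerivAt
    (hχ.deriv.continuous.integrable_of_hasCompactSupport hχ.deriv.hasCompactSupport)
    (hχ.continuous.integrable_of_hasCompactSupport hχ.hasCompactSupport)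

/-- Fubini on the half plane y ≤ x, with ∫ of χ' over [y, ∞) equal to −χ(y). -/
theorem integral_deriv_mul_antideriv {χ : ℝ → ℝ} (hχ : IsTest χ) (f : L1) :
    ∫ x, deriv χ x * antideriv f x = -∫ x, χ x * f x := by
  have hi := hχ.deriv.continuous.integrable_of_hasCompactSupport hχ.deriv.hasCompactSupport
    (μ := volume)
  have hs : MeasurableSet {p : ℝ × ℝ | p.2 ≤ p.1} := measurableSet_le measurable_snd measurable_fst
  have h1 : ∀ x, deriv χ x * antideriv f x =
      ∫ y, {p : ℝ × ℝ | p.2 ≤ p.1}.indicator (fun p => deriv χ p.1 * f p.2) (x, y) := by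
    intro x
    rw [antideriv_apply, ← integral_const_mul, ← integral_indicator measurableSet_Iic]
    rfl
  have h2 : ∀ y, (-χ y) * f y =
      ∫ x, {p : ℝ × ℝ | p.2 ≤ p.1}.indicator (fun p => deriv χ p.1 * f p.2) (x, y) := by
    intro y
    rw [← hχ.hasCompactSupport.integral_Ioi_deriv_eq (hχ.contDiff.of_le (by simp)) y,
      ← integral_Ici_eq_integral_Ioi, ← integral_mul_const, ← integral_indicator measurableSet_Ici]
    rfl
  simp only [h1]
  rw [integral_integral_swap
    (f := fun x y => {p : ℝ × ℝ | p.2 ≤ p.1}.indicator (fun p => deriv χ p.1 * f p.2) (x, y))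
    (((hi.mul_prod (L1.integrable_coeFn f)).indicator hs))]
  simp only [← h2, neg_mul, integral_neg]

namespace Realization

variable {X E : Type*} [NormedAddCommGroup X] [NormedSpace ℝ X]
    [NormedAddCommGroup E] [NormedSpace ℝ E]

/-! ### Instances of realizations -/

/-- `Lᵖ` functions. -/
def ofLp (E : Type*) [NormedAddCommGroup E] [NormedSpace ℝ E] (p : ENNReal) [Fact (1 ≤ p)] :
    Realization (Lp E p (volume : Measure ℝ)) E where
  fn f := f
  locallyIntegrable f := (Lp.memLp f).locallyIntegrable Fact.out
  fn_add := Lp.coeFn_add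
  fn_smul := Lp.coeFn_smul
  bound R := by
    let ν : Measure ℝ := volume.restrict (Icc (-R) R)
    -- The Hölder constant of the embedding of Lᵖ into L¹ on an interval.
    let K : ENNReal := ν univ ^ (1 / (1 : ENNReal).toReal - 1 / p.toReal)
    have hp : (1 : ENNReal) ≤ p := Fact.out
    have hK : K ≠ ⊤ := by
      refine ENNReal.rpow_ne_top_of_nonneg ?_ (measure_ne_top ν univ)
      rcases eq_or_ne p ⊤ with rfl | hp'
      · simp
      · have h1 : (1 : ENNReal).toReal ≤ p.toReal := ENNReal.toReal_mono hp' hp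
        rw [sub_nonneg]
        exact one_div_le_one_div_of_le (by simp) h1
    refine ⟨K.toReal, fun f => ?_⟩
    have h1 : eLpNorm f 1 ν ≤ eLpNorm f p volume * K :=
      (eLpNorm_le_eLpNorm_mul_rpow_measure_univ hp (Lp.aestronglyMeasurable f).restrict).trans
        (mul_le_mul_left (eLpNorm_restrict_le _ _ _ _) _)
    rw [integral_norm_eq_lintegral_enorm (Lp.aestronglyMeasurable f).restrict,
      ← eLpNorm_one_eq_lintegral_enorm, Lp.norm_def, mul_comm, ← ENNReal.toReal_mul]
    exact ENNReal.toReal_mono (ENNReal.mul_ne_top (Lp.eLpNorm_ne_top f) hK) h1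

theorem isFaithful_ofLp (E : Type*) [NormedAddCommGroup E] [NormedSpace ℝ E] (p : ENNReal)
    [Fact (1 ≤ p)] : (ofLp E p).IsFaithful := fun _ _ h => Lp.ext h

theorem isTranslation_ofLp (E : Type*) [NormedAddCommGroup E] [NormedSpace ℝ E] (p : ENNReal)
    [Fact (1 ≤ p)] (hp : p ≠ ⊤) : (ofLp E p).IsTranslation (translation E p hp) :=
  fun h f => coeFn_translation hp h f

/-- Functions in `Y`. -/
def ofY : Realization Y ℝ where
  fn f := f.fn
  locallyIntegrable f := (Y.fnL f).continuous.locallyIntegrable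
  fn_add f g := Eventually.of_forall fun x => rfl
  fn_smul c f := Eventually.of_forall fun x => rfl
  bound R := by
    refine ⟨volume.real (Icc (-R) R), fun f => ?_⟩
    have h1 : IntegrableOn (fun x => ‖f.fn x‖) (Icc (-R) R) :=
      (Y.fnL f).continuous.norm.continuousOn.integrableOn_compact isCompact_Icc
    calc ∫ x in Icc (-R) R, ‖f.fn x‖ ≤ ∫ x in Icc (-R) R, ‖f‖ :=
          setIntegral_mono h1 (integrableOn_const (by simp)) fun x => Y.norm_fn_le f x
      _ = _ := by rw [setIntegral_const, smul_eq_mul]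

/-- The constant part of f pairs to zero with χ', which leaves the antiderivative. -/
theorem pair_ofY_deriv (f : Y) {χ : ℝ → ℝ} (hχ : IsTest χ) :
    ofY.pair (deriv χ) f = -(ofLp ℝ 1).pair χ (Y.derivL f) := by
  have h1 : ∀ x, deriv χ x • f.fn x =
      deriv χ x * Y.lim f + deriv χ x * antideriv (Y.derivL f) x := by
    intro x
    rw [← Y.lim_add_antideriv, smul_eq_mul, mul_add]
  have hi := hχ.deriv.continuous.integrable_of_hasCompactSupport hχ.deriv.hasCompactSupport
    (μ := volume)
  have h2 : Integrable fun x => deriv χ x * antideriv (Y.derivL f) x :=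
    (hχ.deriv.continuous.mul (antideriv (Y.derivL f)).continuous).integrable_of_hasCompactSupport
      hχ.deriv.hasCompactSupport.mul_right
  have h3 : ∫ x, deriv χ x = 0 := by
    exact integral_deriv_eq_zero_of_hasCompactSupport hχ
  change ∫ x, deriv χ x • f.fn x = -∫ x, χ x • (Y.derivL f) x
  simp only [h1]
  rw [integral_add (hi.mul_const _) h2, integral_mul_const, h3, zero_mul, zero_add,
    integral_deriv_mul_antideriv hχ]
  rfl

/-- Continuous functions that agree almost everywhere agree everywhere, and the L¹ derivative is
determined as a weak derivative. -/
theorem isFaithful_ofY : ofY.IsFaithful := by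
  intro f g h
  have h1 : ∀ x, f.fn x = g.fn x := by
    have := (Continuous.ae_eq_iff_eq volume (Y.fnL f).continuous (Y.fnL g).continuous).1 h
    exact fun x => congrFun this x
  refine Y.ext_fn h1 ((isFaithful_ofLp ℝ 1).eq_of_pair_eq fun χ hχ => ?_)
  rw [← neg_inj, ← pair_ofY_deriv f hχ, ← pair_ofY_deriv g hχ]
  exact integral_congr_ae (Eventually.of_forall fun x => congrArg (deriv χ x • ·) (h1 x))

/-- The product of two realizations. -/
def prod {X' E' : Type*} [NormedAddCommGroup X'] [NormedSpace ℝ X'] [NormedAddCommGroup E']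
    [NormedSpace ℝ E'] (ρ : Realization X E) (ρ' : Realization X' E') :
    Realization (X × X') (E × E') where
  fn f x := (ρ.fn f.1 x, ρ'.fn f.2 x)
  locallyIntegrable f := fun x => by
    obtain ⟨s, hs, hs'⟩ := ρ.locallyIntegrable f.1 x
    obtain ⟨t, ht, ht'⟩ := ρ'.locallyIntegrable f.2 x
    exact ⟨s ∩ t, inter_mem hs ht, (hs'.mono_set inter_subset_left).prodMk
      (ht'.mono_set inter_subset_right)⟩
  fn_add f g := by
    filter_upwards [ρ.fn_add f.1 g.1, ρ'.fn_add f.2 g.2] with x h1 h2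
    exact Prod.ext h1 h2
  fn_smul c f := by
    filter_upwards [ρ.fn_smul c f.1, ρ'.fn_smul c f.2] with x h1 h2
    exact Prod.ext h1 h2
  bound R := by
    obtain ⟨C, hC⟩ := ρ.bound R
    obtain ⟨C', hC'⟩ := ρ'.bound R
    refine ⟨|C| + |C'|, fun f => ?_⟩
    have h1 := ρ.integrableOn f.1 R
    have h2 := ρ'.integrableOn f.2 R
    calc ∫ x in Icc (-R) R, ‖(ρ.fn f.1 x, ρ'.fn f.2 x)‖
        ≤ ∫ x in Icc (-R) R, (‖ρ.fn f.1 x‖ + ‖ρ'.fn f.2 x‖) :=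
          setIntegral_mono (h1.prodMk h2).norm (h1.norm.add h2.norm) fun x =>
            max_le_add_of_nonneg (norm_nonneg _) (norm_nonneg _)
      _ ≤ |C| * ‖f‖ + |C'| * ‖f‖ := by
        rw [integral_add h1.norm h2.norm]
        refine add_le_add ((hC _).trans ?_) ((hC' _).trans ?_)
        · exact mul_le_mul (le_abs_self C) (norm_fst_le f) (norm_nonneg _) (abs_nonneg _)
        · exact mul_le_mul (le_abs_self C') (norm_snd_le f) (norm_nonneg _) (abs_nonneg _)
      _ = _ := by ring

/-- The power of a realization. -/
def pow (ρ : Realization X E) (ι : Type*) [Fintype ι] : Realization (ι → X) (ι → E) where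
  fn f x i := ρ.fn (f i) x
  locallyIntegrable f := by
    rw [locallyIntegrable_iff]
    exact fun K hK => Integrable.of_eval fun i =>
      (ρ.locallyIntegrable (f i)).integrableOn_isCompact hK
  fn_add f g := by
    have := eventually_all.2 fun i => ρ.fn_add (f i) (g i)
    exact this.mono fun x hx => funext hx
  fn_smul c f := by
    have := eventually_all.2 fun i => ρ.fn_smul c (f i)
    exact this.mono fun x hx => funext hx
  bound R := by
    obtain ⟨C, hC⟩ := ρ.bound R
    refine ⟨∑ _i : ι, |C|, fun f => ?_⟩
    have h1 := fun i => ρ.integrableOn (f i) R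
    calc ∫ x in Icc (-R) R, ‖fun i => ρ.fn (f i) x‖
        ≤ ∫ x in Icc (-R) R, ∑ i, ‖ρ.fn (f i) x‖ :=
          setIntegral_mono (Integrable.of_eval h1).norm
            (integrable_finsetSum _ fun i _ => (h1 i).norm) fun x =>
            (pi_norm_le_iff_of_nonneg (by positivity)).2 fun i =>
              Finset.single_le_sum (f := fun i => ‖ρ.fn (f i) x‖)
                (fun _ _ => norm_nonneg _) (Finset.mem_univ i)
      _ = ∑ i, ∫ x in Icc (-R) R, ‖ρ.fn (f i) x‖ := integral_finsetSum _ fun i _ => (h1 i).norm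
      _ ≤ ∑ _i : ι, |C| * ‖f‖ := by
        refine Finset.sum_le_sum fun i _ => (hC _).trans ?_
        exact mul_le_mul (le_abs_self C) (norm_le_pi_norm f i) (norm_nonneg _) (abs_nonneg _)
      _ = _ := by rw [Finset.sum_mul]

/-- The realization of a space through a continuous linear map. -/
def comap {W : Type*} [NormedAddCommGroup W] [NormedSpace ℝ W] (ρ : Realization X E)
    (A : W →L[ℝ] X) : Realization W E where
  fn f := ρ.fn (A f)
  locallyIntegrable f := ρ.locallyIntegrable _
  fn_add f g := by rw [map_add]; exact ρ.fn_add _ _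
  fn_smul c f := by rw [map_smul]; exact ρ.fn_smul _ _
  bound R := by
    obtain ⟨C, hC⟩ := ρ.bound R
    refine ⟨|C| * ‖A‖, fun f => (hC _).trans ?_⟩
    rw [mul_assoc]
    exact mul_le_mul (le_abs_self C) (A.le_opNorm f) (norm_nonneg _) (abs_nonneg _)

end Realization

/-- The norm of a pair of elements of `Y` comes from a normed space. -/
instance normedSpacePiY :
    @NormedSpace ℝ (Fin 2 → Y) _ NormedAddCommGroup.toSeminormedAddCommGroup :=
  Pi.normedSpace

/-! ### States and data -/

/-- The state belonging to a datum. -/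
def toState : X0 →L[ℝ] State :=
  (ContinuousLinearMap.fst ℝ L2 ((Fin 2 → Y) × (Fin 2 → L1))).prod
    ((ContinuousLinearMap.pi fun μ => Y.lim ∘L ContinuousLinearMap.proj μ ∘L
      ContinuousLinearMap.fst ℝ (Fin 2 → Y) (Fin 2 → L1) ∘L ContinuousLinearMap.snd ℝ L2 _).prod
    ((ContinuousLinearMap.pi fun μ => ContinuousLinearMap.proj μ ∘L
      ContinuousLinearMap.snd ℝ (Fin 2 → Y) (Fin 2 → L1) ∘L ContinuousLinearMap.snd ℝ L2 _ +
      Y.derivL ∘L ContinuousLinearMap.proj μ ∘L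
      ContinuousLinearMap.fst ℝ (Fin 2 → Y) (Fin 2 → L1) ∘L ContinuousLinearMap.snd ℝ L2 _).prod
    (ContinuousLinearMap.pi fun μ => ContinuousLinearMap.proj μ ∘L
      ContinuousLinearMap.snd ℝ (Fin 2 → Y) (Fin 2 → L1) ∘L ContinuousLinearMap.snd ℝ L2 _ -
      Y.derivL ∘L ContinuousLinearMap.proj μ ∘L
      ContinuousLinearMap.fst ℝ (Fin 2 → Y) (Fin 2 → L1) ∘L ContinuousLinearMap.snd ℝ L2 _)))

theorem toState_apply (d : X0) : toState d = (d.1, fun μ => Y.lim (d.2.1 μ),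
    fun μ => d.2.2 μ + Y.derivL (d.2.1 μ), fun μ => d.2.2 μ - Y.derivL (d.2.1 μ)) := rfl

/-- The datum belonging to a state. -/
def ofState : State →L[ℝ] X0 :=
  (ContinuousLinearMap.fst ℝ L2 _).prod
    ((ContinuousLinearMap.pi fun μ => Y.ofDeriv ∘L State.pot μ).prod
    (ContinuousLinearMap.pi fun μ => (1 / 2 : ℝ) •
      (ContinuousLinearMap.proj μ ∘L ContinuousLinearMap.fst ℝ _ _ ∘L
        ContinuousLinearMap.snd ℝ _ _ ∘L ContinuousLinearMap.snd ℝ _ _ +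
      ContinuousLinearMap.proj μ ∘L ContinuousLinearMap.snd ℝ _ _ ∘L
        ContinuousLinearMap.snd ℝ _ _ ∘L ContinuousLinearMap.snd ℝ _ _)))

theorem ofState_toState (d : X0) : ofState (toState d) = d := by
  refine Prod.ext rfl (Prod.ext ?_ ?_)
  · funext μ
    have h1 : State.pot μ (toState d) = (Y.lim (d.2.1 μ), Y.derivL (d.2.1 μ)) := by
      rw [State.pot_apply, toState_apply]
      refine Prod.ext rfl ?_
      change (1 / 2 : ℝ) • ((d.2.2 μ + Y.derivL (d.2.1 μ)) - (d.2.2 μ - Y.derivL (d.2.1 μ))) = _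
      rw [add_sub_sub_cancel, ← two_smul ℝ, smul_smul]
      norm_num
    change Y.ofDeriv (State.pot μ (toState d)) = _
    rw [h1]
    exact Y.equiv.symm_apply_apply (d.2.1 μ)
  · funext μ
    change (1 / 2 : ℝ) • ((d.2.2 μ + Y.derivL (d.2.1 μ)) + (d.2.2 μ - Y.derivL (d.2.1 μ))) = _
    rw [add_add_sub_cancel, ← two_smul ℝ, smul_smul]
    norm_num

theorem toState_ofState (z : State) : toState (ofState z) = z := by
  have h1 : ∀ μ, (Y.lim (Y.ofDeriv (State.pot μ z)), Y.derivL (Y.ofDeriv (State.pot μ z))) =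
      State.pot μ z := fun μ => Y.equiv.apply_symm_apply _
  refine Prod.ext rfl (Prod.ext ?_ (Prod.ext ?_ ?_))
  · funext μ
    exact congrArg Prod.fst (h1 μ)
  · funext μ
    change (1 / 2 : ℝ) • (z.2.2.1 μ + z.2.2.2 μ) + (1 / 2 : ℝ) • (z.2.2.1 μ - z.2.2.2 μ) = _
    rw [← smul_add, add_add_sub_cancel, ← two_smul ℝ, smul_smul]
    norm_num
  · funext μ
    change (1 / 2 : ℝ) • (z.2.2.1 μ + z.2.2.2 μ) - (1 / 2 : ℝ) • (z.2.2.1 μ - z.2.2.2 μ) = _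
    rw [← smul_sub, add_sub_sub_cancel, ← two_smul ℝ, smul_smul]
    norm_num

/-! ### Pairings of data -/

/-- The realization of data by triples of functions. -/
def realizationX0 : Realization X0 (Spinor × (Fin 2 → ℝ) × (Fin 2 → ℝ)) :=
  (Realization.ofLp Spinor 2).prod
    ((Realization.ofY.pow (Fin 2)).prod ((Realization.ofLp ℝ 1).pow (Fin 2)))

theorem pairLine_eq {φ : ℝ → ℝ} (hc : Continuous φ) (hs : HasCompactSupport φ) (d : X0) :
    pairLine d φ = realizationX0.pair φ d := by
  have h1 := (Realization.ofLp Spinor 2).integrable_smul hc hs d.1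
  have h2 := fun μ => Realization.ofY.integrable_smul hc hs (d.2.1 μ)
  have h3 := fun μ => (Realization.ofLp ℝ 1).integrable_smul hc hs (d.2.2 μ)
  have e : realizationX0.pair φ d = ∫ x, (φ x • (Realization.ofLp Spinor 2).fn d.1 x,
      ((fun μ => φ x • Realization.ofY.fn (d.2.1 μ) x),
        fun μ => φ x • (Realization.ofLp ℝ 1).fn (d.2.2 μ) x)) := rfl
  have h2' : Integrable fun x μ => φ x • Realization.ofY.fn (d.2.1 μ) x := Integrable.of_eval h2
  have h3' : Integrable fun x μ => φ x • (Realization.ofLp ℝ 1).fn (d.2.2 μ) x :=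
    Integrable.of_eval h3
  rw [e, integral_pair h1 (h2'.prodMk h3'), integral_pair h2' h3']
  refine Prod.ext rfl (Prod.ext ?_ ?_)
  · funext μ
    exact (eval_integral h2 μ).symm
  · funext μ
    exact (eval_integral h3 μ).symm

theorem isFaithful_realizationX0 : realizationX0.IsFaithful := by
  intro f g h
  refine Prod.ext ?_ (Prod.ext ?_ ?_)
  · exact Realization.isFaithful_ofLp Spinor 2 _ _ (h.mono fun x hx => congrArg Prod.fst hx)
  · funext μ
    exact Realization.isFaithful_ofY _ _ (h.mono fun x hx => congrFun (congrArg (·.2.1) hx) μ)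
  · funext μ
    exact Realization.isFaithful_ofLp ℝ 1 _ _
      (h.mono fun x hx => congrFun (congrArg (·.2.2) hx) μ)

/-- The realization of states by triples of functions. -/
def realizationState : Realization State (Spinor × (Fin 2 → ℝ) × (Fin 2 → ℝ)) :=
  realizationX0.comap ofState

theorem isFaithful_realizationState : realizationState.IsFaithful := by
  intro f g h
  have h1 := isFaithful_realizationX0 _ _ h
  rw [← toState_ofState f, h1, toState_ofState]

theorem fn_ofDeriv_translation (q : ℝ × L1) (h x : ℝ) :
    (Y.ofDeriv (q.1, translationL1 h q.2)).fn x = (Y.ofDeriv q).fn (x + h) := by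
  rw [← Y.fnL_apply, ← Y.fnL_apply, Y.fnL_ofDeriv, Y.fnL_ofDeriv, potential_apply, potential_apply,
    antideriv_translation]

theorem isTranslation_realizationState : realizationState.IsTranslation translationState := by
  intro h z
  have h1 : ∀ x, (fun μ => (Y.ofDeriv (State.pot μ (translationState h z))).fn x) =
      fun μ => (Y.ofDeriv (State.pot μ z)).fn (x + h) := by
    intro x
    funext μ
    rw [← fn_ofDeriv_translation, State.pot_apply, translationState_apply, State.pot_apply]
    simp only [map_smul, map_sub]
  have h2 : ∀ μ : Fin 2, (1 / 2 : ℝ) • (translationL1 h (z.2.2.1 μ) + translationL1 h (z.2.2.2 μ)) =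
      translationL1 h ((1 / 2 : ℝ) • (z.2.2.1 μ + z.2.2.2 μ)) := by
    intro μ
    rw [map_smul, map_add]
  have h3 : ∀ᵐ x, ∀ μ : Fin 2, (translationL1 h ((1 / 2 : ℝ) • (z.2.2.1 μ + z.2.2.2 μ))) x =
      ((1 / 2 : ℝ) • (z.2.2.1 μ + z.2.2.2 μ)) (x + h) :=
    eventually_all.2 fun μ => coeFn_translation (by simp) h _
  filter_upwards [coeFn_translation (by simp) h z.1, h3] with x hx hx'
  refine Prod.ext hx (Prod.ext (h1 x) ?_)
  funext μ
  exact (congrArg (fun f : L1 => f x) (h2 μ)).trans (hx' μ)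

/-! ### Pairings of curves -/

theorem integral_dt {E : Type*} [NormedAddCommGroup E] [NormedSpace ℝ E] {T : ℝ} (hT : 0 ≤ T)
    {f : ↥(Icc (-T) T) → E} (g : ℝ → E) (hfg : ∀ t, f t = g t) :
    ∫ t, f t ∂(dt T) = ∫ t in (-T)..T, g t := by
  simp only [hfg]
  rw [dt, integral_subtype_comap measurableSet_Icc g, intervalIntegral.integral_of_le (by linarith),
    integral_Icc_eq_integral_Ioc]

theorem pairStrip_eq {T : ℝ} (hT : 0 ≤ T) {φ : ℝ × ℝ → ℝ} (hc : Continuous φ)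
    (hs : HasCompactSupport φ) (u : CX0 T) :
    pairStrip u φ = realizationX0.pairST T φ (extend hT u) := by
  have hv := continuous_extend hT u
  have h1 := (Realization.ofLp Spinor 2).continuous_pair hc hs (v := fun t => (extend hT u t).1)
    hv.fst
  have h2 := fun μ => Realization.ofY.continuous_pair hc hs (v := fun t => (extend hT u t).2.1 μ)
    ((continuous_apply μ).comp hv.snd.fst)
  have h3 := fun μ => (Realization.ofLp ℝ 1).continuous_pair hc hs
    (v := fun t => (extend hT u t).2.2 μ) ((continuous_apply μ).comp hv.snd.snd)
  have e : ∀ t, realizationX0.pair (fun x => φ (t, x)) (extend hT u t) =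
      ((Realization.ofLp Spinor 2).pair (fun x => φ (t, x)) (extend hT u t).1,
        (fun μ => Realization.ofY.pair (fun x => φ (t, x)) ((extend hT u t).2.1 μ)),
        fun μ => (Realization.ofLp ℝ 1).pair (fun x => φ (t, x)) ((extend hT u t).2.2 μ)) := by
    intro t
    rw [← pairLine_eq (by fun_prop)]
    · rfl
    · obtain ⟨R, hR⟩ := exists_radius hs
      exact HasCompactSupport.intro isCompact_Icc (hR t)
  have i1 := (h1.intervalIntegrable (μ := volume) (-T) T).1
  have i2 := fun μ => ((h2 μ).intervalIntegrable (μ := volume) (-T) T).1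
  have i3 := fun μ => ((h3 μ).intervalIntegrable (μ := volume) (-T) T).1
  have i2' := Integrable.of_eval i2
  have i3' := Integrable.of_eval i3
  have hTT : -T ≤ T := by linarith
  rw [Realization.pairST]
  simp only [e]
  rw [intervalIntegral.integral_of_le hTT, integral_pair i1 (i2'.prodMk i3'),
    integral_pair i2' i3']
  refine Prod.ext ?_ (Prod.ext ?_ ?_)
  · exact (integral_dt hT _ fun t => by rw [extend_apply]; rfl).trans
      (intervalIntegral.integral_of_le hTT)
  · funext μ
    refine Eq.trans ?_ (eval_integral i2 μ).symm
    exact (integral_dt hT _ fun t => by rw [extend_apply]; rfl).trans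
      (intervalIntegral.integral_of_le hTT)
  · funext μ
    refine Eq.trans ?_ (eval_integral i3 μ).symm
    exact (integral_dt hT _ fun t => by rw [extend_apply]; rfl).trans
      (intervalIntegral.integral_of_le hTT)

namespace Realization

variable {X E X' E' : Type*} [NormedAddCommGroup X] [NormedSpace ℝ X]
    [NormedAddCommGroup E] [NormedSpace ℝ E] [NormedAddCommGroup X'] [NormedSpace ℝ X']
    [NormedAddCommGroup E'] [NormedSpace ℝ E'] (ρ : Realization X E) (σ : Realization X' E')

/-! ### Linearity of space-time pairings -/

theorem hasCompactSupport_slice {φ : ℝ × ℝ → ℝ} (hs : HasCompactSupport φ) (t : ℝ) :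
    HasCompactSupport fun x => φ (t, x) := by
  obtain ⟨R, hR⟩ := exists_radius hs
  exact HasCompactSupport.intro isCompact_Icc (hR t)

theorem isTest_slice {φ : ℝ × ℝ → ℝ} (hφ : IsTest φ) (t : ℝ) : IsTest fun x => φ (t, x) :=
  ⟨hφ.contDiff.comp (contDiff_const.prodMk contDiff_id),
    hasCompactSupport_slice hφ.hasCompactSupport t⟩

theorem pair_add {φ : ℝ → ℝ} (hφ : IsTest φ) (f f' : X) :
    ρ.pair φ (f + f') = ρ.pair φ f + ρ.pair φ f' := by
  simp only [← ρ.functional_apply hφ, map_add]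

theorem pair_smul {φ : ℝ → ℝ} (hφ : IsTest φ) (c : ℝ) (f : X) :
    ρ.pair φ (c • f) = c • ρ.pair φ f := by
  simp only [← ρ.functional_apply hφ, map_smul]

theorem pairST_add {T : ℝ} {φ : ℝ × ℝ → ℝ} (hφ : IsTest φ) {v w : ℝ → X} (hv : Continuous v)
    (hw : Continuous w) : ρ.pairST T φ (fun t => v t + w t) = ρ.pairST T φ v + ρ.pairST T φ w := by
  have h1 := ρ.continuous_pair hφ.continuous hφ.hasCompactSupport hv
  have h2 := ρ.continuous_pair hφ.continuous hφ.hasCompactSupport hw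
  simp only [pairST, ρ.pair_add (isTest_slice hφ _)]
  exact intervalIntegral.integral_add (h1.intervalIntegrable _ _) (h2.intervalIntegrable _ _)

theorem pairST_smul {T : ℝ} {φ : ℝ × ℝ → ℝ} (hφ : IsTest φ) (c : ℝ) (v : ℝ → X) :
    ρ.pairST T φ (fun t => c • v t) = c • ρ.pairST T φ v := by
  simp only [pairST, ρ.pair_smul (isTest_slice hφ _)]
  exact intervalIntegral.integral_smul _ _

theorem pairST_neg {T : ℝ} {φ : ℝ × ℝ → ℝ} (hφ : IsTest φ) (v : ℝ → X) :
    ρ.pairST T φ (fun t => -v t) = -ρ.pairST T φ v := by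
  simpa using ρ.pairST_smul (T := T) hφ (-1) v

theorem pairST_sub {T : ℝ} {φ : ℝ × ℝ → ℝ} (hφ : IsTest φ) {v w : ℝ → X} (hv : Continuous v)
    (hw : Continuous w) : ρ.pairST T φ (fun t => v t - w t) = ρ.pairST T φ v - ρ.pairST T φ w := by
  simp only [sub_eq_add_neg]
  exact (ρ.pairST_add hφ hv hw.neg).trans (congrArg _ (ρ.pairST_neg hφ w))

theorem pairST_sum {T : ℝ} {φ : ℝ × ℝ → ℝ} (hφ : IsTest φ) {ι : Type*} (s : Finset ι)
    {v : ι → ℝ → X} (hv : ∀ i, Continuous (v i)) :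
    ρ.pairST T φ (fun t => ∑ i ∈ s, v i t) = ∑ i ∈ s, ρ.pairST T φ (v i) := by
  have h1 := fun i => ρ.continuous_pair hφ.continuous hφ.hasCompactSupport (hv i)
  have h2 : ∀ t, ρ.pair (fun x => φ (t, x)) (∑ i ∈ s, v i t) =
      ∑ i ∈ s, ρ.pair (fun x => φ (t, x)) (v i t) := by
    intro t
    simp only [← ρ.functional_apply (isTest_slice hφ t), map_sum]
  simp only [pairST, h2]
  exact intervalIntegral.integral_finsetSum fun i _ => (h1 i).intervalIntegrable _ _

theorem pairST_sub_mul {T : ℝ} {φ χ : ℝ × ℝ → ℝ} (hφ : IsTest φ) (hχ : IsTest χ) (c : ℝ)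
    {v : ℝ → X} (hv : Continuous v) :
    ρ.pairST T (fun p => φ p - c * χ p) v = ρ.pairST T φ v - c • ρ.pairST T χ v := by
  have h1 := ρ.continuous_pair hφ.continuous hφ.hasCompactSupport hv
  have h2 := ρ.continuous_pair hχ.continuous hχ.hasCompactSupport hv
  have h3 : ∀ t, ρ.pair (fun x => φ (t, x) - c * χ (t, x)) (v t) =
      ρ.pair (fun x => φ (t, x)) (v t) - c • ρ.pair (fun x => χ (t, x)) (v t) := by
    intro t
    rw [pair, pair, pair, ← integral_smul, ← integral_sub]
    · simp only [sub_smul, mul_smul]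
    · exact ρ.integrable_smul (isTest_slice hφ t).continuous (isTest_slice hφ t).hasCompactSupport _
    · exact (ρ.integrable_smul (isTest_slice hχ t).continuous
        (isTest_slice hχ t).hasCompactSupport _).smul c
  have h4 : Continuous fun t => c • ρ.pair (fun x => χ (t, x)) (v t) := h2.const_smul c
  simp only [pairST, h3]
  rw [intervalIntegral.integral_sub (h1.intervalIntegrable _ _) (h4.intervalIntegrable _ _),
    intervalIntegral.integral_smul]

variable {ρ σ}

theorem pair_map [CompleteSpace E] [CompleteSpace E'] {A : X → X'} {a : E →L[ℝ] E'}
    (h : ∀ f, σ.fn (A f) =ᵐ[volume] fun x => a (ρ.fn f x)) {φ : ℝ → ℝ} (hφ : IsTest φ) (f : X) :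
    σ.pair φ (A f) = a (ρ.pair φ f) := by
  rw [pair, pair, ← a.integral_comp_comm (ρ.integrable_smul hφ.continuous hφ.hasCompactSupport f)]
  refine integral_congr_ae ?_
  filter_upwards [h f] with x hx
  rw [hx, map_smul]

theorem pairST_map [CompleteSpace E] [CompleteSpace E'] {A : X → X'} {a : E →L[ℝ] E'}
    (h : ∀ f, σ.fn (A f) =ᵐ[volume] fun x => a (ρ.fn f x)) {T : ℝ} {φ : ℝ × ℝ → ℝ}
    (hφ : IsTest φ) {v : ℝ → X} (hv : Continuous v) :
    σ.pairST T φ (fun t => A (v t)) = a (ρ.pairST T φ v) := by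
  have h1 := ρ.continuous_pair hφ.continuous hφ.hasCompactSupport hv
  simp only [pairST, pair_map h (isTest_slice hφ _)]
  exact a.intervalIntegral_comp_comm (h1.intervalIntegrable _ _)

end Realization

/-! ### Weak form of the Dirac equation -/

/-- The realization of `L²` spinors. -/
abbrev realizationL2 : Realization L2 Spinor := Realization.ofLp Spinor 2

/-- The realization of `L¹` functions. -/
abbrev realizationL1 : Realization L1 ℝ := Realization.ofLp ℝ 1

theorem pairST_actL2 (m : Matrix (Fin 2) (Fin 2) ℂ) {T : ℝ} {φ : ℝ × ℝ → ℝ} (hφ : IsTest φ)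
    {v : ℝ → L2} (hv : Continuous v) : realizationL2.pairST T φ (fun t => actL2 m (v t)) =
      act m (realizationL2.pairST T φ v) :=
  Realization.pairST_map (a := (act m).restrictScalars ℝ) (coeFn_actL2 m) hφ hv

/-- Here W0, W1 and W stand for the pairings of ψ with ∂ₜφ, ∂ₓφ and φ, and N μ for that of A_μ ψ
with φ. Multiplication by the invertible matrix −iγ⁰ turns the tested Dirac equation into W0 + γ⁰γ¹
W1 = −F, and γ⁰γ¹ = diag(1, -1) splits it into the two transport equations. -/
theorem dirac_algebra (M : ℝ) (W0 W1 W F : Spinor) (N : Fin 2 → Spinor)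
    (hF : F = act (-(Complex.I * M) • γ 0) W + ∑ μ, act (Complex.I • (γ 0 * γ μ)) (N μ)) :
    act (Complex.I • γ 0) W0 + act (Complex.I • γ 1) W1 + M • W = ∑ μ, act (γ μ) (N μ) ↔
      act leftMatrix W0 - (1 : ℝ) • act leftMatrix W1 = -act leftMatrix F ∧
      (W0 - act leftMatrix W0) - (-1 : ℝ) • (W1 - act leftMatrix W1) =
        -(F - act leftMatrix F) := by
  subst hF
  have hI : Complex.I * Complex.I = -1 := Complex.I_mul_I
  constructor
  · intro h
    have h0 := congrFun (congrArg WithLp.ofLp h) 0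
    have h1 := congrFun (congrArg WithLp.ofLp h) 1
    simp [act_ofLp, γ, Matrix.mulVec, dotProduct, Fin.sum_univ_two] at h0 h1
    constructor
    · refine WithLp.ofLp_injective 2 (funext fun i => ?_)
      fin_cases i
      · simp [act_ofLp, γ, leftMatrix, Matrix.mulVec, dotProduct, Fin.sum_univ_two]
      · simp [act_ofLp, γ, leftMatrix, Matrix.mulVec, dotProduct, Fin.sum_univ_two]
        linear_combination -Complex.I * h0 + (W0.ofLp 1 - W1.ofLp 1) * hI
    · refine WithLp.ofLp_injective 2 (funext fun i => ?_)
      fin_cases i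
      · simp [act_ofLp, γ, leftMatrix, Matrix.mulVec, dotProduct, Fin.sum_univ_two]
        linear_combination -Complex.I * h1 + (W0.ofLp 0 + W1.ofLp 0) * hI
      · simp [act_ofLp, γ, leftMatrix, Matrix.mulVec, dotProduct, Fin.sum_univ_two]
  · rintro ⟨hl, hr⟩
    have h1 := congrFun (congrArg WithLp.ofLp hl) 1
    have h0 := congrFun (congrArg WithLp.ofLp hr) 0
    simp [act_ofLp, γ, leftMatrix, Matrix.mulVec, dotProduct, Fin.sum_univ_two] at h0 h1
    refine WithLp.ofLp_injective 2 (funext fun i => ?_)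
    fin_cases i
    · simp [act_ofLp, γ, Matrix.mulVec, dotProduct, Fin.sum_univ_two]
      linear_combination Complex.I * h1 + (M * W.ofLp 0 - (N 0).ofLp 1 + (N 1).ofLp 1) * hI
    · simp [act_ofLp, γ, Matrix.mulVec, dotProduct, Fin.sum_univ_two]
      linear_combination Complex.I * h0 + (M * W.ofLp 1 - (N 0).ofLp 0 - (N 1).ofLp 0) * hI

theorem act_smul (c : ℂ) (m : Matrix (Fin 2) (Fin 2) ℂ) (v : Spinor) :
    act (c • m) v = c • act m v := by
  simp [act]

theorem testFunction_isTest {T : ℝ} (φ : 𝓓(strip T, ℝ)) : IsTest φ :=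
  ⟨φ.contDiff, φ.hasCompactSupport⟩

theorem exists_testFunction {T : ℝ} {φ : ℝ × ℝ → ℝ} (hφ : IsTest φ) (hT : tsupport φ ⊆ strip T) :
    ∃ φ' : 𝓓(strip T, ℝ), ⇑φ' = φ :=
  ⟨⟨φ, hφ.contDiff, hφ.hasCompactSupport, hT⟩, rfl⟩

/-- The Dirac equation for one test function. -/
theorem dirac_iff {T : ℝ} (hT : 0 ≤ T) (M : ℝ) (u : CX0 T) {z : ℝ → State} (hz : Continuous z)
    (hu : ∀ t : Icc (-T) T, u t = ofState (z t)) {φ : ℝ × ℝ → ℝ} (hφ : IsTest φ) :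
    (∫ t, (∫ x,
        ((∑ μ, (Complex.I * (pd μ φ (t, x) : ℂ)) • act (γ μ) ((u t).1 x)) +
          (M * φ (t, x)) • (u t).1 x)) ∂(dt T) =
      ∫ t, (∫ x,
        φ (t, x) • ∑ μ, ((u t).2.1 μ).fn x • act (γ μ) ((u t).1 x)) ∂(dt T)) ↔
    realizationL2.pairST T (fun p => pd 0 φ p - 1 * pd 1 φ p)
        (fun t => actL2 leftMatrix (z t).1) =
      -realizationL2.pairST T φ (fun t => actL2 leftMatrix ((mdSystem M).nonlin (z t)).1) ∧
    realizationL2.pairST T (fun p => pd 0 φ p - (-1) * pd 1 φ p)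
        (fun t => (z t).1 - actL2 leftMatrix (z t).1) =
      -realizationL2.pairST T φ (fun t => ((mdSystem M).nonlin (z t)).1 -
        actL2 leftMatrix ((mdSystem M).nonlin (z t)).1) := by
  have hψ : Continuous fun t => (z t).1 := hz.fst
  -- The products A_μ ψ as continuous curves in L².
  let n : Fin 2 → ℝ → L2 := fun μ t => mulL2 (potential (State.pot μ (z t))) (z t).1
  have hn : ∀ μ, Continuous (n μ) := fun μ =>
    (mulL2.continuous.comp (potential.continuous.comp ((State.pot μ).continuous.comp hz))).clm_apply
      hψ
  have hna : ∀ m μ, Continuous fun t => actL2 m (n μ t) := fun m μ =>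
    (actL2 m).continuous.comp (hn μ)
  have hψa : ∀ m, Continuous fun t => actL2 m (z t).1 := fun m => (actL2 m).continuous.comp hψ
  have e1 : ∀ t : Icc (-T) T, ∫ x, ((∑ μ, (Complex.I * (pd μ φ (t, x) : ℂ)) • act (γ μ) ((u t).1 x)) +
      (M * φ (t, x)) • (u t).1 x) =
      realizationL2.pair (fun x => pd 0 φ (t, x)) (actL2 (Complex.I • γ 0) (z t).1) +
      realizationL2.pair (fun x => pd 1 φ (t, x)) (actL2 (Complex.I • γ 1) (z t).1) +
      realizationL2.pair (fun x => φ (t, x)) (M • (z t).1) := by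
    intro t
    have i0 := realizationL2.integrable_smul (Realization.isTest_slice (hφ.pd 0) t).continuous
      (Realization.isTest_slice (hφ.pd 0) t).hasCompactSupport (actL2 (Complex.I • γ 0) (z t).1)
    have i1 := realizationL2.integrable_smul (Realization.isTest_slice (hφ.pd 1) t).continuous
      (Realization.isTest_slice (hφ.pd 1) t).hasCompactSupport (actL2 (Complex.I • γ 1) (z t).1)
    have i2 := realizationL2.integrable_smul (Realization.isTest_slice hφ t).continuous
      (Realization.isTest_slice hφ t).hasCompactSupport (M • (z t).1)
    have i01 : Integrable fun x =>
        pd 0 φ (t, x) • realizationL2.fn (actL2 (Complex.I • γ 0) (z t).1) x +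
        pd 1 φ (t, x) • realizationL2.fn (actL2 (Complex.I • γ 1) (z t).1) x := i0.add i1
    rw [Realization.pair, Realization.pair, Realization.pair, ← integral_add i0 i1,
      ← integral_add i01 i2]
    refine integral_congr_ae ?_
    have h1 : (u t).1 = (z t).1 := by rw [hu]; rfl
    filter_upwards [coeFn_actL2 (Complex.I • γ 0) (z t).1, coeFn_actL2 (Complex.I • γ 1) (z t).1,
      Lp.coeFn_smul M (z t).1] with x h2 h3 h4
    change _ = pd 0 φ (t, x) • (actL2 (Complex.I • γ 0) (z t).1) x +
      pd 1 φ (t, x) • (actL2 (Complex.I • γ 1) (z t).1) x + φ (t, x) • (M • (z t).1 : L2) x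
    rw [h2, h3, h4, Fin.sum_univ_two, h1, Pi.smul_apply, act_smul, act_smul, mul_comm Complex.I,
      mul_comm Complex.I, mul_smul, mul_smul, Complex.coe_smul, Complex.coe_smul, mul_comm M,
      mul_smul]
  have e2 : ∀ t : Icc (-T) T, ∫ x, φ (t, x) • ∑ μ, ((u t).2.1 μ).fn x • act (γ μ) ((u t).1 x) =
      realizationL2.pair (fun x => φ (t, x)) (∑ μ, actL2 (γ μ) (n μ t)) := by
    intro t
    refine integral_congr_ae ?_
    have h1 : (u t).1 = (z t).1 := by rw [hu]; rfl
    have h2 : ∀ μ x, ((u t).2.1 μ).fn x = potential (State.pot μ (z t)) x := by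
      intro μ x
      rw [hu]
      rfl
    have h3 : ∀ᵐ x, ∀ μ, actL2 (γ μ) (n μ t) x = act (γ μ) (n μ t x) :=
      eventually_all.2 fun μ => coeFn_actL2 (γ μ) (n μ t)
    have h4 : ∀ᵐ x, ∀ μ, n μ t x = potential (State.pot μ (z t)) x • (z t).1 x :=
      eventually_all.2 fun μ => coeFn_mulL2 _ _
    filter_upwards [h3, h4, Lp.coeFn_add (actL2 (γ 0) (n 0 t)) (actL2 (γ 1) (n 1 t))]
      with x h5 h6 h7
    change _ = φ (t, x) • (∑ μ, actL2 (γ μ) (n μ t) : L2) x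
    rw [Fin.sum_univ_two, Fin.sum_univ_two, h7, Pi.add_apply, h5, h5, h6, h6, h1, h2, h2]
    simp only [ContinuousLinearMap.map_smul_of_tower]
  rw [integral_dt hT
    (fun t => realizationL2.pair (fun x => pd 0 φ (t, x)) (actL2 (Complex.I • γ 0) (z t).1) +
      realizationL2.pair (fun x => pd 1 φ (t, x)) (actL2 (Complex.I • γ 1) (z t).1) +
      realizationL2.pair (fun x => φ (t, x)) (M • (z t).1)) e1, integral_dt hT
    (fun t => realizationL2.pair (fun x => φ (t, x)) (∑ μ, actL2 (γ μ) (n μ t))) e2]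
  have c0 := realizationL2.continuous_pair (hφ.pd 0).continuous (hφ.pd 0).hasCompactSupport
    (hψa (Complex.I • γ 0))
  have c1 := realizationL2.continuous_pair (hφ.pd 1).continuous (hφ.pd 1).hasCompactSupport
    (hψa (Complex.I • γ 1))
  have hMψ : Continuous fun t => M • (z t).1 := hψ.const_smul M
  have c2 := realizationL2.continuous_pair hφ.continuous hφ.hasCompactSupport hMψ
  have c01 : Continuous fun t =>
      realizationL2.pair (fun x => pd 0 φ (t, x)) (actL2 (Complex.I • γ 0) (z t).1) +
      realizationL2.pair (fun x => pd 1 φ (t, x)) (actL2 (Complex.I • γ 1) (z t).1) := c0.add c1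
  rw [intervalIntegral.integral_add (c01.intervalIntegrable _ _)
    (c2.intervalIntegrable _ _), intervalIntegral.integral_add (c0.intervalIntegrable _ _)
    (c1.intervalIntegrable _ _)]
  have hFc : Continuous fun t => ((mdSystem M).nonlin (z t)).1 :=
    (((mdSystem M).contDiff_nonlin (n := 0)).continuous.comp hz).fst
  have hF : realizationL2.pairST T φ (fun t => ((mdSystem M).nonlin (z t)).1) =
      act (-(Complex.I * M) • γ 0) (realizationL2.pairST T φ fun t => (z t).1) +
      ∑ μ, act (Complex.I • (γ 0 * γ μ)) (realizationL2.pairST T φ (n μ)) := by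
    simp only [mdSystem_nonlin, coupling_apply]
    rw [realizationL2.pairST_add hφ (hψa _) (continuous_finsetSum _ fun μ _ => hna _ μ),
      realizationL2.pairST_sum hφ _ (fun μ => hna _ μ), pairST_actL2 _ hφ hψ]
    simp only [pairST_actL2 _ hφ (hn _)]
  have e3 := dirac_algebra M (realizationL2.pairST T (pd 0 φ) fun t => (z t).1)
    (realizationL2.pairST T (pd 1 φ) fun t => (z t).1) (realizationL2.pairST T φ fun t => (z t).1) _
    (fun μ => realizationL2.pairST T φ (n μ)) hF
  have hFl : Continuous fun t => actL2 leftMatrix ((mdSystem M).nonlin (z t)).1 :=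
    (actL2 leftMatrix).continuous.comp hFc
  have hψr : Continuous fun t => (z t).1 - actL2 leftMatrix (z t).1 := hψ.sub (hψa _)
  simp only [← pairST_actL2 _ (hφ.pd _) hψ, ← pairST_actL2 _ hφ (hn _),
    ← pairST_actL2 _ hφ hFc, ← realizationL2.pairST_sub (hφ.pd _) hψ (hψa _),
    ← realizationL2.pairST_sub hφ hFc hFl,
    ← realizationL2.pairST_smul hφ,
    ← realizationL2.pairST_sum hφ _ (fun μ => hna _ μ)] at e3
  rw [realizationL2.pairST_sub_mul (hφ.pd 0) (hφ.pd 1) _ (hψa _),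
    realizationL2.pairST_sub_mul (hφ.pd 0) (hφ.pd 1) _ hψr]
  exact e3

/-! ### Weak form of the Maxwell equations -/

theorem pd_zero_pd_one {φ : ℝ × ℝ → ℝ} (hφ : IsTest φ) : pd 0 (pd 1 φ) = pd 1 (pd 0 φ) := by
  funext p
  have h1 : ∀ v w : ℝ × ℝ, fderiv ℝ (fun q => fderiv ℝ φ q v) p w =
      fderiv ℝ (fderiv ℝ φ) p w v := by
    intro v w
    have h2 : DifferentiableAt ℝ (fderiv ℝ φ) p :=
      ((hφ.contDiff.fderiv_right (m := ∞) (by simp)).differentiable (by simp)) p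
    rw [fderiv_clm_apply h2 (differentiableAt_const v)]
    simp
  have h3 := (hφ.contDiff.contDiffAt (x := p)).isSymmSndFDerivAt (by
    rw [minSmoothness_of_isRCLikeNormedField]
    exact WithTop.coe_le_coe.2 le_top)
  change fderiv ℝ (fun q => fderiv ℝ φ q (0, 1)) p (1, 0) =
    fderiv ℝ (fun q => fderiv ℝ φ q (1, 0)) p (0, 1)
  rw [h1, h1]
  exact h3 _ _

theorem box_eq (φ : ℝ × ℝ → ℝ) : box φ = fun p => pd 0 (pd 0 φ) p - 1 * pd 1 (pd 1 φ) p := by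
  funext p
  simp [box, Fin.sum_univ_two, g, sub_eq_add_neg]

open Realization

theorem pairST_pd_one {T : ℝ} {φ : ℝ × ℝ → ℝ} (hφ : IsTest φ) (A : ℝ → Y) :
    ofY.pairST T (pd 1 φ) A = -realizationL1.pairST T φ (fun t => Y.derivL (A t)) := by
  rw [pairST, pairST, ← intervalIntegral.integral_neg]
  refine intervalIntegral.integral_congr fun t _ => ?_
  change ofY.pair (fun x => pd 1 φ (t, x)) (A t) = -realizationL1.pair (fun x => φ (t, x)) _
  rw [← pair_ofY_deriv _ (isTest_slice hφ t)]
  congr 1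
  funext x
  exact ((hasDerivAt_pd_one (hφ.contDiff.of_le (by simp)) t x).deriv).symm

theorem tsupport_pd_subset_strip {T : ℝ} {φ : ℝ × ℝ → ℝ} (hT : tsupport φ ⊆ strip T) (μ : Fin 2) :
    tsupport (pd μ φ) ⊆ strip T := (tsupport_pd_subset φ μ).trans hT

/-- The wave equation as a transport equation for the Riemann invariants. -/
theorem pairST_riemann {T : ℝ} {A : ℝ → Y} {B : ℝ → L1} (hA : Continuous A) (hB : Continuous B)
    (hAB : ∀ φ, IsTest φ → tsupport φ ⊆ strip T →
      realizationL1.pairST T φ B = -ofY.pairST T (pd 0 φ) A)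
    {φ : ℝ × ℝ → ℝ} (hφ : IsTest φ) (hT : tsupport φ ⊆ strip T) {c : ℝ} (hc : c * c = 1) :
    realizationL1.pairST T (fun p => pd 0 φ p - c * pd 1 φ p) (fun t => B t + c • Y.derivL (A t)) =
      -ofY.pairST T (box φ) A := by
  have hA' : Continuous fun t => Y.derivL (A t) := Y.derivL.continuous.comp hA
  have hA'' : Continuous fun t => c • Y.derivL (A t) := hA'.const_smul c
  have hBA : Continuous fun t => B t + c • Y.derivL (A t) := hB.add hA''
  rw [realizationL1.pairST_sub_mul (hφ.pd 0) (hφ.pd 1) c hBA,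
    realizationL1.pairST_add (hφ.pd 0) hB hA'', realizationL1.pairST_add (hφ.pd 1) hB hA'',
    realizationL1.pairST_smul (hφ.pd 0), realizationL1.pairST_smul (hφ.pd 1), box_eq,
    ofY.pairST_sub_mul ((hφ.pd 0).pd 0) ((hφ.pd 1).pd 1) 1 hA,
    hAB _ (hφ.pd 0) (tsupport_pd_subset_strip hT 0), hAB _ (hφ.pd 1) (tsupport_pd_subset_strip hT 1),
    pd_zero_pd_one hφ, pairST_pd_one (hφ.pd 0), pairST_pd_one (hφ.pd 1)]
  simp only [smul_eq_mul]
  -- The terms in ∂ₜ∂ₓφ cancel, and c² = 1 completes −∂ₜ²φ by ∂ₓ²φ.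
  linear_combination (-realizationL1.pairST T (pd 1 φ) fun t => Y.derivL (A t)) * hc

/-- Both sides of the complex identity are integrals of real functions, the current being real. -/
theorem wave_iff {T : ℝ} (hT : 0 ≤ T) (u : CX0 T) (μ : Fin 2) {φ : ℝ × ℝ → ℝ} :
    (∫ t, (∫ x, ((box φ (t, x) * ((u t).2.1 μ).fn x : ℝ) : ℂ)) ∂(dt T) =
      -∫ t, (∫ x, (φ (t, x) : ℂ) * current μ ((u t).1 x)) ∂(dt T)) ↔
    ofY.pairST T (box φ) (fun t => (extend hT u t).2.1 μ) =
      -realizationL1.pairST T φ (fun t => currentL μ (extend hT u t).1 (extend hT u t).1) := by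
  have e1 : ∀ t : Icc (-T) T, ∫ x, ((box φ (t, x) * ((u t).2.1 μ).fn x : ℝ) : ℂ) =
      ((ofY.pair (fun x => box φ (t, x)) ((extend hT u t).2.1 μ) : ℝ) : ℂ) := by
    intro t
    rw [integral_complex_ofReal, extend_apply]
    rfl
  have e2 : ∀ t : Icc (-T) T, ∫ x, (φ (t, x) : ℂ) * current μ ((u t).1 x) =
      ((realizationL1.pair (fun x => φ (t, x))
        (currentL μ (extend hT u t).1 (extend hT u t).1) : ℝ) : ℂ) := by
    intro t
    rw [extend_apply, pair, ← integral_complex_ofReal]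
    refine integral_congr_ae ?_
    filter_upwards [coeFn_currentL μ (u t).1 (u t).1] with x hx
    change _ = ((φ (t, x) • (currentL μ (u t).1 (u t).1) x : ℝ) : ℂ)
    rw [hx, current_eq, smul_eq_mul, Complex.ofReal_mul]
  rw [integral_dt hT (fun t => ((ofY.pair (fun x => box φ (t, x)) ((extend hT u t).2.1 μ) : ℝ) : ℂ))
    e1, integral_dt hT (fun t => ((realizationL1.pair (fun x => φ (t, x))
        (currentL μ (extend hT u t).1 (extend hT u t).1) : ℝ) : ℂ)) e2,
    intervalIntegral.integral_ofReal, intervalIntegral.integral_ofReal, ← Complex.ofReal_neg,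
    Complex.ofReal_inj]
  rfl

theorem velocity_iff {T : ℝ} (hT : 0 ≤ T) (u : CX0 T) (μ : Fin 2) {φ : ℝ × ℝ → ℝ} :
    (∫ t, (∫ x, φ (t, x) * (u t).2.2 μ x) ∂(dt T) =
      -∫ t, (∫ x, pd 0 φ (t, x) * ((u t).2.1 μ).fn x) ∂(dt T)) ↔
    realizationL1.pairST T φ (fun t => (extend hT u t).2.2 μ) =
      -ofY.pairST T (pd 0 φ) (fun t => (extend hT u t).2.1 μ) := by
  rw [integral_dt hT (fun t => ∫ x, φ (t, x) * (extend hT u t).2.2 μ x)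
    (fun t => by rw [extend_apply]), integral_dt hT
    (fun t => ∫ x, pd 0 φ (t, x) * ((extend hT u t).2.1 μ).fn x) (fun t => by rw [extend_apply])]
  rfl

/-! ### Integral curves are solutions -/

theorem continuous_S_curve {M : ℝ} {U : ℝ → State}
    (hU : (mdSystem M).toQuadField.IsIntegralCurve U) :
    Continuous fun t => (mdSystem M).S t (U t) :=
  (mdSystem M).continuous_S_apply continuous_id hU.continuous

theorem field_apply_mdSystem (M t : ℝ) (z : State) :
    (mdSystem M).toQuadField.field t z =
      (evolveL2 (-t) ((mdSystem M).nonlin ((mdSystem M).S t z)).1, 0,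
        fun μ => -translationL1 (-t) (currentL μ ((mdSystem M).S t z).1 ((mdSystem M).S t z).1),
        fun μ => -translationL1 t (currentL μ ((mdSystem M).S t z).1 ((mdSystem M).S t z).1)) := by
  rw [TransportSystem.field_apply, mdSystem_S M (-t), neg_neg]
  simp only [mdSystem_nonlin, map_neg]

theorem actL2_leftMatrix_evolveL2 (t : ℝ) (f : L2) :
    actL2 leftMatrix (evolveL2 t f) = translationL2 t (actL2 leftMatrix f) := by
  rw [evolveL2, map_add, actL2_translation, actL2_translation, map_sub, actL2_actL2, leftMatrix_mul,
    sub_self, map_zero, add_zero]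

theorem evolveL2_sub_actL2_leftMatrix (t : ℝ) (f : L2) :
    evolveL2 t f - actL2 leftMatrix (evolveL2 t f) =
      translationL2 (-t) (f - actL2 leftMatrix f) := by
  rw [actL2_leftMatrix_evolveL2, evolveL2, add_sub_cancel_left]


theorem continuous_nonlin_curve {M : ℝ} {z : ℝ → State} (hz : Continuous z) :
    Continuous fun t => (mdSystem M).nonlin (z t) :=
  ((mdSystem M).contDiff_nonlin (n := 0)).continuous.comp hz

section

variable {M : ℝ} {U : ℝ → State}

/-- The left-moving part of S(t)U(t) is the translate by t of that of U(t), which is differentiable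
in time; so the weak transport equation in the moving frame applies with speed parameter 1. -/
theorem pairST_spinor_left (hU : (mdSystem M).toQuadField.IsIntegralCurve U) {T : ℝ}
    {φ : ℝ × ℝ → ℝ} (hφ : IsTest φ) (hT : tsupport φ ⊆ strip T) :
    realizationL2.pairST T (fun p => pd 0 φ p - 1 * pd 1 φ p)
        (fun t => actL2 leftMatrix ((mdSystem M).S t (U t)).1) =
      -realizationL2.pairST T φ
        (fun t => actL2 leftMatrix ((mdSystem M).nonlin ((mdSystem M).S t (U t))).1) := by
  refine realizationL2.pairST_transport hφ hT (U := fun t => actL2 leftMatrix (U t).1)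
    (U' := fun t => actL2 leftMatrix ((mdSystem M).toQuadField.field t (U t)).1) 1
    (fun t => ?_) ?_ (fun t => ?_) (fun t => ?_)
  · exact (actL2 leftMatrix ∘L ContinuousLinearMap.fst ℝ L2 _).hasFDerivAt.comp_hasDerivAt t (hU t)
  · exact (actL2 leftMatrix).continuous.comp
      ((mdSystem M).toQuadField.continuous_field_comp hU.continuous).fst
  · rw [mdSystem_S, actL2_leftMatrix_evolveL2, one_mul]
    exact coeFn_translation (by simp) t _
  · rw [field_apply_mdSystem, actL2_leftMatrix_evolveL2, one_mul]
    have := coeFn_translation (by simp) t (translationL2 (-t)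
      (actL2 leftMatrix ((mdSystem M).nonlin ((mdSystem M).S t (U t))).1))
    rwa [translationL2.apply_neg_apply] at this

theorem pairST_spinor_right (hU : (mdSystem M).toQuadField.IsIntegralCurve U) {T : ℝ}
    {φ : ℝ × ℝ → ℝ} (hφ : IsTest φ) (hT : tsupport φ ⊆ strip T) :
    realizationL2.pairST T (fun p => pd 0 φ p - (-1) * pd 1 φ p)
        (fun t => ((mdSystem M).S t (U t)).1 - actL2 leftMatrix ((mdSystem M).S t (U t)).1) =
      -realizationL2.pairST T φ
        (fun t => ((mdSystem M).nonlin ((mdSystem M).S t (U t))).1 -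
          actL2 leftMatrix ((mdSystem M).nonlin ((mdSystem M).S t (U t))).1) := by
  refine realizationL2.pairST_transport hφ hT (U := fun t => (U t).1 - actL2 leftMatrix (U t).1)
    (U' := fun t => ((mdSystem M).toQuadField.field t (U t)).1 -
      actL2 leftMatrix ((mdSystem M).toQuadField.field t (U t)).1) (-1)
    (fun t => ?_) ?_ (fun t => ?_) (fun t => ?_)
  · have h1 := (ContinuousLinearMap.fst ℝ L2 _).hasFDerivAt.comp_hasDerivAt t (hU t)
    exact h1.sub ((actL2 leftMatrix).hasFDerivAt.comp_hasDerivAt t h1)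
  · have h1 := ((mdSystem M).toQuadField.continuous_field_comp hU.continuous).fst
    exact h1.sub ((actL2 leftMatrix).continuous.comp h1)
  · rw [mdSystem_S, evolveL2_sub_actL2_leftMatrix, neg_one_mul]
    exact coeFn_translation (by simp) (-t) _
  · rw [field_apply_mdSystem, evolveL2_sub_actL2_leftMatrix, neg_one_mul, neg_neg]
    have := coeFn_translation (by simp) (-t) (translationL2 t
      (((mdSystem M).nonlin ((mdSystem M).S t (U t))).1 -
        actL2 leftMatrix ((mdSystem M).nonlin ((mdSystem M).S t (U t))).1))
    rwa [translationL2.neg_apply_apply] at this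

theorem pairST_riemann_left (hU : (mdSystem M).toQuadField.IsIntegralCurve U) {T : ℝ}
    {φ : ℝ × ℝ → ℝ} (hφ : IsTest φ) (hT : tsupport φ ⊆ strip T) (μ : Fin 2) :
    realizationL1.pairST T (fun p => pd 0 φ p - 1 * pd 1 φ p)
        (fun t => ((mdSystem M).S t (U t)).2.2.1 μ) =
      -realizationL1.pairST T φ
        (fun t => -currentL μ ((mdSystem M).S t (U t)).1 ((mdSystem M).S t (U t)).1) := by
  let π : State →L[ℝ] L1 := ContinuousLinearMap.proj μ ∘L ContinuousLinearMap.fst ℝ _ _ ∘L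
        ContinuousLinearMap.snd ℝ _ _ ∘L ContinuousLinearMap.snd ℝ _ _
  refine realizationL1.pairST_transport hφ hT (U := fun t => π (U t))
    (U' := fun t => π ((mdSystem M).toQuadField.field t (U t))) 1
    (fun t => ?_) ?_ (fun t => ?_) (fun t => ?_)
  · exact π.hasFDerivAt.comp_hasDerivAt t (hU t)
  · exact π.continuous.comp ((mdSystem M).toQuadField.continuous_field_comp hU.continuous)
  · rw [mdSystem_S, one_mul]
    exact coeFn_translation (by simp) t _
  · rw [field_apply_mdSystem, one_mul]
    have := coeFn_translation (by simp) t (translationL1 (-t)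
      (-currentL μ ((mdSystem M).S t (U t)).1 ((mdSystem M).S t (U t)).1))
    rw [translationL1.apply_neg_apply, map_neg] at this
    exact this

/-- The velocity equation follows from the transport of the two parts of the potential. -/
theorem pairST_velocity (hU : (mdSystem M).toQuadField.IsIntegralCurve U) {T : ℝ}
    {φ : ℝ × ℝ → ℝ} (hφ : IsTest φ) (hT : tsupport φ ⊆ strip T) (μ : Fin 2) :
    realizationL1.pairST T φ (fun t => (ofState ((mdSystem M).S t (U t))).2.2 μ) =
      -ofY.pairST T (pd 0 φ) (fun t => (ofState ((mdSystem M).S t (U t))).2.1 μ) := by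
  let z : ℝ → State := fun t => (mdSystem M).S t (U t)
  have hz : Continuous z := continuous_S_curve hU
  let ℓ : State →L[ℝ] ℝ := ContinuousLinearMap.proj μ ∘L ContinuousLinearMap.fst ℝ _ _ ∘L
    ContinuousLinearMap.snd ℝ L2 _
  let π : State →L[ℝ] L1 := ContinuousLinearMap.proj μ ∘L ContinuousLinearMap.fst ℝ _ _ ∘L
    ContinuousLinearMap.snd ℝ _ _ ∘L ContinuousLinearMap.snd ℝ _ _
  let π' : State →L[ℝ] L1 := ContinuousLinearMap.proj μ ∘L ContinuousLinearMap.snd ℝ _ _ ∘L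
    ContinuousLinearMap.snd ℝ _ _ ∘L ContinuousLinearMap.snd ℝ _ _
  -- The potential is split as A = a + a', a left-moving part with derivative P/2 and a right-moving
  -- part with derivative −Q/2, each taking half of the limit at −∞.
  let a : State →L[ℝ] Y := Y.ofDeriv ∘L ((1 / 2 : ℝ) • ℓ.prod π)
  let a' : State →L[ℝ] Y := Y.ofDeriv ∘L ((1 / 2 : ℝ) • ℓ.prod (-π'))
  have hF : ∀ t, (mdSystem M).toQuadField.field t (U t) =
      (evolveL2 (-t) ((mdSystem M).nonlin (z t)).1, 0,
        fun μ => -translationL1 (-t) (currentL μ (z t).1 (z t).1),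
        fun μ => -translationL1 t (currentL μ (z t).1 (z t).1)) :=
    fun t => field_apply_mdSystem M t (U t)
  have hN : ∀ t, (mdSystem M).nonlin (z t) = (((mdSystem M).nonlin (z t)).1, 0,
      (fun μ => -currentL μ (z t).1 (z t).1), fun μ => -currentL μ (z t).1 (z t).1) := by
    intro t
    rw [mdSystem_nonlin]
  have hFc := (mdSystem M).toQuadField.continuous_field_comp hU.continuous
  have ea : ∀ w, (a w).fn = (Y.ofDeriv ((1 / 2 : ℝ) * ℓ w, (1 / 2 : ℝ) • π w)).fn := fun w => rfl
  have ea' : ∀ w, (a' w).fn = (Y.ofDeriv ((1 / 2 : ℝ) * ℓ w, (1 / 2 : ℝ) • -π' w)).fn :=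
    fun w => rfl
  have e1 : ofY.pairST T (fun p => pd 0 φ p - 1 * pd 1 φ p) (fun t => a (z t)) =
      -ofY.pairST T φ (fun t => a ((mdSystem M).nonlin (z t))) := by
    refine (ofY.comap a).pairST_transport hφ hT (v := z) 1 hU hFc
      (fun t => Eventually.of_forall fun x => ?_) (fun t => Eventually.of_forall fun x => ?_)
    · change (a (z t)).fn x = (a (U t)).fn (x + 1 * t)
      rw [ea, ea, ← fn_ofDeriv_translation]
      simp only [z, mdSystem_S, one_mul, map_smul]
      rfl
    · change (a ((mdSystem M).nonlin (z t))).fn x = (a _).fn (x + 1 * t)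
      rw [ea, ea, ← fn_ofDeriv_translation, hF, hN]
      change (Y.ofDeriv ((1 / 2 : ℝ) * 0, (1 / 2 : ℝ) • -currentL μ (z t).1 (z t).1)).fn x =
        (Y.ofDeriv ((1 / 2 : ℝ) * 0, translationL1 (1 * t)
        ((1 / 2 : ℝ) • -translationL1 (-t) (currentL μ (z t).1 (z t).1)))).fn x
      rw [one_mul, map_smul, map_neg, translationL1.apply_neg_apply]
  have e2 : ofY.pairST T (fun p => pd 0 φ p - (-1) * pd 1 φ p) (fun t => a' (z t)) =
      -ofY.pairST T φ (fun t => a' ((mdSystem M).nonlin (z t))) := by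
    refine (ofY.comap a').pairST_transport hφ hT (v := z) (-1) hU hFc
      (fun t => Eventually.of_forall fun x => ?_) (fun t => Eventually.of_forall fun x => ?_)
    · change (a' (z t)).fn x = (a' (U t)).fn (x + -1 * t)
      rw [ea', ea', ← fn_ofDeriv_translation]
      simp only [z, mdSystem_S, neg_one_mul, map_smul, map_neg]
      rfl
    · change (a' ((mdSystem M).nonlin (z t))).fn x = (a' _).fn (x + -1 * t)
      rw [ea', ea', ← fn_ofDeriv_translation, hF, hN]
      change (Y.ofDeriv ((1 / 2 : ℝ) * 0, (1 / 2 : ℝ) • -(-currentL μ (z t).1 (z t).1))).fn x =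
        (Y.ofDeriv ((1 / 2 : ℝ) * 0, translationL1 (-1 * t)
        ((1 / 2 : ℝ) • -(-translationL1 t (currentL μ (z t).1 (z t).1))))).fn x
      rw [neg_one_mul, neg_neg, neg_neg, map_smul, translationL1.neg_apply_apply]
  -- The sources of the two parts are opposite and cancel in ∂ₜA, which leaves ∂ₜA = ∂ₓ(a − a') = (P
  -- + Q)/2.
  have ej : ∀ t, a' ((mdSystem M).nonlin (z t)) = -a ((mdSystem M).nonlin (z t)) := by
    intro t
    rw [hN]
    change Y.ofDeriv ((1 / 2 : ℝ) * 0, (1 / 2 : ℝ) • -(-currentL μ (z t).1 (z t).1)) =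
      -Y.ofDeriv ((1 / 2 : ℝ) * 0, (1 / 2 : ℝ) • -currentL μ (z t).1 (z t).1)
    rw [← map_neg Y.ofDeriv, mul_zero, Prod.neg_mk, neg_zero, smul_neg]
  simp only [ej] at e2
  have ha : Continuous fun t => a (z t) := a.continuous.comp hz
  have ha' : Continuous fun t => a' (z t) := a'.continuous.comp hz
  have hA : (fun t => (ofState (z t)).2.1 μ) = fun t => a (z t) + a' (z t) := by
    funext t
    change Y.ofDeriv (ℓ (z t), (1 / 2 : ℝ) • (π (z t) - π' (z t))) =
      Y.ofDeriv ((1 / 2 : ℝ) * ℓ (z t), (1 / 2 : ℝ) • π (z t)) +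
      Y.ofDeriv ((1 / 2 : ℝ) * ℓ (z t), (1 / 2 : ℝ) • -π' (z t))
    rw [← map_add, Prod.mk_add_mk]
    congr 1
    refine Prod.ext ?_ ?_
    · change ℓ (z t) = (1 / 2 : ℝ) * ℓ (z t) + (1 / 2 : ℝ) * ℓ (z t)
      ring
    · change (1 / 2 : ℝ) • (π (z t) - π' (z t)) = (1 / 2 : ℝ) • π (z t) + (1 / 2 : ℝ) • -π' (z t)
      rw [smul_sub, smul_neg, sub_eq_add_neg]
  have hB : (fun t => (ofState (z t)).2.2 μ) = fun t => Y.derivL (a (z t) - a' (z t)) := by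
    funext t
    rw [map_sub]
    change (1 / 2 : ℝ) • (π (z t) + π' (z t)) = (1 / 2 : ℝ) • π (z t) - (1 / 2 : ℝ) • -π' (z t)
    rw [smul_add, smul_neg, sub_neg_eq_add]
  have e3 := pairST_pd_one (T := T) hφ (fun t => a (z t) - a' (z t))
  rw [ofY.pairST_sub_mul (hφ.pd 0) (hφ.pd 1) _ ha] at e1
  rw [ofY.pairST_sub_mul (hφ.pd 0) (hφ.pd 1) _ ha', ofY.pairST_neg hφ] at e2
  rw [ofY.pairST_sub (hφ.pd 1) ha ha'] at e3
  change realizationL1.pairST T φ (fun t => (ofState (z t)).2.2 μ) =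
    -ofY.pairST T (pd 0 φ) (fun t => (ofState (z t)).2.1 μ)
  rw [hA, hB, ofY.pairST_add (hφ.pd 0) ha ha']
  simp only [smul_eq_mul] at e1 e2
  linarith

/-- Integral curves give solutions in the sense of distributions. -/
theorem isSolution_of_isIntegralCurve (hU : (mdSystem M).toQuadField.IsIntegralCurve U) {T : ℝ}
    (hT : 0 < T) (u : CX0 T) (hu : ∀ t : Icc (-T) T, u t = ofState ((mdSystem M).S t (U t))) :
    IsSolution hT M (ofState (U 0)) u := by
  have hz : Continuous fun t => (mdSystem M).S t (U t) := continuous_S_curve hU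
  have hw : Continuous fun t => ofState ((mdSystem M).S t (U t)) := ofState.continuous.comp hz
  have hvel : ∀ φ, IsTest φ → tsupport φ ⊆ strip T → ∀ μ,
      realizationL1.pairST T φ (fun t => (extend hT.le u t).2.2 μ) =
      -ofY.pairST T (pd 0 φ) (fun t => (extend hT.le u t).2.1 μ) := by
    intro φ hφ hφT μ
    have hTT : -T ≤ T := by linarith
    have h1 := pairST_velocity hU hφ hφT μ
    convert h1 using 1
    · refine intervalIntegral.integral_congr fun t ht => ?_
      rw [uIcc_of_le hTT] at ht
      simp only [extend_of_mem hT.le u ht, hu]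
    · refine congrArg Neg.neg (intervalIntegral.integral_congr fun t ht => ?_)
      rw [uIcc_of_le hTT] at ht
      simp only [extend_of_mem hT.le u ht, hu]
  refine ⟨?_, fun φ μ => ?_, fun φ => ?_, fun φ μ => ?_⟩
  · rw [hu]
    simp only [(mdSystem M).S_zero]
  · exact (velocity_iff hT.le u μ).2 (hvel φ (testFunction_isTest φ) φ.tsupport_subset μ)
  · exact (dirac_iff hT.le M u hz hu (testFunction_isTest φ)).2
      ⟨pairST_spinor_left hU (testFunction_isTest φ) φ.tsupport_subset,
        pairST_spinor_right hU (testFunction_isTest φ) φ.tsupport_subset⟩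
  · have hφ := testFunction_isTest φ
    have hTT : -T ≤ T := by linarith
    have hv := continuous_extend hT.le u
    -- Given the velocity equation, the transport equation of one Riemann invariant is already
    -- equivalent to the wave equation, so c = 1 suffices.
    have h1 := pairST_riemann (A := fun t => (extend hT.le u t).2.1 μ)
      (B := fun t => (extend hT.le u t).2.2 μ) ((continuous_apply μ).comp hv.snd.fst)
      ((continuous_apply μ).comp hv.snd.snd) (fun χ hχ hχT => hvel χ hχ hχT μ) hφ
      φ.tsupport_subset (c := 1) (by norm_num)
    have h2 := pairST_riemann_left hU hφ φ.tsupport_subset μ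
    rw [realizationL1.pairST_neg hφ, neg_neg] at h2
    refine (wave_iff hT.le u μ).2 ?_
    rw [← neg_inj, neg_neg, ← h1]
    convert h2 using 1
    · refine intervalIntegral.integral_congr fun t ht => ?_
      rw [uIcc_of_le hTT] at ht
      have h3 := congrArg (fun z : State => z.2.2.1 μ)
        (toState_ofState ((mdSystem M).S t (U t)))
      rw [← hu ⟨t, ht⟩] at h3
      simp only [extend_of_mem hT.le u ht, ← h3, one_smul, toState_apply]
    · refine intervalIntegral.integral_congr fun t ht => ?_
      rw [uIcc_of_le hTT] at ht
      simp only [extend_of_mem hT.le u ht, hu]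
      rfl

end

/-! ### From weak to mild solutions of transport equations -/

namespace Realization

variable {X E : Type*} [NormedAddCommGroup X] [NormedSpace ℝ X]
    [NormedAddCommGroup E] [NormedSpace ℝ E] {ρ : Realization X E}

/-- Weak solutions of a transport equation are mild solutions. -/
theorem IsTranslation.eq_add_integral [CompleteSpace X] [CompleteSpace E] {τ : IsometryGroup X}
    (hτ : ρ.IsTranslation τ) (hρ : ρ.IsFaithful) {T : ℝ} (hT : 0 < T) {v F : ℝ → X}
    (hv : Continuous v) (hF : Continuous F) (c : ℝ)
    (H : ∀ φ : ℝ × ℝ → ℝ, IsTest φ → tsupport φ ⊆ strip T →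
      ρ.pairST T (fun p => pd 0 φ p - c * pd 1 φ p) v = -ρ.pairST T φ F) :
    ∀ t ∈ Icc (-T) T, τ (-(c * t)) (v t) = v 0 + ∫ s in (0 : ℝ)..t, τ (-(c * s)) (F s) := by
  intro t ht
  have hc : Continuous fun s => τ (-(c * s)) (F s) := τ.continuous_uncurry.comp
      ((by fun_prop : Continuous fun t : ℝ => -(c * t)).prodMk hF)
  refine hρ.eq_of_pair_eq fun χ hχ => ?_
  rw [hτ.pair_eq_of_pairST_eq hT hv hF c H hχ t ht, ρ.pair_add hχ, ← ρ.functional_apply hχ (∫ s in _.._, _),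
    ← ContinuousLinearMap.intervalIntegral_comp_comm _ (hc.intervalIntegrable _ _)]
  simp only [ρ.functional_apply hχ]

end Realization

/-! ### Uniqueness of solutions -/

open Realization

theorem pair_const_mul {X E : Type*} [NormedAddCommGroup X] [NormedSpace ℝ X]
    [NormedAddCommGroup E] [NormedSpace ℝ E] (ρ : Realization X E) (a : ℝ) (χ : ℝ → ℝ) (f : X) :
    ρ.pair (fun x => a * χ x) f = a • ρ.pair χ f := by
  rw [pair, pair, ← integral_smul]
  simp only [mul_smul]

/-- The velocity equation, integrated in time. -/
theorem pair_eq_add_integral_of_velocity {T : ℝ} (hT : 0 < T) {A : ℝ → Y} {B : ℝ → L1}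
    (hA : Continuous A) (hB : Continuous B) (hAB : ∀ φ, IsTest φ → tsupport φ ⊆ strip T →
      realizationL1.pairST T φ B = -ofY.pairST T (pd 0 φ) A) {χ : ℝ → ℝ} (hχ : IsTest χ) :
    ∀ t ∈ Icc (-T) T, ofY.pair χ (A t) =
      ofY.pair χ (A 0) + ∫ s in (0 : ℝ)..t, realizationL1.pair χ (B s) := by
  have c1 : Continuous fun t => ofY.pair χ (A t) := by
    simp only [← ofY.functional_apply hχ]
    exact (ofY.functional hχ).continuous.comp hA
  have c2 : Continuous fun t => realizationL1.pair χ (B t) := by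
    simp only [← realizationL1.functional_apply hχ]
    exact (realizationL1.functional hχ).continuous.comp hB
  refine eq_add_integral_of_forall_integral_deriv_smul c1 c2 hT fun η hη hηT => ?_
  -- Without shear the test function is the plain product η(t)χ(x).
  have hφ := hη.mul_comp_shear hχ 0
  have h2 := hAB _ hφ (tsupport_mul_comp_shear_subset 0 hηT)
  have h3 : ∀ t x, pd 0 (fun p : ℝ × ℝ => η p.1 * χ (p.2 + 0 * p.1)) (t, x) =
      deriv η t * χ x := by
    intro t x
    refine (hasDerivAt_pd_zero (hφ.contDiff.of_le (by simp)) t x).unique ?_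
    simpa using (hη.hasDerivAt t).mul_const (χ x)
  simp only [pairST, h3, pair_const_mul] at h2
  simp only [zero_mul, add_zero] at h2
  rw [h2, neg_neg]

/-- The limits of the potentials at `-∞` are conserved. -/
theorem lim_eq_of_velocity {T : ℝ} (hT : 0 < T) {A : ℝ → Y} {B : ℝ → L1} (hA : Continuous A)
    (hB : Continuous B) (hAB : ∀ φ, IsTest φ → tsupport φ ⊆ strip T →
      realizationL1.pairST T φ B = -ofY.pairST T (pd 0 φ) A) :
    ∀ t ∈ Icc (-T) T, Y.lim (A t) = Y.lim (A 0) := by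
  intro t ht
  -- A(t) − A(0) coincides with this element of L¹. A function integrable near −∞ that has a limit
  -- there has limit zero, so the limits of A(t) and A(0) agree.
  let D : L1 := ∫ s in (0 : ℝ)..t, B s
  have h1 : ∀ χ : ℝ → ℝ, IsTest χ → ofY.pair χ (A t - A 0) = ∫ x, χ x • D x := by
    intro χ hχ
    have h4 : ofY.pair χ (A t - A 0) = ofY.pair χ (A t) - ofY.pair χ (A 0) := by
      simp only [← ofY.functional_apply hχ, map_sub]
    have h5 : realizationL1.pair χ D = ∫ s in (0 : ℝ)..t, realizationL1.pair χ (B s) := by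
      rw [← realizationL1.functional_apply hχ, ← ContinuousLinearMap.intervalIntegral_comp_comm _
        (hB.intervalIntegrable _ _)]
      simp only [realizationL1.functional_apply hχ]
    rw [h4, pair_eq_add_integral_of_velocity hT hA hB hAB hχ t ht, add_sub_cancel_left, ← h5]
    rfl
  have h2 := ofY.ae_eq_of_pair_eq (realizationL1.locallyIntegrable D) h1
  have h3 : Integrable (A t - A 0).fn := (L1.integrable_coeFn D).congr h2.symm
  have h4 : Y.lim (A t - A 0) = 0 := by
    refine IntegrableAtFilter.eq_zero_of_tendsto (μ := volume) (l := atBot)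
      (f := (A t - A 0).fn) ⟨univ, univ_mem, h3.integrableOn⟩ (fun s hs => ?_) (Y.tendsto_atBot _)
    obtain ⟨a, ha⟩ := mem_atBot_sets.1 hs
    exact top_unique (Real.volume_Iic.symm.le.trans (measure_mono ha))
  rwa [map_sub, sub_eq_zero] at h4

theorem TransportSystem.continuous_S_comp {Z : Type*} [NormedAddCommGroup Z] [NormedSpace ℝ Z]
    (sys : TransportSystem Z) {α : Type*} [TopologicalSpace α] {f : α → ℝ} {u : α → Z}
    (hf : Continuous f) (hu : Continuous u) : Continuous fun a => sys.S (f a) (u a) :=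
  sys.continuous_S.comp (hf.prodMk hu)

/-- The curve in the interaction picture belonging to a curve of data. -/
def interaction (M : ℝ) {T : ℝ} (u : CX0 T) : Curve T State :=
  ⟨fun t => (mdSystem M).S (-t) (toState (u t)),
    (mdSystem M).continuous_S_comp continuous_subtype_val.neg
      (toState.continuous.comp u.continuous)⟩

theorem interaction_apply (M : ℝ) {T : ℝ} (u : CX0 T) (t : Icc (-T) T) :
    interaction M u t = (mdSystem M).S (-t) (toState (u t)) := rfl

theorem interaction_injective (M T : ℝ) : Function.Injective (interaction M (T := T)) := by
  intro u v h
  ext1 t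
  have h1 := congrArg (fun W : Curve T State => ofState ((mdSystem M).S t (W t))) h
  simpa only [interaction_apply, (mdSystem M).S_S_neg, ofState_toState] using h1

theorem evolveL2_neg (t : ℝ) (f : L2) : evolveL2 (-t) f =
    translationL2 (-(1 * t)) (actL2 leftMatrix f) +
      translationL2 (-(-1 * t)) (f - actL2 leftMatrix f) := by
  rw [evolveL2, one_mul, neg_one_mul]

/-- Solutions in the sense of distributions are mild solutions. -/
theorem IsSolution.defect_interaction {M T : ℝ} {hT : 0 < T} {d : X0} {u : CX0 T}
    (hu : IsSolution hT M d u) :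
    (mdSystem M).toQuadField.defect hT.le (interaction M u) =
      ContinuousMap.const _ (toState d) := by
  let v : ℝ → X0 := extend hT.le u
  have hv : Continuous v := continuous_extend hT.le u
  let z : ℝ → State := fun t => toState (v t)
  have hz : Continuous z := toState.continuous.comp hv
  have huz : ∀ t : Icc (-T) T, u t = ofState (z t) := fun t => by
    rw [ofState_toState]
    exact (extend_apply hT.le u t).symm
  let N : ℝ → State := fun t => (mdSystem M).nonlin (z t)
  have hN : Continuous N := continuous_nonlin_curve hz
  have hN1 : Continuous fun t => (N t).1 := hN.fst
  have hz1 : Continuous fun t => (z t).1 := hz.fst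
  have hNl : Continuous fun t => actL2 leftMatrix (N t).1 := (actL2 leftMatrix).continuous.comp hN1
  have hzl : Continuous fun t => actL2 leftMatrix (z t).1 := (actL2 leftMatrix).continuous.comp hz1
  have hdirac : ∀ φ, IsTest φ → tsupport φ ⊆ strip T →
      realizationL2.pairST T (fun p => pd 0 φ p - 1 * pd 1 φ p)
        (fun t => actL2 leftMatrix (z t).1) =
      -realizationL2.pairST T φ (fun t => actL2 leftMatrix (N t).1) ∧
      realizationL2.pairST T (fun p => pd 0 φ p - (-1) * pd 1 φ p)
        (fun t => (z t).1 - actL2 leftMatrix (z t).1) =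
      -realizationL2.pairST T φ (fun t => (N t).1 - actL2 leftMatrix (N t).1) :=
      fun φ hφ hφT => by
    obtain ⟨φ', rfl⟩ := exists_testFunction hφ hφT
    exact (dirac_iff hT.le M u hz huz hφ).1 (hu.dirac φ')
  have hvel : ∀ φ, IsTest φ → tsupport φ ⊆ strip T → ∀ μ,
      realizationL1.pairST T φ (fun t => (v t).2.2 μ) =
      -ofY.pairST T (pd 0 φ) (fun t => (v t).2.1 μ) := fun φ hφ hφT μ => by
    obtain ⟨φ', rfl⟩ := exists_testFunction hφ hφT
    exact (velocity_iff hT.le u μ).1 (hu.velocity φ' μ)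
  have hwave : ∀ φ, IsTest φ → tsupport φ ⊆ strip T → ∀ μ,
      ofY.pairST T (box φ) (fun t => (v t).2.1 μ) =
      -realizationL1.pairST T φ (fun t => currentL μ (z t).1 (z t).1) := fun φ hφ hφT μ => by
    obtain ⟨φ', rfl⟩ := exists_testFunction hφ hφT
    exact (wave_iff hT.le u μ).1 (hu.wave φ' μ)
  have hA : ∀ μ, Continuous fun t => (v t).2.1 μ := fun μ => (continuous_apply μ).comp hv.snd.fst
  have hB : ∀ μ, Continuous fun t => (v t).2.2 μ := fun μ => (continuous_apply μ).comp hv.snd.snd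
  have hP : ∀ μ, Continuous fun t => (z t).2.2.1 μ := fun μ =>
    (continuous_apply μ).comp hz.snd.snd.fst
  have hQ : ∀ μ, Continuous fun t => (z t).2.2.2 μ := fun μ =>
    (continuous_apply μ).comp hz.snd.snd.snd
  have hJ : ∀ μ, Continuous fun t => -currentL μ (z t).1 (z t).1 := fun μ =>
    (((currentL μ).continuous.comp hz1).clm_apply hz1).neg
  -- The mild equations, component by component: left and right spinor parts, the invariants P and
  -- Q, and the constancy of the limits at −∞. Together they form the integral equation in the
  -- interaction picture.
  have m1 := (isTranslation_ofLp Spinor 2 (by simp)).eq_add_integral (isFaithful_ofLp Spinor 2) hT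
    hzl hNl 1 fun φ hφ hφT => (hdirac φ hφ hφT).1
  have m2 := (isTranslation_ofLp Spinor 2 (by simp)).eq_add_integral (isFaithful_ofLp Spinor 2) hT
    (hz1.sub hzl) (hN1.sub hNl) (-1) fun φ hφ hφT => (hdirac φ hφ hφT).2
  have m3 := fun μ => (isTranslation_ofLp ℝ 1 (by simp)).eq_add_integral (isFaithful_ofLp ℝ 1) hT
    (hP μ) (hJ μ) 1 fun φ hφ hφT => by
      have h1 := pairST_riemann (hA μ) (hB μ) (fun χ hχ hχT => hvel χ hχ hχT μ) hφ hφT (c := 1)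
        (by norm_num)
      rw [hwave φ hφ hφT, ← realizationL1.pairST_neg hφ] at h1
      simp only [one_smul] at h1
      exact h1
  have m4 := fun μ => (isTranslation_ofLp ℝ 1 (by simp)).eq_add_integral (isFaithful_ofLp ℝ 1) hT
    (hQ μ) (hJ μ) (-1) fun φ hφ hφT => by
      have h1 := pairST_riemann (hA μ) (hB μ) (fun χ hχ hχT => hvel χ hχ hχT μ) hφ hφT (c := -1)
        (by norm_num)
      rw [hwave φ hφ hφT, ← realizationL1.pairST_neg hφ] at h1
      simp only [neg_one_smul, ← sub_eq_add_neg] at h1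
      exact h1
  have m5 := fun μ => lim_eq_of_velocity hT (hA μ) (hB μ) fun φ hφ hφT => hvel φ hφ hφT μ
  have hz0 : z 0 = toState d := by
    rw [← hu.initial]
    exact congrArg toState (extend_of_mem hT.le u _)
  let W : ℝ → State := fun t => (mdSystem M).S (-t) (z t)
  have hWc : Continuous W := (mdSystem M).continuous_S_apply continuous_neg hz
  refine ((mdSystem M).toQuadField.defect_eq_const_iff hT.le _ _ W fun t => ?_).2 fun t ht => ?_
  · rw [interaction_apply, ← extend_apply hT.le u t]
  have hfield : ∀ s, (mdSystem M).toQuadField.field s (W s) =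
      (evolveL2 (-s) (N s).1, 0,
        fun μ => translationL1 (-(1 * s)) (-currentL μ (z s).1 (z s).1),
        fun μ => translationL1 (-(-1 * s)) (-currentL μ (z s).1 (z s).1)) := by
    intro s
    rw [field_apply_mdSystem, (mdSystem M).S_S_neg]
    simp only [map_neg, one_mul, neg_one_mul, neg_neg, N]
  have hFc : Continuous fun s => (mdSystem M).toQuadField.field s (W s) :=
    (mdSystem M).toQuadField.continuous_field_comp hWc
  have hmap : ∀ {X : Type} [NormedAddCommGroup X] [NormedSpace ℝ X] [CompleteSpace X]
      (π : State →L[ℝ] X),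
      π (toState d + ∫ s in (0 : ℝ)..t, (mdSystem M).toQuadField.field s (W s)) =
      π (z 0) + ∫ s in (0 : ℝ)..t, π ((mdSystem M).toQuadField.field s (W s)) := by
    intro X _ _ _ π
    rw [map_add, hz0, π.intervalIntegral_comp_comm (hFc.intervalIntegrable _ _)]
  have hWt : W t = (evolveL2 (-t) (z t).1, (z t).2.1,
      fun μ => translationL1 (-(1 * t)) ((z t).2.2.1 μ),
      fun μ => translationL1 (-(-1 * t)) ((z t).2.2.2 μ)) := by
    change (mdSystem M).S (-t) (z t) = _
    rw [mdSystem_S]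
    simp only [one_mul, neg_one_mul]
  refine Prod.ext ?_ (Prod.ext (funext fun μ => ?_) (Prod.ext (funext fun μ => ?_)
    (funext fun μ => ?_)))
  · refine Eq.trans ?_ (hmap (ContinuousLinearMap.fst ℝ L2 _)).symm
    simp only [hfield, hWt, ContinuousLinearMap.coe_fst', evolveL2_neg]
    have i1 : Continuous fun s => translationL2 (-(1 * s)) (actL2 leftMatrix (N s).1) :=
      translationL2.continuous_uncurry.comp
        ((by fun_prop : Continuous fun t : ℝ => -(1 * t)).prodMk hNl)
    have i2 : Continuous fun s => translationL2 (-(-1 * s)) ((N s).1 - actL2 leftMatrix (N s).1) :=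
      translationL2.continuous_uncurry.comp
        ((by fun_prop : Continuous fun t : ℝ => -(-1 * t)).prodMk (hN1.sub hNl))
    rw [intervalIntegral.integral_add (i1.intervalIntegrable _ _) (i2.intervalIntegrable _ _)]
    rw [m1 t ht]
    refine (congrArg _ (m2 t ht)).trans ?_
    simp only [Pi.sub_apply]
    abel
  · refine Eq.trans ?_ (hmap (ContinuousLinearMap.proj μ ∘L ContinuousLinearMap.fst ℝ _ _ ∘L
      ContinuousLinearMap.snd ℝ L2 _)).symm
    simp only [hfield, hWt]
    refine (m5 μ t ht).trans ?_
    simp [z]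
    rfl
  · refine Eq.trans ?_ (hmap (ContinuousLinearMap.proj μ ∘L ContinuousLinearMap.fst ℝ _ _ ∘L
      ContinuousLinearMap.snd ℝ _ _ ∘L ContinuousLinearMap.snd ℝ L2 _)).symm
    simp only [hfield, hWt]
    exact m3 μ t ht
  · refine Eq.trans ?_ (hmap (ContinuousLinearMap.proj μ ∘L ContinuousLinearMap.snd ℝ _ _ ∘L
      ContinuousLinearMap.snd ℝ _ _ ∘L ContinuousLinearMap.snd ℝ L2 _)).symm
    simp only [hfield, hWt]
    exact m4 μ t ht

/-- Both solutions become curves of the same defect, and the defect is injective. -/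
theorem IsSolution.unique {M T : ℝ} {hT : 0 < T} {d : X0} {u v : CX0 T}
    (hu : IsSolution hT M d u) (hv : IsSolution hT M d v) : u = v :=
  interaction_injective M T ((mdSystem M).toQuadField.defect_injective hT.le
    (hu.defect_interaction.trans hv.defect_interaction.symm))

/-! ### The solution map -/

theorem exists_flow (M : ℝ) (z : State) :
    ∃ U : ℝ → State, (mdSystem M).toQuadField.IsIntegralCurve U ∧ U 0 = z :=
  (mdSystem M).toQuadField.exists_isIntegralCurve (mdSystem_apriori M) z

/-- The integral curves of the Maxwell-Dirac system in the interaction picture. -/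
def flow (M : ℝ) (z : State) : ℝ → State := (exists_flow M z).choose

theorem isIntegralCurve_flow (M : ℝ) (z : State) :
    (mdSystem M).toQuadField.IsIntegralCurve (flow M z) := (exists_flow M z).choose_spec.1

theorem flow_zero (M : ℝ) (z : State) : flow M z 0 = z := (exists_flow M z).choose_spec.2

/-- The curve of data belonging to a curve in the interaction picture. -/
def ofInteraction (M : ℝ) {T : ℝ} (W : Curve T State) : CX0 T :=
  ⟨fun t => ofState ((mdSystem M).S t (W t)), ofState.continuous.comp
    ((mdSystem M).continuous_S_comp continuous_subtype_val W.continuous)⟩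

/-- The free evolution is only strongly continuous in time; joint continuity on the compact interval
still gives continuity for uniform convergence. -/
theorem continuous_ofInteraction (M T : ℝ) : Continuous (ofInteraction M (T := T)) := by
  refine ContinuousMap.continuous_of_continuous_uncurry _ ?_
  have h1 : Continuous fun p : Curve T State × Icc (-T) T => p.1 p.2 := continuous_eval
  exact ofState.continuous.comp
    ((mdSystem M).continuous_S_comp (continuous_subtype_val.comp continuous_snd) h1)

/-- The flow on a time interval. -/
def flowCurve (M T : ℝ) (z : State) : Curve T State :=
  QuadField.restrictCurve T (flow M z) (isIntegralCurve_flow M z).continuous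

theorem defect_flowCurve (M : ℝ) {T : ℝ} (hT : 0 ≤ T) (z : State) :
    (mdSystem M).toQuadField.defect hT (flowCurve M T z) = ContinuousMap.const _ z := by
  rw [flowCurve, (isIntegralCurve_flow M z).defect_restrict hT, flow_zero]

/-- On the ball of radius ‖z‖ + 1 the a priori bound confines all curves to one ball, where the
inverse of the defect is Lipschitz. -/
theorem continuous_flowCurve (M : ℝ) {T : ℝ} (hT : 0 ≤ T) : Continuous (flowCurve M T) := by
  refine continuous_iff_continuousAt.2 fun z => ?_
  obtain ⟨R, hR⟩ := mdSystem_apriori M T hT (‖z‖ + 1)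
  obtain ⟨C, hC, hlip⟩ := (mdSystem M).toQuadField.exists_norm_sub_le hT (max R 0)
    (le_max_right _ _)
  have hb : ∀ w : State, ‖w‖ ≤ ‖z‖ + 1 → ‖flowCurve M T w‖ ≤ max R 0 := fun w hw =>
    (hR w _ hw (defect_flowCurve M hT w)).trans (le_max_left _ _)
  have h1 : ∀ᶠ w in 𝓝 z, ‖w‖ ≤ ‖z‖ + 1 :=
    (continuous_norm.tendsto z).eventually (Iic_mem_nhds (by linarith))
  have h2 : Tendsto (fun w => C * ‖ContinuousMap.const (Icc (-T) T) w -
      ContinuousMap.const (Icc (-T) T) z‖) (𝓝 z) (𝓝 0) := by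
    have h3 : Continuous fun w : State => C * ‖ContinuousMap.const (Icc (-T) T) w -
      ContinuousMap.const (Icc (-T) T) z‖ :=
      ((ContinuousMap.continuous_const'.sub continuous_const).norm).const_mul C
    have h4 := h3.tendsto z
    rwa [sub_self, norm_zero, mul_zero] at h4
  refine tendsto_iff_norm_sub_tendsto_zero.2 (squeeze_zero' (Eventually.of_forall fun w =>
    norm_nonneg _) (h1.mono fun w hw => ?_) h2)
  have h3 := hlip _ _ (hb w hw) (hb z (by linarith))
  rwa [defect_flowCurve, defect_flowCurve] at h3

/-- The map from data to solutions. -/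
def solution (M T : ℝ) (d : X0) : CX0 T := ofInteraction M (flowCurve M T (toState d))

theorem solution_apply (M T : ℝ) (d : X0) (t : Icc (-T) T) :
    solution M T d t = ofState ((mdSystem M).S t (flow M (toState d) t)) := rfl

theorem continuous_solution (M : ℝ) {T : ℝ} (hT : 0 ≤ T) : Continuous (solution M T) :=
  (continuous_ofInteraction M T).comp ((continuous_flowCurve M hT).comp toState.continuous)

theorem isSolution_solution (M : ℝ) {T : ℝ} (hT : 0 < T) (d : X0) :
    IsSolution hT M d (solution M T d) := by
  have h := isSolution_of_isIntegralCurve (isIntegralCurve_flow M (toState d)) hT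
    (solution M T d) fun t => rfl
  rwa [flow_zero, ofState_toState] at h

/-! ### Orbits under translations and regularity -/

theorem pair_realizationState_toState (χ : ℝ → ℝ) (d : X0) :
    realizationState.pair χ (toState d) = realizationX0.pair χ d := by
  change ∫ x, χ x • realizationX0.fn (ofState (toState d)) x = _
  rw [ofState_toState]
  rfl

/-- `e` is a chain of successive weak derivatives. The derivative of the orbit of `e 0` is the orbit
of `e 1`, and the shifted chain serves the induction. -/
theorem contDiff_orbit_of_pair (N : ℕ) : ∀ e : ℕ → State,
    (∀ j < N, ∀ χ : ℝ → ℝ, IsTest χ →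
      realizationState.pair χ (e (j + 1)) = -realizationState.pair (deriv χ) (e j)) →
    ContDiff ℝ N fun h => translationState h (e 0) := by
  induction N with
  | zero =>
    intro e _
    rw [Nat.cast_zero, contDiff_zero]
    exact translationState.continuous_orbit _
  | succ N ih =>
    intro e he
    have h1 : ∀ h, HasDerivAt (fun h => translationState h (e 0)) (translationState h (e 1)) h :=
      translationState.hasDerivAt_orbit (isTranslation_realizationState.hasDerivAt_of_pair
        isFaithful_realizationState (he 0 N.succ_pos))
    rw [Nat.cast_succ, contDiff_succ_iff_deriv]
    refine ⟨fun h => (h1 h).differentiableAt, by simp, ?_⟩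
    rw [funext fun h => (h1 h).deriv]
    exact ih (fun j => e (j + 1)) fun j hj => he (j + 1) (Nat.succ_lt_succ hj)

/-- This converts weak differentiability of the datum within X₀ into the hypothesis of the
regularity theorem for transport systems. -/
theorem contDiff_orbit_of_isSpaceDeriv {N : ℕ} {d : X0}
    (h : ∀ j ≤ N, ∃ e : X0, IsSpaceDeriv j d e) :
    ContDiff ℝ N fun h => translationState h (toState d) := by
  have htest : ∀ χ : ℝ → ℝ, IsTest χ → ∃ φ : 𝓓((⊤ : Opens ℝ), ℝ), ⇑φ = χ := fun χ hχ =>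
    ⟨⟨χ, hχ.contDiff, hχ.hasCompactSupport, by simp⟩, rfl⟩
  have hpair : ∀ χ : ℝ → ℝ, IsTest χ → ∀ d : X0, pairLine d χ = realizationX0.pair χ d :=
    fun χ hχ d => pairLine_eq hχ.continuous hχ.hasCompactSupport d
  choose! e he using h
  have h0 : e 0 = d := by
    refine isFaithful_realizationX0.eq_of_pair_eq fun χ hχ => ?_
    obtain ⟨φ, rfl⟩ := htest χ hχ
    simpa [hpair _ hχ] using he 0 (Nat.zero_le N) φ
  rw [← h0]
  refine contDiff_orbit_of_pair N (fun j => toState (e j)) fun j hj χ hχ => ?_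
  rw [pair_realizationState_toState, pair_realizationState_toState, ← hpair χ hχ,
    ← hpair _ hχ.deriv]
  obtain ⟨φ, hφ⟩ := htest χ hχ
  obtain ⟨φ', hφ'⟩ := htest _ hχ.deriv
  have h1 := he (j + 1) hj φ
  have h2 := he j hj.le φ'
  rw [hφ, iteratedDeriv_succ'] at h1
  rw [hφ'] at h2
  rw [h1, h2, pow_succ, mul_neg_one, neg_smul]

/-- A function on the plane which is translated by the group `τ` along the second variable. -/
def IsCovariant {Z : Type*} [NormedAddCommGroup Z] [NormedSpace ℝ Z] (τ : IsometryGroup Z)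
    (G : ℝ × ℝ → Z) : Prop := ∀ p h, G (p + (0, h)) = τ h (G p)

/-- Since the operators are linear, covariance is inherited by derivatives, so weak derivatives can
be taken one after another. -/
theorem IsCovariant.fderiv_apply {Z : Type*} [NormedAddCommGroup Z] [NormedSpace ℝ Z]
    {τ : IsometryGroup Z} {G : ℝ × ℝ → Z} (hG : IsCovariant τ G) (hd : Differentiable ℝ G)
    (v : ℝ × ℝ) : IsCovariant τ fun p => fderiv ℝ G p v := by
  intro p h
  have h1 : (fun p => G (p + (0, h))) = fun p => τ h (G p) := funext fun p => hG p h
  have h2 := congrArg (fun F => fderiv ℝ F p v) h1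
  simp only [fderiv_comp_add_right] at h2
  refine h2.trans ?_
  have h3 := ((τ h).hasFDerivAt.comp p (hd p).hasFDerivAt).fderiv
  exact congrArg (fun A : ℝ × ℝ →L[ℝ] Z => A v) h3

theorem IsCovariant.apply {Z : Type*} [NormedAddCommGroup Z] [NormedSpace ℝ Z]
    {τ : IsometryGroup Z} {G : ℝ × ℝ → Z} (hG : IsCovariant τ G) (t h : ℝ) :
    G (t, h) = τ h (G (t, 0)) := by
  rw [← hG (t, 0) h]
  simp

theorem hasDerivAt_fst {Z : Type*} [NormedAddCommGroup Z] [NormedSpace ℝ Z] {G : ℝ × ℝ → Z}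
    (hd : Differentiable ℝ G) (t h : ℝ) :
    HasDerivAt (fun t => G (t, h)) (fderiv ℝ G (t, h) (1, 0)) t :=
  (hd (t, h)).hasFDerivAt.comp_hasDerivAt t ((hasDerivAt_id t).prodMk (hasDerivAt_const t h))

theorem hasDerivAt_snd {Z : Type*} [NormedAddCommGroup Z] [NormedSpace ℝ Z] {G : ℝ × ℝ → Z}
    (hd : Differentiable ℝ G) (t h : ℝ) :
    HasDerivAt (fun h => G (t, h)) (fderiv ℝ G (t, h) (0, 1)) h :=
  (hd (t, h)).hasFDerivAt.comp_hasDerivAt h ((hasDerivAt_const h t).prodMk (hasDerivAt_id h))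

/-- The converse of `hasDerivAt_of_pair`: a derivative of the orbit under translations is a weak
derivative. -/
theorem Realization.IsTranslation.pair_deriv {X E : Type*} [NormedAddCommGroup X]
    [NormedSpace ℝ X] [NormedAddCommGroup E] [NormedSpace ℝ E] {ρ : Realization X E}
    {τ : IsometryGroup X} (hτ : ρ.IsTranslation τ) {f f' : X}
    (hf : HasDerivAt (fun h => τ h f) f' 0) {χ : ℝ → ℝ} (hχ : IsTest χ) :
    ρ.pair (deriv χ) f = -ρ.pair χ f' := by
  have h1 := Realization.hasDerivAt_pair_comp_sub (ρ := ρ) hχ f 0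
  have h2 := (ρ.functional hχ).hasFDerivAt.comp_hasDerivAt (0 : ℝ) hf
  have h3 : (⇑(ρ.functional hχ) ∘ fun h => τ h f) = fun h => ρ.pair (fun x => χ (x + -h)) f := by
    funext h
    rw [← hτ.pair_apply]
    exact ρ.functional_apply hχ _
  rw [h3] at h2
  have h4 := h1.unique h2
  simp only [neg_zero, add_zero, ρ.functional_apply hχ] at h4
  rw [← h4, neg_neg]

theorem IsTest.iterate_pd {φ : ℝ × ℝ → ℝ} (hφ : IsTest φ) (μ : Fin 2) (k : ℕ) :
    IsTest ((MaxwellDirac.pd μ)^[k] φ) := by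
  induction k with
  | zero => exact hφ
  | succ k ih => rw [Function.iterate_succ_apply']; exact ih.pd μ

theorem tsupport_iterate_pd_subset (φ : ℝ × ℝ → ℝ) (μ : Fin 2) (k : ℕ) :
    tsupport ((pd μ)^[k] φ) ⊆ tsupport φ := by
  induction k with
  | zero => exact subset_rfl
  | succ k ih => rw [Function.iterate_succ_apply']; exact (tsupport_pd_subset _ _).trans ih

/-- Weak derivatives of a covariant function of class `Cᵐ`. -/
theorem exists_weak_mixedDeriv {X E : Type*} [NormedAddCommGroup X]
    [NormedSpace ℝ X] [NormedAddCommGroup E] [NormedSpace ℝ E] [CompleteSpace E]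
    {ρ : Realization X E} {τ : IsometryGroup X} (hτ : ρ.IsTranslation τ) (T : ℝ) (m : ℕ) :
    ∀ G : ℝ × ℝ → X, ContDiff ℝ m G → IsCovariant τ G → ∀ j k : ℕ, j + k = m →
    ∃ w : ℝ → X, Continuous w ∧ ∀ φ : ℝ × ℝ → ℝ, IsTest φ → tsupport φ ⊆ strip T →
      ρ.pairST T φ w =
        (-1 : ℝ) ^ (j + k) • ρ.pairST T ((pd 0)^[j] ((pd 1)^[k] φ)) fun t => G (t, 0) := by
  induction m with
  | zero =>
    intro G hG _ j k hjk
    obtain ⟨rfl, rfl⟩ : j = 0 ∧ k = 0 := by omega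
    exact ⟨fun t => G (t, 0), hG.continuous.comp (by fun_prop), fun φ _ _ => by simp⟩
  | succ m ih =>
    intro G hG hcov j k hjk
    have hd : Differentiable ℝ G := hG.differentiable (by simp)
    have hG' : ∀ v : ℝ × ℝ, ContDiff ℝ m fun p => fderiv ℝ G p v := fun v =>
      (hG.fderiv_right (m := m) (by simp)).clm_apply contDiff_const
    -- The outermost derivative is moved from the test function to `G`: a time derivative by
    -- integration by parts if there is one, otherwise an x-derivative, which by covariance is the
    -- derivative in the second variable.
    rcases j with _ | j
    · obtain ⟨k, rfl⟩ : ∃ l, k = l + 1 := ⟨k - 1, by omega⟩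
      obtain ⟨w, hw, h⟩ := ih _ (hG' (0, 1)) (hcov.fderiv_apply hd _) 0 k (by omega)
      refine ⟨w, hw, fun φ hφ hφT => ?_⟩
      rw [h φ hφ hφT, Function.iterate_zero_apply, Function.iterate_zero_apply,
        Function.iterate_succ_apply']
      have h1 : ρ.pairST T (pd 1 ((pd 1)^[k] φ)) (fun t => G (t, 0)) =
          -ρ.pairST T ((pd 1)^[k] φ) fun t => fderiv ℝ G (t, 0) (0, 1) := by
        rw [Realization.pairST, Realization.pairST, ← intervalIntegral.integral_neg]
        refine intervalIntegral.integral_congr fun t _ => ?_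
        have hχ := hφ.iterate_pd 1 k
        have h2 : HasDerivAt (fun h => τ h (G (t, 0))) (fderiv ℝ G (t, 0) (0, 1)) 0 := by
          have h3 := hasDerivAt_snd hd t 0
          simpa only [← hcov.apply] using h3
        refine Eq.trans ?_ (hτ.pair_deriv h2 (Realization.isTest_slice hχ t))
        congr 1
        funext x
        exact ((hasDerivAt_pd_one (hχ.contDiff.of_le (by simp)) t x).deriv).symm
      rw [h1, zero_add, zero_add, pow_succ, mul_neg_one, neg_smul, smul_neg, neg_neg]
    · obtain ⟨w, hw, h⟩ := ih _ (hG' (1, 0)) (hcov.fderiv_apply hd _) j k (by omega)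
      refine ⟨w, hw, fun φ hφ hφT => ?_⟩
      have hχ := (hφ.iterate_pd 1 k).iterate_pd 0 j
      have hχT := ((tsupport_iterate_pd_subset ((pd 1)^[k] φ) 0 j).trans
        (tsupport_iterate_pd_subset φ 1 k)).trans hφT
      rw [h φ hφ hφT, Function.iterate_succ_apply', ρ.pairST_pd_zero hχ hχT
        (fun t => hasDerivAt_fst hd t 0) ((hG' (1, 0)).continuous.comp (by fun_prop)),
        add_right_comm, pow_succ, mul_neg_one, neg_smul, smul_neg, neg_neg]

theorem pairStrip_eq_pairST {T : ℝ} (hT : 0 ≤ T) {φ : ℝ × ℝ → ℝ} (hφ : IsTest φ) (u : CX0 T)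
    {z : ℝ → State} (hu : ∀ t : Icc (-T) T, u t = ofState (z t)) :
    pairStrip u φ = realizationState.pairST T φ z := by
  rw [pairStrip_eq hT hφ.continuous hφ.hasCompactSupport]
  refine intervalIntegral.integral_congr fun t ht => ?_
  rw [uIcc_of_le (by linarith)] at ht
  simp only [extend_of_mem hT u ht, hu]
  rfl

/-- The solution and its translates, as a function of two variables. -/
def translates (M : ℝ) (z : State) (p : ℝ × ℝ) : State :=
  translationState p.2 ((mdSystem M).S p.1 (flow M z p.1))

theorem contDiff_translates {M : ℝ} {z : State} {m : ℕ}
    (hz : ContDiff ℝ m fun h => translationState h z) : ContDiff ℝ m (translates M z) :=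
  TransportSystem.contDiff_of_contDiff_orbit m (mdSystem M) (isIntegralCurve_flow M z)
    (by rw [flow_zero]; exact hz)

theorem isCovariant_translates (M : ℝ) (z : State) :
    IsCovariant translationState (translates M z) := by
  intro p h
  rw [translates, translates, ← translationState.map_add, add_comm h]
  simp

theorem translates_zero (M : ℝ) (z : State) (t : ℝ) :
    translates M z (t, 0) = (mdSystem M).S t (flow M z t) := translationState.map_zero _

theorem exists_isMixedDeriv {M T : ℝ} (hT : 0 ≤ T) {N : ℕ} {d : X0}
    (h : ∀ j ≤ N, ∃ e : X0, IsSpaceDeriv j d e) {j k : ℕ} (hjk : j + k ≤ N) :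
    ∃ w : CX0 T, IsMixedDeriv j k (solution M T d) w := by
  have h1 := contDiff_translates (M := M) (contDiff_orbit_of_isSpaceDeriv h)
  obtain ⟨w, hw, h2⟩ := exists_weak_mixedDeriv isTranslation_realizationState T (j + k)
    (translates M (toState d)) (h1.of_le (by exact_mod_cast hjk)) (isCovariant_translates M _) j k
    rfl
  refine ⟨⟨fun t => ofState (w t), ofState.continuous.comp (hw.comp continuous_subtype_val)⟩,
    fun φ => ?_⟩
  have hφ := testFunction_isTest φ
  rw [pairStrip_eq_pairST hT hφ _ (z := w) fun t => rfl, h2 φ hφ φ.tsupport_subset,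
    pairStrip_eq_pairST hT ((hφ.iterate_pd 1 k).iterate_pd 0 j) _
      (z := fun t => translates M (toState d) (t, 0)) fun t => ?_]
  rw [translates_zero]
  rfl

/-! ### Smooth approximation -/

/-- Averaging the translates of z against a smooth kernel gives a state whose orbit is the
convolution of the kernel with the orbit of z, hence smooth. It tends to z because the orbit is
continuous. -/
theorem exists_smooth_orbit_tendsto (z : State) : ∃ y : ℕ → State,
    (∀ n, ∀ m : ℕ, ContDiff ℝ m fun h => translationState h (y n)) ∧
      Tendsto y atTop (𝓝 z) := by
  let G : ℝ → State := fun h => translationState h z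
  have hG : Continuous G := translationState.continuous_orbit z
  let b : ℕ → ContDiffBump (0 : ℝ) := fun n =>
    ⟨1 / (n + 2), 1 / (n + 1), by positivity, one_div_lt_one_div_of_lt (by positivity) (by linarith)⟩
  let F : ℕ → ℝ → State := fun n =>
    convolution ((b n).normed volume) G (ContinuousLinearMap.lsmul ℝ ℝ) volume
  have hF : ∀ n h, translationState h (F n 0) = F n h := by
    intro n h
    have h1 : Integrable fun s => (b n).normed volume s • G (0 - s) :=
      ((b n).continuous_normed.smul (hG.comp (by fun_prop))).integrable_of_hasCompactSupport
        ((b n).hasCompactSupport_normed.smul_right)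
    change translationState h (∫ s, (b n).normed volume s • G (0 - s)) =
      ∫ s, (b n).normed volume s • G (h - s)
    rw [← ContinuousLinearMap.integral_comp_comm _ h1]
    refine integral_congr_ae (Eventually.of_forall fun s => ?_)
    simp only [map_smul, G]
    rw [← translationState.map_add, zero_sub, ← sub_eq_add_neg]
  refine ⟨fun n => F n 0, fun n m => ?_, ?_⟩
  · simp only [hF]
    exact (b n).hasCompactSupport_normed.contDiff_convolution_left _
      (b n).contDiff_normed hG.locallyIntegrable
  · have h1 : Tendsto (fun n => (b n).rOut) atTop (𝓝 0) :=
      tendsto_one_div_add_atTop_nhds_zero_nat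
    have h2 := ContDiffBump.convolution_tendsto_right_of_continuous (μ := volume) h1 hG 0
    have h3 : G 0 = z := translationState.map_zero z
    rwa [h3] at h2

open Realization

/-- Exchanging the order of two pairings of the translates of a function. -/
theorem integral_smul_pairL_translation (K : ℝ →ᵇ ℝ) (R : ℝ) {χ : ℝ → ℝ} (hχ : IsTest χ)
    (f : L2) : ∫ x, χ x • realizationL2.pairL R K (translationL2 x f) =
      ∫ y in Icc (-R) R, K y • realizationL2.pair χ (translationL2 y f) := by
  let ν : Measure ℝ := volume.restrict (Icc (-R) R)
  -- Fubini for this kernel: f(x + y) is both the translate by x evaluated at y and the translate by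
  -- y evaluated at x.
  let g : ℝ → ℝ → Spinor := fun x y => χ x • (K y • f (x + y))
  have hm : AEStronglyMeasurable (Function.uncurry g) (volume.prod ν) := by
    have h1 : StronglyMeasurable fun p : ℝ × ℝ => f (p.1 + p.2) :=
      (Lp.stronglyMeasurable f).comp_measurable (by fun_prop)
    exact ((hχ.continuous.comp continuous_fst).stronglyMeasurable.smul
      ((K.continuous.comp continuous_snd).stronglyMeasurable.smul h1)).aestronglyMeasurable
  obtain ⟨C, hC⟩ := hχ.hasCompactSupport.exists_bound_of_continuous hχ.continuous
  obtain ⟨r, hr⟩ := hχ.hasCompactSupport.isCompact.isBounded.exists_norm_le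
  obtain ⟨C', hC'⟩ := realizationL2.bound r
  have hfy : ∀ y, ∀ᵐ x, translationL2 y f x = f (x + y) := fun y => coeFn_translation (by simp) y f
  have hgi : ∀ y, Integrable fun x => g x y := by
    intro y
    have h1 := (realizationL2.integrable_smul hχ.continuous hχ.hasCompactSupport
      (translationL2 y f)).smul (K y)
    refine h1.congr ?_
    filter_upwards [hfy y] with x hx
    change K y • χ x • (translationL2 y f) x = χ x • (K y • f (x + y))
    rw [hx, smul_comm]
  have hint : Integrable (Function.uncurry g) (volume.prod ν) := by
    rw [integrable_prod_iff' hm]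
    refine ⟨Eventually.of_forall hgi, ?_⟩
    refine Integrable.of_bound (C := ‖K‖ * (C * (C' * ‖f‖))) hm.norm.prod_swap.integral_prod_right'
      (Eventually.of_forall fun y => ?_)
    rw [Real.norm_of_nonneg (integral_nonneg fun x => norm_nonneg _)]
    have h1 : ∀ x, x ∉ Icc (-r) r → ‖g x y‖ = 0 := by
      intro x hx
      have : χ x = 0 := image_eq_zero_of_notMem_tsupport fun h => hx (abs_le.1 (hr _ h))
      simp [g, this]
    have hC0 : 0 ≤ C := (norm_nonneg _).trans (hC 0)
    have i1 : IntegrableOn (fun x => ‖K‖ * (C * ‖(translationL2 y f) x‖)) (Icc (-r) r) :=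
      ((realizationL2.integrableOn (translationL2 y f) r).norm.const_mul C).const_mul ‖K‖
    calc ∫ x, ‖g x y‖ = ∫ x in Icc (-r) r, ‖g x y‖ :=
          (setIntegral_eq_integral_of_forall_compl_eq_zero h1).symm
      _ ≤ ∫ x in Icc (-r) r, ‖K‖ * (C * ‖(translationL2 y f) x‖) := by
        refine setIntegral_mono_ae (hgi y).norm.integrableOn i1 ?_
        filter_upwards [hfy y] with x hx
        change ‖χ x • (K y • f (x + y))‖ ≤ _
        rw [hx, norm_smul, norm_smul]
        have h2 := hC x
        have h3 := K.norm_coe_le_norm y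
        calc ‖χ x‖ * (‖K y‖ * ‖f (x + y)‖) ≤ C * (‖K‖ * ‖f (x + y)‖) := by gcongr
          _ = _ := by ring
      _ = ‖K‖ * (C * ∫ x in Icc (-r) r, ‖(translationL2 y f) x‖) := by
        rw [integral_const_mul, integral_const_mul]
      _ ≤ ‖K‖ * (C * (C' * ‖f‖)) := by
        have := hC' (translationL2 y f)
        rw [translationL2.norm_map] at this
        gcongr
        exact this
  have hswap := integral_integral_swap hint
  have e1 : ∀ x, χ x • realizationL2.pairL R K (translationL2 x f) = ∫ y, g x y ∂ν := by
    intro x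
    change χ x • ∫ y in Icc (-R) R, K y • (translationL2 x f) y = _
    rw [← integral_smul]
    refine integral_congr_ae (ae_restrict_of_ae ?_)
    filter_upwards [hfy x] with y hy
    change χ x • K y • (translationL2 x f) y = χ x • K y • f (x + y)
    rw [hy, add_comm]
  have e2 : ∀ y, K y • realizationL2.pair χ (translationL2 y f) = ∫ x, g x y := by
    intro y
    rw [pair, ← integral_smul]
    refine integral_congr_ae ?_
    filter_upwards [hfy y] with x hx
    change K y • χ x • (translationL2 y f) x = χ x • (K y • f (x + y))
    rw [hx, smul_comm]
  simp only [e1, e2]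
  exact hswap

/-- The weight `(1 + y) / 2`, cut off at distance one. -/
def weight : ℝ →ᵇ ℝ := BoundedContinuousFunction.ofNormedAddCommGroup
  (fun y => max (-1) (min y 1) / 2 + 1 / 2) (by fun_prop) 1 (fun y => by
    have h1 := le_max_left (-1) (min y 1)
    have h2 : max (-1) (min y 1) ≤ 1 := max_le (by norm_num) (min_le_right _ _)
    rw [Real.norm_eq_abs, abs_le]
    constructor <;> linarith)

theorem weight_of_mem {y : ℝ} (hy : y ∈ Icc (-1 : ℝ) 1) : weight y = (1 + y) / 2 := by
  change max (-1) (min y 1) / 2 + 1 / 2 = _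
  rw [min_eq_left hy.2, max_eq_right hy.1]
  ring

/-- The value at the right endpoint of a function on `[-1, 1]`, in terms of the function and its
derivative. -/
def endpoint (p : L2 × L2) : Spinor :=
  realizationL2.pairL 1 weight p.2 + realizationL2.pairL 1 (BoundedContinuousFunction.const ℝ (1 / 2)) p.1

theorem contDiff_endpoint {n : WithTop ℕ∞} : ContDiff ℝ n endpoint :=
  ((realizationL2.pairL 1 weight).contDiff.comp contDiff_snd).add
    ((realizationL2.pairL 1 (BoundedContinuousFunction.const ℝ (1 / 2))).contDiff.comp contDiff_fst)

/-- The weight (1 + y)/2 is 0 at -1 and 1 at 1, so f(1) is the integral over [-1, 1] of the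
derivative of ((1 + y)/2) f(y); applied to the translate by x - 1 this is f(x). The formula is
continuous and linear in f and f' in L², so smooth orbits give smooth representatives. As f is only
an L² class, the identity is proved after pairing with `χ`. -/
theorem ae_eq_endpoint {f f' : L2} (hf : HasDerivAt (fun h => translationL2 h f) f' 0) :
    f =ᵐ[volume] fun x => endpoint (translationL2 (x - 1) f, translationL2 (x - 1) f') := by
  have hτ : realizationL2.IsTranslation translationL2 := isTranslation_ofLp Spinor 2 (by simp)
  have hcf := translationL2.continuous_orbit f
  have hcf' := translationL2.continuous_orbit f'
  let c : ℝ →ᵇ ℝ := BoundedContinuousFunction.const ℝ (1 / 2)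
  have hc1 : Continuous fun x => realizationL2.pairL 1 weight (translationL2 x f') :=
    (realizationL2.pairL 1 weight).continuous.comp hcf'
  have hc2 : Continuous fun x => realizationL2.pairL 1 c (translationL2 x f) :=
    (realizationL2.pairL 1 c).continuous.comp hcf
  have hsub : Continuous fun x : ℝ => x - 1 := by fun_prop
  have hcont : Continuous fun x => endpoint (translationL2 (x - 1) f, translationL2 (x - 1) f') :=
    (hc1.comp hsub).add (hc2.comp hsub)
  refine realizationL2.ae_eq_of_pair_eq hcont.locallyIntegrable fun χ hχ => ?_
  have hχ1 : IsTest fun x => χ (x + 1) := hχ.comp_add 1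
  -- The tested counterpart of y ↦ f(x + y): a differentiable function of y whose value at 1 is the
  -- pairing of f with χ, to which the fundamental theorem applies.
  let p : ℝ → Spinor := fun y => realizationL2.pair (fun x => χ (x + 1)) (translationL2 y f)
  let p' : ℝ → Spinor := fun y => realizationL2.pair (fun x => χ (x + 1)) (translationL2 y f')
  have hp : ∀ y, HasDerivAt p (p' y) y := by
    intro y
    have h1 := (realizationL2.functional hχ1).hasFDerivAt.comp_hasDerivAt y
      (translationL2.hasDerivAt_orbit hf y)
    simp only [realizationL2.functional_apply hχ1] at h1
    refine h1.congr_of_eventuallyEq (Eventually.of_forall fun y => ?_)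
    exact (realizationL2.functional_apply hχ1 _).symm
  have hp'c : Continuous p' := by
    simp only [p', ← realizationL2.functional_apply hχ1]
    exact (realizationL2.functional hχ1).continuous.comp hcf'
  have hpc : Continuous p := continuous_iff_continuousAt.2 fun y => (hp y).continuousAt
  have e1 : realizationL2.pair χ f = p 1 := by
    change _ = realizationL2.pair (fun x => χ (x + 1)) (translationL2 1 f)
    exact (realizationL2.pair_comp_sub (hτ 1 f) χ).symm
  have e2 : ∫ x, χ x • endpoint (translationL2 (x - 1) f, translationL2 (x - 1) f') =
      (∫ x, χ (x + 1) • realizationL2.pairL 1 weight (translationL2 x f')) +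
      ∫ x, χ (x + 1) • realizationL2.pairL 1 c (translationL2 x f) := by
    rw [← integral_add_right_eq_self _ (1 : ℝ), ← integral_add]
    · refine integral_congr_ae (Eventually.of_forall fun x => ?_)
      simp only [endpoint, add_sub_cancel_right, smul_add, c]
    · exact (hχ1.continuous.smul hc1).integrable_of_hasCompactSupport
        hχ1.hasCompactSupport.smul_right
    · exact (hχ1.continuous.smul hc2).integrable_of_hasCompactSupport
        hχ1.hasCompactSupport.smul_right
  have hq : ∀ y, HasDerivAt (fun y => ((1 + y) / 2) • p y)
      (((1 + y) / 2) • p' y + (1 / 2 : ℝ) • p y) y := by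
    intro y
    have h1 : HasDerivAt (fun y : ℝ => (1 + y) / 2) (1 / 2) y :=
      ((hasDerivAt_id y).const_add 1).div_const 2
    exact h1.smul (hp y)
  have i1 : Continuous fun y : ℝ => ((1 + y) / 2) • p' y :=
    (by fun_prop : Continuous fun y : ℝ => (1 + y) / 2).smul hp'c
  have i2 : Continuous fun y => (1 / 2 : ℝ) • p y := hpc.const_smul (1 / 2 : ℝ)
  have h1 := intervalIntegral.integral_eq_sub_of_hasDerivAt (a := -1) (b := 1)
    (fun y _ => hq y) ((i1.add i2).intervalIntegrable _ _)
  rw [intervalIntegral.integral_add (i1.intervalIntegrable _ _) (i2.intervalIntegrable _ _)] at h1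
  have h2 : ((1 + (1 : ℝ)) / 2) • p 1 - ((1 + (-1 : ℝ)) / 2) • p (-1) = p 1 := by norm_num
  have hle : (-1 : ℝ) ≤ 1 := by norm_num
  rw [h2, intervalIntegral.integral_of_le hle, intervalIntegral.integral_of_le hle,
    ← integral_Icc_eq_integral_Ioc, ← integral_Icc_eq_integral_Ioc] at h1
  rw [e1, e2, integral_smul_pairL_translation weight 1 hχ1, integral_smul_pairL_translation c 1 hχ1,
    ← h1]
  congr 1
  exact setIntegral_congr_fun measurableSet_Icc fun y hy => by
    change ((1 + y) / 2) • p' y = weight y • p' y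
    rw [weight_of_mem hy]

/-- Solutions whose data have smooth orbits are smooth. -/
theorem isSmooth_solution {M T : ℝ} {d : X0}
    (hd : ∀ m : ℕ, ContDiff ℝ m fun h => translationState h (toState d)) :
    IsSmooth (solution M T d) := by
  let z := toState d
  let V : ℝ × ℝ → State := translates M z
  have hV : ContDiff ℝ ∞ V := contDiff_infty.2 fun m => contDiff_translates (hd m)
  have hVd : Differentiable ℝ V := hV.differentiable (by simp)
  have hcov : IsCovariant translationState V := isCovariant_translates M z
  have hV' : ∀ v : ℝ × ℝ, ContDiff ℝ ∞ fun p => fderiv ℝ V p v := fun v =>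
    (hV.fderiv_right (m := ∞) (by simp)).clm_apply contDiff_const
  have hcov' : ∀ v : ℝ × ℝ, IsCovariant translationState fun p => fderiv ℝ V p v := fun v =>
    hcov.fderiv_apply hVd v
  have hsol : ∀ t : Icc (-T) T, solution M T d t = ofState (V (t, 0)) := by
    intro t
    rw [solution_apply]
    exact congrArg ofState (translates_zero M z t).symm
  -- The value of A_μ at 0 is a continuous functional of the state, and the value at x is that
  -- functional on the translate by x. Hence A_μ(t, x) is a smooth function of (t, x).
  let a : Fin 2 → State →L[ℝ] ℝ := fun μ =>
    BoundedContinuousFunction.evalCLM ℝ (0 : ℝ) ∘L potential ∘L State.pot μ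
  have ha : ∀ μ w x, a μ (translationState x w) = potential (State.pot μ w) x := by
    intro μ w x
    refine (potential_pot_translation μ x w 0).trans ?_
    rw [zero_add]
  have hA : ∀ μ t x, pd 0 (fun p => a μ (V p)) (t, x) = a μ (fderiv ℝ V (t, x) (1, 0)) := by
    intro μ t x
    have h1 := ((a μ).hasFDerivAt.comp (t, x) (hVd (t, x)).hasFDerivAt).fderiv
    exact congrArg (fun A : ℝ × ℝ →L[ℝ] ℝ => A (1, 0)) h1
  refine ⟨fun p => endpoint ((V (p.1, p.2 - 1)).1, (fderiv ℝ V (p.1, p.2 - 1) (0, 1)).1),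
    fun μ p => a μ (V p), ?_, fun μ => (a μ).contDiff.comp hV, fun t => ⟨?_, fun μ => ⟨?_, ?_⟩⟩⟩
  · have h1 : ContDiff ℝ ∞ fun p : ℝ × ℝ => (p.1, p.2 - 1) :=
      contDiff_fst.prodMk (contDiff_snd.sub contDiff_const)
    exact contDiff_endpoint.comp ((contDiff_fst.comp (hV.comp h1)).prodMk
      (contDiff_fst.comp ((hV' (0, 1)).comp h1)))
  · have h1 : HasDerivAt (fun h => translationL2 h (V (t, 0)).1)
        (fderiv ℝ V ((t : ℝ), 0) (0, 1)).1 0 := by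
      have h2 := (ContinuousLinearMap.fst ℝ L2 _).hasFDerivAt.comp_hasDerivAt (0 : ℝ)
        (hasDerivAt_snd hVd t 0)
      refine h2.congr_of_eventuallyEq (Eventually.of_forall fun h => ?_)
      exact (congrArg Prod.fst (hcov.apply t h)).symm
    rw [hsol]
    refine (ae_eq_endpoint h1).trans (Eventually.of_forall fun x => ?_)
    have h3 := congrArg Prod.fst (hcov.apply t (x - 1))
    have h4 := congrArg Prod.fst ((hcov' (0, 1)).apply t (x - 1))
    simp only [h3, h4]
    rfl
  · funext x
    rw [hsol]
    exact ((congrArg (a μ) (hcov.apply t x)).trans (ha μ _ x)).symm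
  · rw [hsol]
    let B : ℝ → L1 := fun s => (ofState (V (s, 0))).2.2 μ
    let A : ℝ → Y := fun s => (ofState (V (s, 0))).2.1 μ
    have hv : Continuous fun s => ofState (V (s, 0)) :=
      ofState.continuous.comp (hV.continuous.comp (by fun_prop))
    have hBc : Continuous B := (continuous_apply μ).comp hv.snd.snd
    have hAc : Continuous A := (continuous_apply μ).comp hv.snd.fst
    have hVt : ∀ s, V (s, 0) = (mdSystem M).S s (flow M z s) := translates_zero M z
    have hfn : ∀ s x, pd 0 (fun p => a μ (V p)) (s, x) =
        (Y.ofDeriv (State.pot μ (fderiv ℝ V (s, 0) (1, 0)))).fn x := by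
      intro s x
      rw [hA, (hcov' (1, 0)).apply, ha]
      rfl
    have hcont : Continuous fun x => pd 0 (fun p => a μ (V p)) ((t : ℝ), x) := by
      simp only [hA]
      exact (a μ).continuous.comp ((hV' (1, 0)).continuous.comp (by fun_prop))
    refine realizationL1.ae_eq_of_pair_eq hcont.locallyIntegrable fun χ hχ => ?_
    let σ : Realization State ℝ := (ofY.comap Y.ofDeriv).comap (State.pot μ)
    -- To identify B with ∂ₜA, the time derivative of the pairing of A with χ is computed twice:
    -- from the smooth curve of states here, and from the velocity equation in `h5`.
    have h1 : HasDerivAt (fun s => ofY.pair χ (A s)) (σ.pair χ (fderiv ℝ V ((t : ℝ), 0) (1, 0))) t := by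
      have h2 := (σ.functional hχ).hasFDerivAt.comp_hasDerivAt (t : ℝ) (hasDerivAt_fst hVd t 0)
      rw [σ.functional_apply hχ] at h2
      refine h2.congr_of_eventuallyEq (Eventually.of_forall fun s => ?_)
      exact (σ.functional_apply hχ _).symm
    have hTt : 0 < |(t : ℝ)| + 1 := by positivity
    have h3 := pair_eq_add_integral_of_velocity hTt hAc hBc (fun φ hφ hφT => by
      have h4 := pairST_velocity (isIntegralCurve_flow M z) hφ hφT μ
      simp only [← hVt] at h4
      exact h4) hχ
    have c2 : Continuous fun s => realizationL1.pair χ (B s) := by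
      simp only [← realizationL1.functional_apply hχ]
      exact (realizationL1.functional hχ).continuous.comp hBc
    have h5 : HasDerivAt (fun s => ofY.pair χ (A s)) (realizationL1.pair χ (B t)) t := by
      refine ((c2.integral_hasStrictDerivAt 0 t).hasDerivAt.const_add
        (ofY.pair χ (A 0))).congr_of_eventuallyEq ?_
      have h6 : Icc (-(|(t : ℝ)| + 1)) (|(t : ℝ)| + 1) ∈ 𝓝 (t : ℝ) :=
        Icc_mem_nhds (by linarith [neg_abs_le (t : ℝ)]) (by linarith [le_abs_self (t : ℝ)])
      filter_upwards [h6] with s hs using h3 s hs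
    change realizationL1.pair χ (B t) = _
    rw [h5.unique h1]
    simp only [hfn]
    rfl

theorem exists_smooth_approximation (M : ℝ) {T : ℝ} (hT : 0 ≤ T) (d : X0) : ∃ d' : ℕ → X0,
    (∀ n, IsSmooth (solution M T (d' n))) ∧
      Tendsto (fun n => solution M T (d' n)) atTop (𝓝 (solution M T d)) := by
  obtain ⟨y, hy, hlim⟩ := exists_smooth_orbit_tendsto (toState d)
  refine ⟨fun n => ofState (y n), fun n => isSmooth_solution fun m => ?_, ?_⟩
  · rw [toState_ofState]
    exact hy n m
  · have h1 := (ofState.continuous.tendsto (toState d)).comp hlim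
    rw [ofState_toState] at h1
    exact ((continuous_solution M hT).tendsto d).comp h1

end

end MaxwellDirac

theorem theorem1 (M T : ℝ) (hT : 0 < T) :
    ∃ S : MaxwellDirac.X0 → MaxwellDirac.CX0 T,
      -- existence and uniqueness of the solution in `C([-T, T]; X₀)`
      (∀ d : MaxwellDirac.X0, MaxwellDirac.IsSolution hT M d (S d) ∧
        ∀ u : MaxwellDirac.CX0 T, MaxwellDirac.IsSolution hT M d u → u = S d) ∧
      -- continuity of the data-to-solution map
      Continuous S ∧
      -- persistence of higher regularity
      (∀ (N : ℕ) (d : MaxwellDirac.X0),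
        (∀ j ≤ N, ∃ e : MaxwellDirac.X0, MaxwellDirac.IsSpaceDeriv j d e) →
        ∀ j k : ℕ, j + k ≤ N →
          ∃ w : MaxwellDirac.CX0 T, MaxwellDirac.IsMixedDeriv j k (S d) w) ∧
      -- approximation by smooth solutions
      (∀ d : MaxwellDirac.X0,
        ∃ (d' : ℕ → MaxwellDirac.X0) (u : ℕ → MaxwellDirac.CX0 T),
          (∀ n, MaxwellDirac.IsSolution hT M (d' n) (u n) ∧ MaxwellDirac.IsSmooth (u n)) ∧
          Tendsto u atTop (𝓝 (S d))) := by
  refine ⟨MaxwellDirac.solution M T, fun d => ⟨MaxwellDirac.isSolution_solution M hT d,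
    fun u hu => hu.unique (MaxwellDirac.isSolution_solution M hT d)⟩,
    MaxwellDirac.continuous_solution M hT.le,
    fun N d hd j k hjk => MaxwellDirac.exists_isMixedDeriv hT.le hd hjk, fun d => ?_⟩
  obtain ⟨d', h, hlim⟩ := MaxwellDirac.exists_smooth_approximation M hT.le d
  exact ⟨d', fun n => MaxwellDirac.solution M T (d' n),
    fun n => ⟨MaxwellDirac.isSolution_solution M hT (d' n), h n⟩, hlim⟩
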